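/- Let $G=\mathrm{PSL}_4(\mathbb{Z})$ act by $A\mapsto PAP^t$ on the space $S^4_{>0}$ of positive definite real symmetric $4\times 4$ matrices. For $A\in S^4_{>0}$ put $A[v]=v^tAv$, $\min(A)=\min_{0\ne v\in\mathbb{Z}^4}A[v]$ and $\mathrm{Min}(A)=\{v\in\mathbb{Z}^4: A[v]=\min(A)\}$. Let $X$ be the well-rounded retract, that is, the set of all $A\in S^4_{>0}$ with $\min(A)=1$ for which $\mathrm{Min}(A)$ contains four linearly independent vectors, with its polyhedral cell structure: the closed cells are the nonempty faces, contained in $X$, of the Ryshkov polyhedron $\{A\in S^4_{>0}:\min(A)\ge 1\}$ (a face being the set where the inequalities $A[v]\ge 1$, $v\in V$, become equalities for some set $V$ of integer vectors). For a cell $e$ let $G^e$ be its (setwise) stabilizer in $G$, and let $\mathbb{Z}^\rho$ be $\mathbb{Z}$ on which $g\in G^e$ acts by $+1$ or $-1$ according to whether $g$ preserves or reverses the orientation of $e$. For an abelian group $H$ write $H_{(5)}$ for its $5$-primary part, the subgroup of elements killed by a power of $5$. At the prime $5$, the equivariant (Leray) spectral sequence of $G$ acting on $X$, whose first page is $$E^1_{p,q}=\bigoplus_{[e^p]}H_q(G^{e^p},\mathbb{Z}^\rho)_{(5)}\qquad(p,q\ge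 0),$$ the sum being over the $G$-orbits of $p$-dimensional cells $e^p$ of $X$, satisfies $$E^1_{p,q}\cong\begin{cases}\mathbb{Z}/5 & p=0,\ q=3+4k,\\ \mathbb{Z}/5 & p=5,\ q=3+4k,\\ 0&\text{otherwise}\end{cases}\qquad(k\ge 0).$$ Moreover, these entries come from the two $A_5$ stabilizers: in each of the dimensions $p=0$ and $p=5$ there is exactly one $G$-orbit of $p$-cells whose stabilizer is isomorphic to the alternating group $A_5$, and whenever $H_q(G^{e},\mathbb{Z}^\rho)_{(5)}\neq 0$ for a cell $e$ of $X$ and some $q\ge 0$, the cell $e$ has dimension $0$ or $5$ and $G^e\cong A_5$. -/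

import Mathlib

open scoped Matrix MatrixGroups

noncomputable section

namespace WellRounded

/-! ### Positive definite forms, the arithmetical minimum, well-rounded forms -/

/-- An integer vector, seen as a real vector. -/
def toReal {n : ℕ} (v : Fin n → ℤ) : Fin n → ℝ := fun i => (v i : ℝ)

/-- The value `A[v] = vᵗ A v` of the quadratic form `A` at the integer vector `v`. -/
def formValue {n : ℕ} (A : Matrix (Fin n) (Fin n) ℝ) (v : Fin n → ℤ) : ℝ :=
  toReal v ⬝ᵥ (A *ᵥ toReal v)

/-- The arithmetical minimum `min(A)`, the least value of `A[v]` over nonzero integer vectors `v`.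
It is only used for positive definite `A`, for which the infimum is attained (for `n ≥ 1`). -/
def arithMin {n : ℕ} (A : Matrix (Fin n) (Fin n) ℝ) : ℝ :=
  ⨅ v : {v : Fin n → ℤ // v ≠ 0}, formValue A v

/-- `Min(A)`: the integer vectors that represent the arithmetical minimum. -/
def minVectors {n : ℕ} (A : Matrix (Fin n) (Fin n) ℝ) : Set (Fin n → ℤ) :=
  {v | formValue A v = arithMin A}

/-- The positive definite symmetric real matrices with arithmetical minimum `1`. -/
def minOneForms (n : ℕ) : Set (Matrix (Fin n) (Fin n) ℝ) :=
  {A | A.PosDef ∧ arithMin A = 1}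

/-- The well-rounded retract: the forms of arithmetical minimum `1` whose minimal vectors
contain `n` linearly independent ones. -/
def wellRoundedForms (n : ℕ) : Set (Matrix (Fin n) (Fin n) ℝ) :=
  {A | A ∈ minOneForms n ∧ ∃ v : Fin n → (Fin n → ℤ),
    (∀ i, v i ∈ minVectors A) ∧ LinearIndependent ℝ (fun i => toReal (v i))}

/-! ### The polyhedral cell structure -/

/-- The Ryshkov polyhedron: the locally finite polyhedral set of all positive definite forms with
arithmetical minimum at least `1`; its facets are given by equations `A[v] = 1`. -/
def ryshkov (n : ℕ) : Set (Matrix (Fin n) (Fin n) ℝ) :=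
  {A | A.PosDef ∧ 1 ≤ arithMin A}

/-- The face of the Ryshkov polyhedron on which the inequalities `A[v] ≥ 1`, `v ∈ V`, are
equalities. -/
def face {n : ℕ} (V : Set (Fin n → ℤ)) : Set (Matrix (Fin n) (Fin n) ℝ) :=
  {A | A ∈ ryshkov n ∧ ∀ v ∈ V, formValue A v = 1}

/-- A (closed) cell of the well-rounded retract: a nonempty face of the Ryshkov polyhedron that
consists of well-rounded forms. -/
def IsCell {n : ℕ} (C : Set (Matrix (Fin n) (Fin n) ℝ)) : Prop :=
  C.Nonempty ∧ C ⊆ wellRoundedForms n ∧ ∃ V : Set (Fin n → ℤ), C = face V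

/-- The dimension of a cell, that is, of its affine span. -/
def cellDim {n : ℕ} (C : Set (Matrix (Fin n) (Fin n) ℝ)) : ℕ :=
  Module.finrank ℝ (vectorSpan ℝ C)

/-- The `p`-dimensional cells of the well-rounded retract. -/
def Cell (n p : ℕ) : Type :=
  {C : Set (Matrix (Fin n) (Fin n) ℝ) // IsCell C ∧ cellDim C = p}

/-! ### The action of `PSL_n(ℤ)` -/

/-- An integral matrix of determinant one, seen as a real matrix. -/
def realMat {n : ℕ} (P : SL(n, ℤ)) : Matrix (Fin n) (Fin n) ℝ :=
  (P : Matrix (Fin n) (Fin n) ℤ).map (Int.castRingHom ℝ)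

theorem realMat_one {n : ℕ} : realMat (1 : SL(n, ℤ)) = 1 := by
  simp [realMat]

theorem realMat_mul {n : ℕ} (P Q : SL(n, ℤ)) : realMat (P * Q) = realMat P * realMat Q := by
  simp only [realMat, Matrix.SpecialLinearGroup.coe_mul, Matrix.map_mul]

/-- The linear action `A ↦ P A Pᵗ` of `SL_n(ℤ)` on real matrices. -/
def slRep (n : ℕ) : Representation ℝ SL(n, ℤ) (Matrix (Fin n) (Fin n) ℝ) where
  toFun P :=
    { toFun := fun A => realMat P * A * (realMat P)ᵀ
      map_add' := fun A B => by rw [mul_add, add_mul]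
      map_smul' := fun r A => by simp }
  map_one' := by
    ext1 A
    simp [realMat_one]
  map_mul' P Q := by
    ext1 A
    simp [realMat_mul, Matrix.mul_assoc]

theorem slRep_center {n : ℕ} (P : SL(n, ℤ)) (hP : P ∈ Subgroup.center SL(n, ℤ)) :
    slRep n P = 1 := by
  obtain ⟨r, hr, h⟩ := Matrix.SpecialLinearGroup.mem_center_iff.1 hP
  rcases Nat.eq_zero_or_pos n with rfl | hn
  · ext A i
    exact i.elim0
  have hu : IsUnit r := IsUnit.of_pow_eq_one hr (by simpa using hn.ne')
  have hm : realMat P = (r : ℝ) • (1 : Matrix (Fin n) (Fin n) ℝ) := by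
    ext i j
    rw [realMat, ← h, Matrix.scalar_apply]
    by_cases hij : i = j
    · subst hij
      rw [Matrix.map_apply, Matrix.diagonal_apply_eq]
      simp
    · rw [Matrix.map_apply, Matrix.diagonal_apply_ne _ hij]
      simp [hij]
  have hr2 : (r : ℝ) * r = 1 := by
    rcases Int.isUnit_iff.1 hu with rfl | rfl <;> norm_num
  ext1 A
  change realMat P * A * (realMat P)ᵀ = A
  simp [hm, smul_smul, hr2]

/-- The linear action of `PSL_n(ℤ)` on real matrices induced by `A ↦ P A Pᵗ`. -/
def pslRep (n : ℕ) : Representation ℝ PSL(n, ℤ) (Matrix (Fin n) (Fin n) ℝ) :=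
  QuotientGroup.lift (Subgroup.center SL(n, ℤ)) (slRep n) (fun P hP => slRep_center P hP)

theorem pslRep_mk {n : ℕ} (P : SL(n, ℤ)) (A : Matrix (Fin n) (Fin n) ℝ) :
    pslRep n (P : PSL(n, ℤ)) A = realMat P * A * (realMat P)ᵀ := rfl

theorem formValue_conj {n : ℕ} (P : SL(n, ℤ)) (A : Matrix (Fin n) (Fin n) ℝ) (v : Fin n → ℤ) :
    formValue (realMat P * A * (realMat P)ᵀ) v =
      formValue A ((P : Matrix (Fin n) (Fin n) ℤ)ᵀ *ᵥ v) := by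
  have h : toReal ((P : Matrix (Fin n) (Fin n) ℤ)ᵀ *ᵥ v) = (realMat P)ᵀ *ᵥ toReal v := by
    ext i
    simp [toReal, realMat, Matrix.mulVec, dotProduct]
  rw [formValue, formValue, h, ← Matrix.mulVec_mulVec, ← Matrix.mulVec_mulVec,
    Matrix.dotProduct_mulVec, ← Matrix.mulVec_transpose]

/-- The transpose of an element of `SL_n(ℤ)` as a permutation of `ℤⁿ`. -/
def transEquiv {n : ℕ} (P : SL(n, ℤ)) : (Fin n → ℤ) ≃ (Fin n → ℤ) where
  toFun v := (P : Matrix (Fin n) (Fin n) ℤ)ᵀ *ᵥ v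
  invFun v := ((P⁻¹ : SL(n, ℤ)) : Matrix (Fin n) (Fin n) ℤ)ᵀ *ᵥ v
  left_inv v := by
    have h : (P : Matrix (Fin n) (Fin n) ℤ) * ((P⁻¹ : SL(n, ℤ)) : Matrix (Fin n) (Fin n) ℤ) = 1 := by
      rw [← Matrix.SpecialLinearGroup.coe_mul, mul_inv_cancel, Matrix.SpecialLinearGroup.coe_one]
    change ((P⁻¹ : SL(n, ℤ)) : Matrix (Fin n) (Fin n) ℤ)ᵀ *ᵥ ((P : Matrix (Fin n) (Fin n) ℤ)ᵀ *ᵥ v) = v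
    rw [Matrix.mulVec_mulVec, ← Matrix.transpose_mul, h, Matrix.transpose_one, Matrix.one_mulVec]
  right_inv v := by
    have h : ((P⁻¹ : SL(n, ℤ)) : Matrix (Fin n) (Fin n) ℤ) * (P : Matrix (Fin n) (Fin n) ℤ) = 1 := by
      rw [← Matrix.SpecialLinearGroup.coe_mul, inv_mul_cancel, Matrix.SpecialLinearGroup.coe_one]
    change (P : Matrix (Fin n) (Fin n) ℤ)ᵀ *ᵥ (((P⁻¹ : SL(n, ℤ)) : Matrix (Fin n) (Fin n) ℤ)ᵀ *ᵥ v) = v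
    rw [Matrix.mulVec_mulVec, ← Matrix.transpose_mul, h, Matrix.transpose_one, Matrix.one_mulVec]

theorem transEquiv_ne_zero {n : ℕ} (P : SL(n, ℤ)) (v : Fin n → ℤ) :
    v ≠ 0 ↔ transEquiv P v ≠ 0 := by
  have h0 : transEquiv P 0 = 0 :=
    Matrix.mulVec_zero (P : Matrix (Fin n) (Fin n) ℤ)ᵀ
  rw [Ne, Ne, ← (transEquiv P).injective.eq_iff (a := v) (b := 0), h0]

theorem toReal_transEquiv {n : ℕ} (P : SL(n, ℤ)) (v : Fin n → ℤ) :
    toReal (transEquiv P v) = (realMat P)ᵀ *ᵥ toReal v := by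
  ext i
  simp [toReal, transEquiv, realMat, Matrix.mulVec, dotProduct]

theorem arithMin_conj {n : ℕ} (P : SL(n, ℤ)) (A : Matrix (Fin n) (Fin n) ℝ) :
    arithMin (realMat P * A * (realMat P)ᵀ) = arithMin A := by
  unfold arithMin
  refine Equiv.iInf_congr ((transEquiv P).subtypeEquiv (transEquiv_ne_zero P)) (fun v => ?_)
  exact (formValue_conj P A v).symm

theorem realMat_mul_inv {n : ℕ} (P : SL(n, ℤ)) : realMat P * realMat P⁻¹ = 1 := by
  rw [← realMat_mul, mul_inv_cancel, realMat_one]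

theorem realMat_inv_mul {n : ℕ} (P : SL(n, ℤ)) : realMat P⁻¹ * realMat P = 1 := by
  rw [← realMat_mul, inv_mul_cancel, realMat_one]

theorem posDef_conj {n : ℕ} (P : SL(n, ℤ)) {A : Matrix (Fin n) (Fin n) ℝ} (hA : A.PosDef) :
    (realMat P * A * (realMat P)ᵀ).PosDef := by
  have hu : IsUnit (realMat P) := IsUnit.of_mul_eq_one _ (realMat_mul_inv P)
  have h := (Matrix.IsUnit.posDef_star_right_conjugate_iff hu).2 hA
  rwa [Matrix.star_eq_conjTranspose, Matrix.conjTranspose_eq_transpose_of_trivial] at h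

theorem wellRounded_conj {n : ℕ} (P : SL(n, ℤ)) {A : Matrix (Fin n) (Fin n) ℝ}
    (hA : A ∈ wellRoundedForms n) : realMat P * A * (realMat P)ᵀ ∈ wellRoundedForms n := by
  obtain ⟨⟨hpd, hmin⟩, v, hv, hli⟩ := hA
  refine ⟨⟨posDef_conj P hpd, by rw [arithMin_conj, hmin]⟩,
    fun i => (transEquiv P).symm (v i), fun i => ?_, ?_⟩
  · change formValue _ _ = arithMin _
    rw [formValue_conj, arithMin_conj]
    change formValue A (transEquiv P ((transEquiv P).symm (v i))) = _
    rw [Equiv.apply_symm_apply]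
    exact hv i
  · refine LinearIndependent.of_comp ((realMat P)ᵀ).mulVecLin ?_
    convert hli using 1
    funext i
    change (realMat P)ᵀ *ᵥ toReal ((transEquiv P).symm (v i)) = _
    rw [← toReal_transEquiv, Equiv.apply_symm_apply]

theorem ryshkov_conj {n : ℕ} (P : SL(n, ℤ)) {A : Matrix (Fin n) (Fin n) ℝ}
    (hA : A ∈ ryshkov n) : realMat P * A * (realMat P)ᵀ ∈ ryshkov n :=
  ⟨posDef_conj P hA.1, by rw [arithMin_conj]; exact hA.2⟩

theorem isCell_image {n : ℕ} (g : PSL(n, ℤ)) {C : Set (Matrix (Fin n) (Fin n) ℝ)}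
    (hC : IsCell C) : IsCell (pslRep n g '' C) := by
  obtain ⟨P, rfl⟩ := QuotientGroup.mk_surjective g
  obtain ⟨hne, hwr, V, rfl⟩ := hC
  refine ⟨hne.image _, ?_, transEquiv P ⁻¹' V, ?_⟩
  · rintro _ ⟨A, hA, rfl⟩
    exact wellRounded_conj P (hwr hA)
  · ext B
    constructor
    · rintro ⟨A, hA, rfl⟩
      refine ⟨ryshkov_conj P hA.1, fun v hv => ?_⟩
      rw [pslRep_mk, formValue_conj]
      exact hA.2 _ hv
    · intro hB
      have key : realMat P * (realMat P⁻¹ * B * (realMat P⁻¹)ᵀ) * (realMat P)ᵀ = B := by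
        have h2 : (realMat P⁻¹)ᵀ * (realMat P)ᵀ = 1 := by
          rw [← Matrix.transpose_mul, realMat_mul_inv, Matrix.transpose_one]
        calc realMat P * (realMat P⁻¹ * B * (realMat P⁻¹)ᵀ) * (realMat P)ᵀ
            = (realMat P * realMat P⁻¹) * B * ((realMat P⁻¹)ᵀ * (realMat P)ᵀ) := by
              simp only [Matrix.mul_assoc]
          _ = B := by rw [realMat_mul_inv, h2, one_mul, mul_one]
      refine ⟨realMat P⁻¹ * B * (realMat P⁻¹)ᵀ, ⟨ryshkov_conj _ hB.1, fun v hv => ?_⟩, ?_⟩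
      · have h3 := formValue_conj P (realMat P⁻¹ * B * (realMat P⁻¹)ᵀ) ((transEquiv P).symm v)
        rw [key] at h3
        change _ = formValue _ (transEquiv P ((transEquiv P).symm v)) at h3
        rw [Equiv.apply_symm_apply] at h3
        rw [← h3]
        exact hB.2 _ (by simpa using hv)
      · rw [pslRep_mk, key]

theorem vectorSpan_image {n : ℕ} (g : PSL(n, ℤ)) (C : Set (Matrix (Fin n) (Fin n) ℝ)) :
    vectorSpan ℝ (pslRep n g '' C) = (vectorSpan ℝ C).map (pslRep n g) :=
  (AffineMap.map_vectorSpan (s := C) (pslRep n g).toAffineMap).symm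

theorem pslRep_injective {n : ℕ} (g : PSL(n, ℤ)) : Function.Injective (pslRep n g) := by
  refine Function.LeftInverse.injective (g := pslRep n g⁻¹) (fun A => ?_)
  rw [← Module.End.mul_apply, ← map_mul, inv_mul_cancel, map_one, Module.End.one_apply]

theorem cellDim_image {n : ℕ} (g : PSL(n, ℤ)) (C : Set (Matrix (Fin n) (Fin n) ℝ)) :
    cellDim (pslRep n g '' C) = cellDim C := by
  rw [cellDim, vectorSpan_image]
  exact (LinearEquiv.finrank_eq (Submodule.equivMapOfInjective _ (pslRep_injective g) _)).symm

/-- `PSL_n(ℤ)` permutes the `p`-cells of the well-rounded retract, `C ↦ g C`. -/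
instance cellAction (n p : ℕ) : MulAction PSL(n, ℤ) (Cell n p) where
  smul g C := ⟨pslRep n g '' C.1, isCell_image g C.2.1, (cellDim_image g C.1).trans C.2.2⟩
  one_smul C := Subtype.ext <| by
    change pslRep n 1 '' C.1 = C.1
    rw [map_one]
    exact Set.image_id _
  mul_smul g h C := Subtype.ext <| by
    change pslRep n (g * h) '' C.1 = pslRep n g '' (pslRep n h '' C.1)
    rw [map_mul, Set.image_image]
    rfl

theorem coe_smul_cell {n p : ℕ} (g : PSL(n, ℤ)) (C : Cell n p) :
    (g • C).1 = pslRep n g '' C.1 := rfl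

/-- The stabilizer (as a set) of a cell in `PSL_n(ℤ)`. -/
abbrev cellStabilizer {n p : ℕ} (C : Cell n p) : Subgroup PSL(n, ℤ) :=
  MulAction.stabilizer PSL(n, ℤ) C

/-- The set of `PSL_n(ℤ)`-orbits of `p`-cells. -/
abbrev CellOrbit (n p : ℕ) : Type :=
  MulAction.orbitRel.Quotient PSL(n, ℤ) (Cell n p)

/-! ### The orientation character of a cell stabilizer -/

theorem stabilizer_le_comap {n p : ℕ} (C : Cell n p) (g : cellStabilizer C) :
    vectorSpan ℝ C.1 ≤
      (vectorSpan ℝ C.1).comap (((pslRep n).comp (cellStabilizer C).subtype) g) := by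
  rw [← Submodule.map_le_iff_le_comap]
  change (vectorSpan ℝ C.1).map (pslRep n (g : PSL(n, ℤ))) ≤ _
  rw [← vectorSpan_image, ← coe_smul_cell, MulAction.mem_stabilizer_iff.1 g.2]

/-- The stabilizer of a cell acts linearly on the tangent space (the direction of the affine span)
of the cell. -/
def tangentRep {n p : ℕ} (C : Cell n p) :
    Representation ℝ (cellStabilizer C) (vectorSpan ℝ C.1) :=
  Representation.subrepresentation ((pslRep n).comp (cellStabilizer C).subtype)
    (vectorSpan ℝ C.1) (stabilizer_le_comap C)

/-- The orientation character: `1` if the group element preserves the orientation of the cell,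
`-1` if it reverses it (the sign of the determinant on the tangent space). -/
def orientationChar {n p : ℕ} (C : Cell n p) : cellStabilizer C →* ℤ :=
  (SignType.castHom (α := ℤ)).toMonoidHom.comp
    ((signHom (α := ℝ)).toMonoidHom.comp (LinearMap.det.comp (tangentRep C)))

/-- The module `ℤ^ρ`: the integers, on which the stabilizer of the cell acts through the
orientation character. -/
def orientationModule {n p : ℕ} (C : Cell n p) : Rep ℤ (cellStabilizer C) :=
  Rep.of ((Module.toModuleEnd ℤ (S := ℤ) ℤ).toMonoidHom.comp (orientationChar C))

/-! ### The first page of the spectral sequence -/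

/-- `H_q(G^e, ℤ^ρ)_(ℓ)`: the `ℓ`-primary part of the group homology of the stabilizer of a cell with
coefficients in its orientation module. -/
abbrev cellTerm (ℓ : ℕ) {n p : ℕ} (C : Cell n p) (q : ℕ) : Type :=
  AddCommGroup.primaryComponent (groupHomology (orientationModule C) q) ℓ

/-- The entry `E¹_{p,q}`, at the prime `ℓ`, of the spectral sequence of `PSL_n(ℤ)` acting on the
well-rounded retract: the direct sum of `H_q(G^e, ℤ^ρ)_(ℓ)`, where `e` runs through representatives
of the orbits of `p`-cells. -/
abbrev E1 (ℓ n p q : ℕ) : Type :=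
  DirectSum (CellOrbit n p) (fun o => cellTerm ℓ (Quotient.out o) q)

end WellRounded

end

/-!
The proof separates a homological computation for the alternating group `A₅` from the determination
of the cells with a symmetry of order five.

*Reduction to elements of order five.* A cell stabilizer is finite, since it permutes the finitely
many minimal vectors of a generic form in the cell. If it contains no element of order five, then
its order is prime to `5`; as the order of a finite group kills the higher homology with
coefficients in `ℤ^ρ` and the torsion of the coinvariants, the `5`-primary part of its homology
vanishes (`cellTerm_subsingleton`). Hence only cells with a symmetry of order five contribute.

*The cells with a symmetry of order five.* Averaging gives a generic form `A` in such a cell that is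
itself invariant under an element of order five. The orbit `v₀, …, v₄` of a minimal vector of `A`
sums to zero, because the minimal polynomial of the symmetry is the fifth cyclotomic polynomial, and
in the coordinates `yᵢ` with respect to this orbit `A` is `p * cyc₁ y + q * cyc₂ y`, the sums of the
squared differences along the pentagon and along the pentagram, with `p, q ≥ 0` and `p + q = 1 / 2`
(`exists_isPentagonal`). An averaging argument over the residue classes shows that the `vᵢ` span the
lattice (`IsPentagonal.exists_eq_sum`). If `p` and `q` are positive, the minimal vectors are exactly
the `±vᵢ`, and the cell is equivalent to the five-dimensional `superbaseCell`; if one of them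
vanishes, the form is equivalent to that of the root lattice `A₄`, which is a vertex, `rootCell`
(`exists_eq_image_of_orderOf_eq_five`). Both stabilizers consist of the matrices that permute
the vectors of the standard superbase evenly, up to a common sign (or of their contragredients), and
are therefore isomorphic to `A₅` (`nonempty_stabilizer_rootCell`,
`nonempty_stabilizer_superbaseCell`).

*The homology of `A₅` at the prime `5`.* As `A₅` is perfect, the orientation character of these two
cells is trivial. The augmented chain complex of the boundary of the `4`-simplex gives an exact
sequence `0 → ℤ → ℤ⁵ → Λ → Λ → ℤ⁵ → ℤ → 0` of `A₅`-modules, where `Λ` consists of the alternating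
functions on pairs of letters. Multiplication by `12` on `ℤ⁵` and by `6` on `Λ` factors through the
free module of rank one (`Rep.FreeUpTo`), so that these modules are acyclic at `5` and the homology
is periodic with period four (`AltFive.periodicity`). Dimension shifting reduces degrees one, two
and three to coinvariants, and in degree three these are `ℤ / 5` (`AltFive.coinvariantsEquiv`).
-/

section

open CategoryTheory

/-! ### Primary components of abelian groups -/

namespace AddCommGroup

variable {A B : Type*} [AddCommGroup A] [AddCommGroup B]

theorem primaryComponent_subsingleton {p : ℕ} (h : ∀ x : A, p • x = 0 → x = 0) :
    Subsingleton (primaryComponent A p) := by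
  have key : ∀ (k : ℕ) (x : A), p ^ k • x = 0 → x = 0 := by
    intro k
    induction k with
    | zero => intro x hx; simpa using hx
    | succ k ih =>
      intro x hx
      rw [pow_succ, mul_smul] at hx
      exact h x (ih _ hx)
  refine ⟨fun x y => Subtype.ext ?_⟩
  obtain ⟨k, hk⟩ := x.2
  obtain ⟨l, hl⟩ := y.2
  rw [key k _ hk, key l _ hl]

theorem eq_zero_of_coprime_smul {m n : ℕ} (hmn : m.Coprime n) {x : A} (hm : m • x = 0)
    (hn : n • x = 0) : x = 0 := by
  have h1 := addOrderOf_dvd_iff_nsmul_eq_zero.2 hm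
  have h2 := addOrderOf_dvd_iff_nsmul_eq_zero.2 hn
  have h3 := Nat.dvd_gcd h1 h2
  rw [hmn.gcd_eq_one, Nat.dvd_one] at h3
  exact AddMonoid.addOrderOf_eq_one_iff.1 h3

/-- An additive map induces a map on `p`-primary components. -/
def primaryComponentMap (p : ℕ) (f : A →+ B) : primaryComponent A p →+ primaryComponent B p :=
  (f.comp (primaryComponent A p).subtype).codRestrict (primaryComponent B p) fun x => by
    obtain ⟨k, hk⟩ := x.2
    exact ⟨k, by simpa using congrArg f hk⟩

/-- A homomorphism whose kernel is killed by an integer prime to `p`, and whose image contains a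
prime-to-`p` multiple of every `p`-primary element, is an isomorphism on `p`-primary components. -/
noncomputable def primaryComponentEquiv {p n : ℕ} (hn : n.Coprime p) (f : A →+ B)
    (hinj : ∀ x, f x = 0 → n • x = 0)
    (hsurj : ∀ y ∈ primaryComponent B p, ∃ x, f x = n • y) :
    primaryComponent A p ≃+ primaryComponent B p :=
  AddEquiv.ofBijective (primaryComponentMap p f) <| by
    constructor
    · refine (injective_iff_map_eq_zero _).2 fun x hx => Subtype.ext ?_
      obtain ⟨k, hk⟩ := x.2
      exact eq_zero_of_coprime_smul (hn.pow_right k) (hinj _ (congrArg Subtype.val hx)) hk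
    · rintro ⟨y, k, hk⟩
      obtain ⟨x, hx⟩ := hsurj y ⟨k, hk⟩
      have hfx : f (p ^ k • x) = 0 := by
        rw [map_nsmul, hx, smul_comm, hk, smul_zero]
      have hxk : n • x ∈ primaryComponent A p :=
        ⟨k, by rw [smul_comm]; exact hinj _ hfx⟩
      -- The image of `n • x` is `n ^ 2 • y`, and `n ^ 2` is invertible modulo the order of `y`.
      obtain ⟨u, hu⟩ : ∃ u : ℤ, u • (n * n) • y = y := by
        have hc : IsCoprime ((n * n : ℕ) : ℤ) ((p ^ k : ℕ) : ℤ) :=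
          Nat.isCoprime_iff_coprime.2
            (Nat.Coprime.mul_left (hn.pow_right k) (hn.pow_right k))
        obtain ⟨a, b, hab⟩ := hc
        refine ⟨a, ?_⟩
        have h2 : (b * ((p ^ k : ℕ) : ℤ)) • y = 0 := by
          rw [mul_smul, natCast_zsmul, hk, smul_zero]
        have h1 : (a * ((n * n : ℕ) : ℤ)) • y + (b * ((p ^ k : ℕ) : ℤ)) • y = y := by
          rw [← add_smul, hab, one_smul]
        rwa [h2, add_zero, mul_smul, natCast_zsmul] at h1
      refine ⟨u • ⟨n • x, hxk⟩, Subtype.ext ?_⟩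
      change f (u • n • x) = y
      rw [map_zsmul, map_nsmul, hx, ← mul_smul, hu]

/-- Isomorphic groups have isomorphic `p`-primary components. -/
noncomputable def primaryComponentCongr (p : ℕ) (e : A ≃+ B) :
    primaryComponent A p ≃+ primaryComponent B p :=
  primaryComponentEquiv (n := 1) (Nat.coprime_one_left p) e.toAddMonoidHom
    (fun x hx => by simpa using hx)
    (fun y _ => ⟨e.symm y, by simp⟩)

end AddCommGroup

/-! ### Group homology and averaging maps -/

namespace groupHomology

variable {k G : Type} [CommRing k] [Group G]

theorem map_add {A B : Rep k G} (φ ψ : A ⟶ B) (n : ℕ) :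
    (functor k G n).map (φ + ψ) = (functor k G n).map φ + (functor k G n).map ψ := by
  have h : (chainsFunctor k G).map (φ + ψ) =
      (chainsFunctor k G).map φ + (chainsFunctor k G).map ψ :=
    HomologicalComplex.hom_ext _ _ fun _ =>
      ModuleCat.hom_ext (LinearMap.ext fun _ => Finsupp.ext fun _ => rfl)
  exact (congrArg (fun t => HomologicalComplex.homologyMap t n) h).trans
    (HomologicalComplex.homologyMap_add _ _ _)

instance (n : ℕ) : (functor k G n).Additive where
  map_add := map_add _ _ n

end groupHomology

namespace Rep

variable {k G : Type} [CommRing k] [Group G]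

variable (k G) in
/-- The free `k[G]`-module of rank one, in the form of the representation induced from the trivial
representation of the trivial subgroup. -/
noncomputable abbrev freeOne : Rep k G :=
  ind (⊥ : Subgroup G).subtype (Rep.trivial k (⊥ : Subgroup G) k)

/-- The morphism from the free module of rank one sending the generator to `m`. -/
noncomputable def ofFreeOne {M : Rep k G} (m : M) : freeOne k G ⟶ M :=
  (indResHomEquiv (⊥ : Subgroup G).subtype (Rep.trivial k (⊥ : Subgroup G) k) M).symm
    (Rep.ofHom ⟨LinearMap.toSpanSingleton k M m, fun g => by
      obtain rfl := Subsingleton.elim g 1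
      ext; simp⟩)

theorem ofFreeOne_mk {M : Rep k G} (m : M) (h : G) (r : k) :
    (ofFreeOne m).hom (Representation.IndV.mk (⊥ : Subgroup G).subtype
      (Rep.trivial k (⊥ : Subgroup G) k).ρ h r) = r • M.ρ h⁻¹ m := by
  simp [ofFreeOne]

variable [Fintype G]

/-- The morphism to the free module of rank one determined by a linear functional. -/
noncomputable def toFreeOne {M : Rep k G} (φ : M →ₗ[k] k) : M ⟶ freeOne k G :=
  Rep.ofHom ⟨∑ g : G, Representation.IndV.mk (⊥ : Subgroup G).subtype
      (Rep.trivial k (⊥ : Subgroup G) k).ρ g ∘ₗ φ ∘ₗ M.ρ g, fun h => by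
    ext m
    simp only [LinearMap.comp_apply, LinearMap.sum_apply, map_sum]
    refine (Fintype.sum_equiv (Equiv.mulRight h) _ _ fun g => ?_)
    have h1 := Representation.ind_mk (⊥ : Subgroup G).subtype
      (Rep.trivial k (⊥ : Subgroup G) k).ρ h (g * h) (φ (M.ρ (g * h) m))
    rw [mul_inv_cancel_right] at h1
    refine Eq.trans ?_ h1.symm
    rw [map_mul]
    rfl⟩

/-- The averaging morphism `m ↦ ∑ φ(g m) g⁻¹ m'`. -/
noncomputable def average {M M' : Rep k G} (φ : M →ₗ[k] k) (m' : M') : M ⟶ M' :=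
  toFreeOne φ ≫ ofFreeOne m'

theorem average_apply {M M' : Rep k G} (φ : M →ₗ[k] k) (m' : M') (m : M) :
    (average φ m').hom m = ∑ g : G, φ (M.ρ g m) • M'.ρ g⁻¹ m' := by
  simp only [average, toFreeOne, hom_comp]
  change (ofFreeOne m').hom ((∑ g : G, Representation.IndV.mk (⊥ : Subgroup G).subtype
      (Rep.trivial k (⊥ : Subgroup G) k).ρ g ∘ₗ φ ∘ₗ M.ρ g) m) = _
  rw [LinearMap.sum_apply, map_sum]
  exact Finset.sum_congr rfl fun g _ => ofFreeOne_mk m' g _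

/-- `M` is *free up to `N`* if multiplication by `N` on `M` factors through a free module of rank
one. By `average_apply`, this is a statement about averages over the group; for example the
permutation module on the cosets of a finite subgroup is free up to the order of the subgroup. -/
def FreeUpTo (M : Rep k G) (N : ℕ) : Prop :=
  ∃ (φ : M →ₗ[k] k) (m' : M), ∀ m : M, ∑ g : G, φ (M.ρ g m) • M.ρ g⁻¹ m' = N • m

end Rep

namespace groupHomology

section

variable {k G : Type} [CommRing k] [Group G]

theorem map_nsmul_id (M : Rep k G) (N n : ℕ) (x : groupHomology M n) :
    (functor k G n).map (N • 𝟙 M) x = N • x := by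
  rw [Functor.map_nsmul, CategoryTheory.Functor.map_id]
  induction N with
  | zero => simp; rfl
  | succ N ih =>
    rw [succ_nsmul, succ_nsmul, ← ih]
    rfl

theorem isZero_freeOne (n : ℕ) : Limits.IsZero (groupHomology (Rep.freeOne k G) (n + 1)) := by
  classical
  exact (isZero_groupHomology_succ_of_subsingleton _ n).of_iso (indIso _ _ _)

theorem freeOne_torsionFree [CharZero k] [NoZeroDivisors k] {p : ℕ} (hp : p ≠ 0) (n : ℕ)
    (x : groupHomology (Rep.freeOne k G) n) (hx : p • x = 0) : x = 0 := by
  classical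
  cases n with
  | succ n =>
    have := ModuleCat.subsingleton_of_isZero (isZero_freeOne (k := k) (G := G) n)
    exact Subsingleton.elim _ _
  | zero =>
    let e := (indIso (⊥ : Subgroup G) (Rep.trivial k (⊥ : Subgroup G) k) 0 ≪≫
      H0IsoOfIsTrivial _).toLinearEquiv
    refine e.injective ?_
    have h1 : p • (e x : k) = 0 := (map_nsmul e p x).symm.trans (by rw [hx, map_zero])
    rw [map_zero]
    rw [nsmul_eq_mul] at h1
    exact (mul_eq_zero.1 h1).resolve_left (Nat.cast_ne_zero.2 hp)

variable [Fintype G]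

theorem _root_.Rep.FreeUpTo.nsmul_eq {M : Rep k G} {N : ℕ} (h : M.FreeUpTo N) (n : ℕ) :
    ∃ (f : groupHomology M n →+ groupHomology (Rep.freeOne k G) n)
      (f' : groupHomology (Rep.freeOne k G) n →+ groupHomology M n), ∀ x, f' (f x) = N • x := by
  obtain ⟨φ, m', h⟩ := h
  have h1 : Rep.toFreeOne φ ≫ Rep.ofFreeOne m' = N • 𝟙 M := by
    ext m
    exact (Rep.average_apply φ m' m).trans (h m)
  refine ⟨((functor k G n).map (Rep.toFreeOne φ)).hom.toAddMonoidHom,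
    ((functor k G n).map (Rep.ofFreeOne m')).hom.toAddMonoidHom, fun x => ?_⟩
  rw [← map_nsmul_id, ← h1, Functor.map_comp]
  rfl

theorem _root_.Rep.FreeUpTo.nsmul_eq_zero {M : Rep k G} {N : ℕ} (h : M.FreeUpTo N) (n : ℕ)
    (x : groupHomology M (n + 1)) : N • x = 0 := by
  obtain ⟨f, f', hf⟩ := h.nsmul_eq (n + 1)
  have := ModuleCat.subsingleton_of_isZero (isZero_freeOne (k := k) (G := G) n)
  rw [← hf, Subsingleton.elim (f x) 0, map_zero]

variable [CharZero k] [NoZeroDivisors k]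

theorem _root_.Rep.FreeUpTo.torsionFree {M : Rep k G} {N p : ℕ} (h : M.FreeUpTo N) (hp : p ≠ 0)
    (hN : N.Coprime p) (n : ℕ) (x : groupHomology M n) (hx : p • x = 0) : x = 0 := by
  obtain ⟨f, f', hf⟩ := h.nsmul_eq n
  refine AddCommGroup.eq_zero_of_coprime_smul hN ?_ hx
  rw [← hf, freeOne_torsionFree hp n (f x) (by rw [← map_nsmul, hx, map_zero]), map_zero]

/-- Dimension shifting at `p`: if the middle term of a short exact sequence is free up to an
integer prime to `p`, then the connecting homomorphism is an isomorphism on `p`-primary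
components. This includes degree zero on the right, because the homology of the middle term has no
`p`-torsion there either. -/
noncomputable def shift {X : ShortComplex (Rep k G)} (hX : X.ShortExact) {N p : ℕ}
    (h : X.X₂.FreeUpTo N) (hp : p ≠ 0) (hN : N.Coprime p) (n : ℕ) :
    AddCommGroup.primaryComponent (groupHomology X.X₃ (n + 1)) p ≃+
      AddCommGroup.primaryComponent (groupHomology X.X₁ n) p :=
  AddCommGroup.primaryComponentEquiv hN (δ hX (n + 1) n rfl).hom.toAddMonoidHom
    (fun x hx => by
      obtain ⟨y, hy⟩ : ∃ y : groupHomology X.X₂ (n + 1),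
          ((functor k G (n + 1)).map X.g).hom y = x :=
        (ShortComplex.moduleCat_exact_iff _).1 (mapShortComplex₃_exact hX (j := n) rfl) x hx
      refine (congrArg (N • ·) hy).symm.trans ?_
      refine (map_nsmul ((functor k G (n + 1)).map X.g).hom N y).symm.trans ?_
      exact (congrArg _ (h.nsmul_eq_zero n y)).trans (map_zero _))
    (fun y ⟨j, hj⟩ => by
      have := AddCommGroup.primaryComponent_subsingleton (h.torsionFree hp hN n)
      have hy : (functor k G n).map X.f y = 0 := by
        refine congrArg Subtype.val (Subsingleton.elim
          (⟨_, j, ?_⟩ : AddCommGroup.primaryComponent (groupHomology X.X₂ n) p) 0)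
        exact (map_nsmul ((functor k G n).map X.f).hom _ _).symm.trans
          ((congrArg _ hj).trans (map_zero _))
      obtain ⟨x, hx⟩ : ∃ x : groupHomology X.X₃ (n + 1), (δ hX (n + 1) n rfl).hom x = y :=
        (ShortComplex.moduleCat_exact_iff _).1 (mapShortComplex₁_exact hX (j := n) rfl) y hy
      exact ⟨N • x, (map_nsmul (δ hX (n + 1) n rfl).hom N x).trans (congrArg (N • ·) hx)⟩)

end

end groupHomology

/-- A rank one representation of a finite group through a sign character is free up to the order of
the group. -/
theorem Rep.freeUpTo_card {G : Type} [Group G] [Fintype G] (χ : G →* ℤ) :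
    (Rep.of ((Module.toModuleEnd ℤ (S := ℤ) ℤ).toMonoidHom.comp χ) : Rep ℤ G).FreeUpTo
      (Fintype.card G) := by
  refine ⟨LinearMap.id, (1 : ℤ), fun m => ?_⟩
  change ∑ g : G, (χ g * m) * (χ g⁻¹ * 1) = Fintype.card G • (m : ℤ)
  have h : ∀ g : G, (χ g * m) * (χ g⁻¹ * 1) = m := fun g => by
    have h1 : χ g * χ g⁻¹ = 1 := by rw [← map_mul, mul_inv_cancel, map_one]
    linear_combination (m : ℤ) * h1
  rw [Finset.sum_congr rfl fun g _ => h g, Finset.sum_const, Finset.card_univ]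

end

/-! ### Kernels of representations and coinvariants -/

section

open CategoryTheory

namespace Rep

variable {k G : Type} [CommRing k] [Group G]

/-- A pair of morphisms of representations that is exact on underlying modules. -/
theorem shortExact_of_exact {A B C : Rep k G} (f : A ⟶ B) (g : B ⟶ C) (w : f ≫ g = 0)
    (hf : Function.Injective f.hom) (hg : Function.Surjective g.hom)
    (h : ∀ b : B, g.hom b = 0 → ∃ a : A, f.hom a = b) : (ShortComplex.mk f g w).ShortExact where
  exact := (forget₂ (Rep k G) (ModuleCat k)).reflects_exact_of_faithful _ <|
    (ShortComplex.moduleCat_exact_iff _).2 h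
  mono_f := (Rep.mono_iff_injective _).2 hf
  epi_g := (Rep.epi_iff_surjective _).2 hg

theorem ker_le_comap {A B : Rep k G} (f : A ⟶ B) (g : G) :
    LinearMap.ker f.hom.toLinearMap ≤ (LinearMap.ker f.hom.toLinearMap).comap (A.ρ g) := by
  intro a ha
  change f.hom (A.ρ g a) = 0
  rw [hom_comm_apply, show f.hom a = 0 from ha, map_zero]

/-- The kernel of a morphism of representations, as a representation. -/
noncomputable abbrev kerRep {A B : Rep k G} (f : A ⟶ B) : Rep k G :=
  Rep.of (A.ρ.subrepresentation (LinearMap.ker f.hom.toLinearMap) (ker_le_comap f))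

/-- The inclusion of the kernel. -/
noncomputable def kerι {A B : Rep k G} (f : A ⟶ B) : kerRep f ⟶ A :=
  Rep.ofHom ⟨Submodule.subtype _, fun g => by ext; rfl⟩

/-- A morphism that composes to zero with `f` factors through the kernel of `f`. -/
noncomputable def kerLift {A B C : Rep k G} (f : A ⟶ B) (h : C ⟶ A)
    (w : ∀ c, f.hom (h.hom c) = 0) : C ⟶ kerRep f :=
  Rep.ofHom ⟨h.hom.toLinearMap.codRestrict _ w, fun g => by
    ext c
    exact hom_comm_apply h g c⟩

/-- If `A ⟶ B ⟶ C` is exact at `B`, then `0 → ker f → A → ker g → 0` is a short exact sequence. -/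
theorem shortExact_ker {A B C : Rep k G} (f : A ⟶ B) (g : B ⟶ C)
    (w : ∀ a, g.hom (f.hom a) = 0) (h : ∀ b, g.hom b = 0 → ∃ a, f.hom a = b) :
    (ShortComplex.mk (kerι f) (kerLift g f w)
      (by
        refine Rep.hom_ext (DFunLike.ext _ _ fun a => Subtype.ext a.2))).ShortExact :=
  shortExact_of_exact _ _ _ (fun a b hab => Subtype.ext hab)
    (fun b => by
      obtain ⟨a, ha⟩ := h b.1 b.2
      exact ⟨a, Subtype.ext ha⟩)
    (fun b hb => ⟨⟨b, congrArg Subtype.val hb⟩, rfl⟩)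

end Rep

namespace groupHomology

variable {k G : Type} [CommRing k] [Group G]

theorem H0π_ρ (M : Rep k G) (g : G) (m : M) : H0π M (M.ρ g m) = H0π M m := by
  have h := (H0Iso M).toLinearEquiv.injective
  apply h
  have h1 : ∀ x, (H0Iso M).toLinearEquiv (H0π M x) = Representation.Coinvariants.mk M.ρ x :=
    fun x => H0π_comp_H0Iso_hom_apply M x
  rw [h1, h1]
  simp

theorem H0π_surjective (M : Rep k G) : Function.Surjective (H0π M) :=
  (ModuleCat.epi_iff_surjective _).1 inferInstance

/-- If the generator `m'` of a module that is free up to `N` is reversed by a group element, then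
twice `N` kills the coinvariants. -/
theorem nsmul_H0_eq_zero [Fintype G] {M : Rep k G} {N : ℕ} {φ : M →ₗ[k] k} {m' : M}
    (h : ∀ m : M, ∑ g : G, φ (M.ρ g m) • M.ρ g⁻¹ m' = N • m) {s : G} (hs : M.ρ s m' = -m')
    (x : groupHomology M 0) : (2 * N) • x = 0 := by
  obtain ⟨m, rfl⟩ := H0π_surjective M x
  have h2 : H0π M m' + H0π M m' = 0 := by
    nth_rewrite 2 [← H0π_ρ M s]
    rw [hs, map_neg, add_neg_cancel]
  rw [mul_smul, ← map_nsmul, ← h m, map_sum, Finset.smul_sum]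
  refine Finset.sum_eq_zero fun g _ => ?_
  rw [map_smul, H0π_ρ, two_smul, ← smul_add, h2, smul_zero]

/-- An integer that kills the coinvariants of a module kills the coinvariants of its quotients. -/
theorem nsmul_H0_eq_zero_of_surjective {M M' : Rep k G} (f : M ⟶ M')
    (hf : Function.Surjective f.hom) {N : ℕ} (h : ∀ x : groupHomology M 0, N • x = 0)
    (x : groupHomology M' 0) : N • x = 0 := by
  have := (Rep.epi_iff_surjective f).2 hf
  obtain ⟨y, rfl⟩ := (ModuleCat.epi_iff_surjective ((functor k G 0).map f)).1
    (inferInstanceAs (Epi (map (MonoidHom.id G) f 0))) x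
  exact (map_nsmul ((functor k G 0).map f).hom N y).symm.trans
    ((congrArg _ (h y)).trans (map_zero _))

end groupHomology

/-! ### The chain complex of the boundary of the 4-simplex -/

namespace AltFive

open Finset

/-- The alternating group on five letters. -/
abbrev A5 : Type := alternatingGroup (Fin 5)

/-- The permutation representation on `ℤ⁵`. -/
def permRep : Representation ℤ A5 (Fin 5 → ℤ) where
  toFun g := LinearMap.funLeft ℤ ℤ (g⁻¹).1
  map_one' := rfl
  map_mul' g h := by
    refine LinearMap.ext fun x => funext fun i => ?_
    simp [LinearMap.funLeft]

/-- The alternating functions on pairs of letters. -/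
def skew : Submodule ℤ (Fin 5 → Fin 5 → ℤ) where
  carrier := {M | ∀ i j, M i j = -M j i}
  add_mem' hM hN i j := by
    change _ + _ = -(_ + _)
    rw [hM i j, hN i j, neg_add]
  zero_mem' i j := rfl
  smul_mem' c M hM i j := by
    change c * _ = -(c * _)
    rw [hM i j, mul_neg]

/-- The representation of the alternating group on the alternating functions. -/
def skewRep : Representation ℤ A5 skew where
  toFun g :=
    { toFun := fun M => ⟨fun i j => M.1 ((g⁻¹).1 i) ((g⁻¹).1 j), fun i j => M.2 _ _⟩
      map_add' := fun M N => rfl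
      map_smul' := fun c M => rfl }
  map_one' := rfl
  map_mul' g h := by
    ext1 x
    refine Subtype.ext ?_
    funext i j
    simp

/-- The permutation module `ℤ⁵`. -/
abbrev P : Rep ℤ A5 := Rep.of permRep

/-- The module `Λ` of alternating functions on pairs. -/
abbrev S : Rep ℤ A5 := Rep.of skewRep

/-- The trivial module. -/
abbrev Z : Rep ℤ A5 := Rep.trivial ℤ A5 ℤ

theorem skew_self (M : skew) (i : Fin 5) : M.1 i i = 0 := by
  have := M.2 i i
  omega

theorem skew_sum_apply {ι : Type*} (s : Finset ι) (f : ι → S) (i j : Fin 5) :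
    ((∑ g ∈ s, f g : S) : skew).1 i j = ∑ g ∈ s, (f g : skew).1 i j := by
  refine (congrFun (congrFun (map_sum skew.subtype f s) i) j).trans ?_
  rw [Finset.sum_apply, Finset.sum_apply]
  rfl

/-- The sum of the coordinates. -/
def total : P ⟶ Z :=
  Rep.ofHom ⟨∑ i, LinearMap.proj i, fun g => by
    refine LinearMap.ext fun x => ?_
    simp only [LinearMap.comp_apply, LinearMap.sum_apply, LinearMap.proj_apply]
    exact (Equiv.sum_comp (g⁻¹).1 (x : Fin 5 → ℤ)).trans (by simp)⟩

theorem total_apply (x : P) : total.hom x = ∑ i, (x : Fin 5 → ℤ) i := by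
  change (∑ i, LinearMap.proj i : (Fin 5 → ℤ) →ₗ[ℤ] ℤ) x = _
  simp

/-- The row sums of an alternating function. -/
def rowSum : S ⟶ P :=
  Rep.ofHom ⟨
    { toFun := fun M i => ∑ j, M.1 i j
      map_add' := fun M N => by
        funext i
        exact Finset.sum_add_distrib
      map_smul' := fun c M => by
        funext i
        exact (Finset.mul_sum _ _ _).symm }, fun g => by
    ext1 M
    funext i
    exact Equiv.sum_comp (g⁻¹).1 (M.1 ((g⁻¹).1 i))⟩

theorem rowSum_apply (M : S) (i : Fin 5) :
    (rowSum.hom M : Fin 5 → ℤ) i = ∑ j, (M : skew).1 i j := rfl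

/-- The coboundary of a function on letters. -/
def grad : P ⟶ S :=
  Rep.ofHom ⟨
    { toFun := fun x => ⟨fun i j => x i - x j, fun i j => (neg_sub _ _).symm⟩
      map_add' := fun x y => by
        refine Subtype.ext ?_
        funext i j
        exact add_sub_add_comm _ _ _ _
      map_smul' := fun c x => by
        refine Subtype.ext ?_
        funext i j
        exact (mul_sub _ _ _).symm }, fun g => rfl⟩

theorem grad_apply (x : P) (i j : Fin 5) :
    (grad.hom x : skew).1 i j = (x : Fin 5 → ℤ) i - (x : Fin 5 → ℤ) j := rfl

/-- The constant functions. -/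
def const : Z ⟶ P :=
  Rep.ofHom ⟨LinearMap.toSpanSingleton ℤ (Fin 5 → ℤ) 1, fun g => by
    ext; rfl⟩

theorem const_apply (c : ℤ) (i : Fin 5) : (const.hom c : Fin 5 → ℤ) i = c := mul_one c

theorem exists_swap : ∃ s : A5, s.1 0 = 1 ∧ s.1 1 = 0 ∧ s.1 2 = 2 ∧ s.1 3 = 4 ∧ s.1 4 = 3 := by
  decide +kernel

theorem exists_swap' : ∃ s : A5, s.1 0 = 0 ∧ s.1 1 = 2 ∧ s.1 2 = 1 ∧ s.1 3 = 4 ∧ s.1 4 = 3 := by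
  decide +kernel

/-- The sum of `F l m` over all even arrangements `i, j, k, l, m` of the five letters. -/
def evenSum (F : Fin 5 → Fin 5 → ℤ) (i j : Fin 5) : ℤ :=
  ∑ g : A5, if g.1 0 = i ∧ g.1 1 = j then F (g.1 3) (g.1 4) else 0

theorem evenSum_skew (M : skew) (i j : Fin 5) : evenSum M.1 i j = -evenSum M.1 j i := by
  obtain ⟨s, h0, h1, -, h3, h4⟩ := exists_swap
  rw [evenSum, evenSum, ← Equiv.sum_comp (Equiv.mulRight s), ← Finset.sum_neg_distrib]
  refine Finset.sum_congr rfl fun g _ => ?_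
  simp only [Equiv.coe_mulRight, Subgroup.coe_mul, Equiv.Perm.mul_apply, h0, h1, h3, h4]
  rw [M.2]
  by_cases h : g.1 1 = i ∧ g.1 0 = j
  · rw [if_pos h, if_pos h.symm]
  · rw [if_neg h, if_neg (mt And.symm h), neg_zero]

theorem evenSum_add (F F' : Fin 5 → Fin 5 → ℤ) (i j : Fin 5) :
    evenSum (F + F') i j = evenSum F i j + evenSum F' i j := by
  rw [evenSum, evenSum, evenSum, ← Finset.sum_add_distrib]
  refine Finset.sum_congr rfl fun g _ => ?_
  split_ifs
  · rfl
  · rfl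

theorem evenSum_smul (c : ℤ) (F : Fin 5 → Fin 5 → ℤ) (i j : Fin 5) :
    evenSum (c • F) i j = c * evenSum F i j := by
  rw [evenSum, evenSum, Finset.mul_sum]
  refine Finset.sum_congr rfl fun g _ => ?_
  rw [mul_ite, mul_zero]
  rfl

theorem evenSum_comp (h : A5) (F : Fin 5 → Fin 5 → ℤ) (i j : Fin 5) :
    evenSum (fun a b => F ((h⁻¹).1 a) ((h⁻¹).1 b)) i j =
      evenSum F ((h⁻¹).1 i) ((h⁻¹).1 j) := by
  refine Fintype.sum_equiv (Equiv.mulLeft h⁻¹) _ _ fun g => ?_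
  simp only [Equiv.coe_mulLeft, Subgroup.coe_mul, Equiv.Perm.mul_apply]
  have : ∀ a b : Fin 5, (h⁻¹).1 a = (h⁻¹).1 b ↔ a = b := fun a b => (h⁻¹).1.injective.eq_iff
  exact if_congr (by rw [← this, ← this (g.1 1)]) rfl rfl

/-- The boundary map from triples to pairs, where a triple of letters is replaced by the
complementary pair, so that both its source and its target consist of alternating functions on
pairs. -/
def curl : S ⟶ S :=
  Rep.ofHom ⟨
    { toFun := fun M => ⟨evenSum M.1, evenSum_skew M⟩
      map_add' := fun M N => Subtype.ext <| funext fun i => funext fun j => evenSum_add M.1 N.1 i j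
      map_smul' := fun c M => Subtype.ext <| funext fun i => funext fun j =>
        evenSum_smul c M.1 i j }, fun h => by
    exact LinearMap.ext fun M => Subtype.ext <| funext fun i => funext fun j =>
      evenSum_comp h M.1 i j⟩

set_option maxRecDepth 100000 in
theorem filter_eq : ∃ c : A5, (univ.filter fun g : A5 => g.1 0 = 0 ∧ g.1 1 = 1) = {1, c, c ^ 2} ∧
    c ≠ 1 ∧ c ^ 2 ≠ 1 ∧ c ^ 2 ≠ c ∧ c.1 2 = 3 ∧ c.1 3 = 4 ∧ c.1 4 = 2 := by
  decide +kernel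

theorem curl_apply_zero_one (M : S) : (curl.hom M : skew).1 0 1 =
    (M : skew).1 3 4 + (M : skew).1 4 2 + (M : skew).1 2 3 := by
  obtain ⟨c, hc, h1, h2, h3, c2, c3, c4⟩ := filter_eq
  change (∑ g : A5, if g.1 0 = 0 ∧ g.1 1 = 1 then (M : skew).1 (g.1 3) (g.1 4) else 0) = _
  rw [← Finset.sum_filter, hc, Finset.sum_insert, Finset.sum_insert, Finset.sum_singleton]
  · simp [pow_two, c2, c3, c4, add_assoc]
  · simpa using h3.symm
  · simpa using ⟨h1.symm, h2.symm⟩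

/-- The value of `curl M` on an even arrangement of the letters. -/
theorem curl_apply (M : S) (g : A5) : (curl.hom M : skew).1 (g.1 0) (g.1 1) =
    (M : skew).1 (g.1 3) (g.1 4) + (M : skew).1 (g.1 4) (g.1 2) + (M : skew).1 (g.1 2) (g.1 3) := by
  have h1 := Rep.hom_comm_apply curl g⁻¹ M
  have h2 := curl_apply_zero_one (S.ρ g⁻¹ M)
  rw [h1] at h2
  have h3 : ∀ (N : skew) (i j : Fin 5), (skewRep g⁻¹ N).1 i j = N.1 (g.1 i) (g.1 j) := by
    intro N i j
    change N.1 ((g⁻¹)⁻¹.1 i) ((g⁻¹)⁻¹.1 j) = _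
    rw [inv_inv]
  change (skewRep g⁻¹ _).1 0 1 = (skewRep g⁻¹ _).1 _ _ + (skewRep g⁻¹ _).1 _ _
    + (skewRep g⁻¹ _).1 _ _ at h2
  simpa only [h3] using h2

set_option maxRecDepth 100000 in
theorem exists_even : ∀ i j k : Fin 5, i ≠ j → i ≠ k → j ≠ k →
    ∃ g : A5, g.1 0 = i ∧ g.1 1 = j ∧ g.1 2 = k := by
  decide +kernel

set_option maxRecDepth 100000 in
theorem exists_even' : ∀ i j k : Fin 5, i ≠ j → i ≠ k → j ≠ k →
    ∃ g : A5, g.1 2 = i ∧ g.1 3 = j ∧ g.1 4 = k := by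
  decide +kernel

theorem const_injective : Function.Injective const.hom := fun c d h => by
  have := congrFun h 0
  rwa [const_apply, const_apply] at this

theorem grad_const (c : Z) : grad.hom (const.hom c) = 0 := by
  refine Subtype.ext ?_
  funext i j
  rw [grad_apply, const_apply, const_apply]
  exact sub_self _

theorem exact_const_grad (x : P) (hx : grad.hom x = 0) : ∃ c : Z, const.hom c = x := by
  refine ⟨(x : Fin 5 → ℤ) 0, ?_⟩
  funext i
  rw [const_apply]
  have h : (grad.hom x : skew).1 0 i = 0 := by rw [hx]; rfl
  rw [grad_apply] at h
  exact sub_eq_zero.1 h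

theorem total_surjective : Function.Surjective total.hom := fun c => by
  refine ⟨(Pi.single 0 c : Fin 5 → ℤ), ?_⟩
  rw [total_apply]
  simp

theorem total_rowSum (M : S) : total.hom (rowSum.hom M) = 0 := by
  rw [total_apply]
  change ∑ i, ∑ j, (M : skew).1 i j = 0
  have h : ∑ i, ∑ j, (M : skew).1 i j = -∑ i, ∑ j, (M : skew).1 i j := by
    conv_lhs => rw [Finset.sum_comm]
    rw [← Finset.sum_neg_distrib]
    refine Finset.sum_congr rfl fun i _ => ?_
    rw [← Finset.sum_neg_distrib]
    exact Finset.sum_congr rfl fun j _ => (M : skew).2 j i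
  omega

theorem exact_rowSum_total (x : P) (hx : total.hom x = 0) : ∃ M : S, rowSum.hom M = x := by
  rw [total_apply] at hx
  refine ⟨(⟨fun i j => (if j = 0 then (x : Fin 5 → ℤ) i else 0) -
    (if i = 0 then (x : Fin 5 → ℤ) j else 0), fun i j => (neg_sub _ _).symm⟩ : skew), ?_⟩
  funext i
  rw [rowSum_apply]
  simp only [Finset.sum_sub_distrib, Finset.sum_ite_eq', Finset.mem_univ, if_true]
  split_ifs
  · rw [hx, sub_zero]
  · simp

theorem curl_grad (x : P) : curl.hom (grad.hom x) = 0 := by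
  refine Subtype.ext ?_
  funext i j
  by_cases hij : i = j
  · rw [hij]
    exact skew_self _ _
  · obtain ⟨k, hk⟩ : ∃ k : Fin 5, i ≠ k ∧ j ≠ k := by
      revert i j
      decide
    obtain ⟨g, rfl, rfl, -⟩ := exists_even i j k hij hk.1 hk.2
    rw [curl_apply, grad_apply, grad_apply, grad_apply]
    change _ = (0 : ℤ)
    ring

theorem exact_grad_curl (M : S) (hM : curl.hom M = 0) : ∃ x : P, grad.hom x = M := by
  refine ⟨fun i => (M : skew).1 i 0, ?_⟩
  refine Subtype.ext ?_
  funext i j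
  rw [grad_apply]
  have hs := (M : skew).2
  have h0 := skew_self M
  by_cases hij : i = j
  · rw [hij, h0]
    exact sub_self _
  by_cases hi : i = 0
  · rw [hi, h0, hs 0 j, zero_sub]
  by_cases hj : j = 0
  · rw [hj, h0, sub_zero]
  obtain ⟨g, h2, h3, h4⟩ := exists_even' 0 i j (Ne.symm hi) (Ne.symm hj) hij
  have h := curl_apply M g
  rw [hM, h2, h3, h4, hs 0 i] at h
  have h5 : (0 : ℤ) = (M : skew).1 i j + (M : skew).1 j 0 + -(M : skew).1 i 0 := h
  linarith

theorem permRep_inv_apply (g : A5) (x : Fin 5 → ℤ) (i : Fin 5) :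
    permRep g⁻¹ x i = x (g.1 i) := by
  change x ((g⁻¹)⁻¹.1 i) = _
  rw [inv_inv]

theorem skewRep_inv_apply (g : A5) (N : skew) (i j : Fin 5) :
    (skewRep g⁻¹ N).1 i j = N.1 (g.1 i) (g.1 j) := by
  change N.1 ((g⁻¹)⁻¹.1 i) ((g⁻¹)⁻¹.1 j) = _
  rw [inv_inv]

set_option maxRecDepth 100000 in
theorem exists_even_rows : (∃ g : A5, g.1 0 = 0 ∧ g.1 1 = 2 ∧ g.1 2 = 1 ∧ g.1 3 = 4 ∧ g.1 4 = 3) ∧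
    (∃ g : A5, g.1 0 = 0 ∧ g.1 1 = 3 ∧ g.1 2 = 1 ∧ g.1 3 = 2 ∧ g.1 4 = 4) ∧
    (∃ g : A5, g.1 0 = 0 ∧ g.1 1 = 4 ∧ g.1 2 = 1 ∧ g.1 3 = 3 ∧ g.1 4 = 2) := by
  decide +kernel

theorem exists_moveZero : ∀ i : Fin 5, ∃ g : A5, g.1 0 = i := by
  decide +kernel

theorem rowSum_curl (M : S) : rowSum.hom (curl.hom M) = 0 := by
  have key : ∀ M : S, (rowSum.hom (curl.hom M) : Fin 5 → ℤ) 0 = 0 := by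
    intro M
    obtain ⟨⟨a, a0, a1, a2, a3, a4⟩, ⟨b, b0, b1, b2, b3, b4⟩, ⟨c, c0, c1, c2, c3, c4⟩⟩ :=
      exists_even_rows
    have h1 := curl_apply_zero_one M
    have h2 := curl_apply M a
    have h3 := curl_apply M b
    have h4 := curl_apply M c
    rw [a0, a1, a2, a3, a4] at h2
    rw [b0, b1, b2, b3, b4] at h3
    rw [c0, c1, c2, c3, c4] at h4
    rw [rowSum_apply, Fin.sum_univ_five, skew_self, h1, h2, h3, h4]
    have hs := (M : skew).2
    rw [hs 4 3, hs 3 1, hs 4 2, hs 4 1, hs 3 2, hs 2 1]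
    ring
  funext i
  obtain ⟨g, rfl⟩ := exists_moveZero i
  have h := key (S.ρ g⁻¹ M)
  rw [Rep.hom_comm_apply, Rep.hom_comm_apply] at h
  exact (permRep_inv_apply g _ 0).symm.trans h

set_option maxRecDepth 100000 in
theorem eq_one_of_fix : ∀ g : A5, g.1 0 = 0 → g.1 3 = 3 → g.1 4 = 4 → g = 1 := by
  decide +kernel

theorem exists_cycle :
    ∃ g : A5, g.1 0 = 0 ∧ g.1 1 = 1 ∧ g.1 2 = 3 ∧ g.1 3 = 4 ∧ g.1 4 = 2 := by
  decide +kernel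

theorem exists_cycle' :
    ∃ g : A5, g.1 0 = 2 ∧ g.1 1 = 0 ∧ g.1 2 = 1 ∧ g.1 3 = 3 ∧ g.1 4 = 4 := by
  decide +kernel

theorem exact_curl_rowSum (N : S) (hN : rowSum.hom N = 0) : ∃ M : S, curl.hom M = N := by
  have hs := (N : skew).2
  -- The cone from the letter `0`: the pair `(l, m)` is sent to the value of `N` on the
  -- complementary pair of letters different from `0`.
  let F : Fin 5 → Fin 5 → ℤ := fun l m =>
    ∑ g : A5, if g.1 0 = 0 ∧ g.1 3 = l ∧ g.1 4 = m then (N : skew).1 (g.1 1) (g.1 2) else 0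
  have hF : ∀ l m, F l m = -F m l := by
    intro l m
    obtain ⟨s, h0, h1, h2, h3, h4⟩ := exists_swap'
    change ∑ g : A5, _ = -∑ g : A5, _
    rw [← Equiv.sum_comp (Equiv.mulRight s), ← Finset.sum_neg_distrib]
    refine Finset.sum_congr rfl fun g _ => ?_
    simp only [Equiv.coe_mulRight, Subgroup.coe_mul, Equiv.Perm.mul_apply, h0, h1, h2, h3, h4]
    rw [hs]
    by_cases h : g.1 0 = 0 ∧ g.1 3 = m ∧ g.1 4 = l
    · rw [if_pos h, if_pos ⟨h.1, h.2.2, h.2.1⟩]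
    · rw [if_neg h, if_neg (fun h' => h ⟨h'.1, h'.2.2, h'.2.1⟩), neg_zero]
  have hF0 : ∀ m, F 0 m = 0 := by
    intro m
    refine Finset.sum_eq_zero fun g _ => if_neg fun h => ?_
    exact absurd (g.1.injective (h.1.trans h.2.1.symm)) (by decide)
  have hF1 : ∀ m, F m 0 = 0 := fun m => by rw [hF, hF0, neg_zero]
  have hFg : ∀ g : A5, g.1 0 = 0 → F (g.1 3) (g.1 4) = (N : skew).1 (g.1 1) (g.1 2) := by
    intro g hg
    refine (Finset.sum_eq_single g (fun h _ hh => if_neg fun h' => hh ?_)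
      (fun h => absurd (Finset.mem_univ g) h)).trans (if_pos ⟨hg, rfl, rfl⟩)
    have : ∀ a, h.1 a = g.1 a → (g⁻¹ * h).1 a = a := fun a ha => by
      change (g.1)⁻¹ (h.1 a) = a
      rw [ha]
      exact g.1.symm_apply_apply a
    exact (inv_mul_eq_one.1 (eq_one_of_fix (g⁻¹ * h) (this 0 (h'.1.trans hg.symm))
      (this 3 h'.2.1) (this 4 h'.2.2))).symm
  refine ⟨(⟨F, hF⟩ : skew), Subtype.ext ?_⟩
  -- The value at `(0, j)` is the row sum of `N` at `j`, up to the entry `N j 0`.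
  have h0 : ∀ j, j ≠ 0 → (curl.hom (⟨F, hF⟩ : skew) : skew).1 0 j = (N : skew).1 0 j := by
    intro j hj
    obtain ⟨k, hk⟩ : ∃ k : Fin 5, 0 ≠ k ∧ j ≠ k := by
      clear hN hF hF0 hF1 hFg F
      revert j
      decide
    obtain ⟨g, hg0, rfl, -⟩ := exists_even 0 j k hj.symm hk.1 hk.2
    have h := curl_apply (⟨F, hF⟩ : skew) g
    rw [hg0] at h
    rw [h]
    have hrow : ∑ k, (N : skew).1 (g.1 1) (g.1 k) = 0 :=
      (Equiv.sum_comp g.1 ((N : skew).1 (g.1 1))).trans (congrFun hN (g.1 1))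
    rw [Fin.sum_univ_five, skew_self, hg0] at hrow
    obtain ⟨c, c0, c1, c2, c3, c4⟩ := exists_cycle
    have e1 := hFg g hg0
    have e2 := hFg (g * c) (by rw [Subgroup.coe_mul, Equiv.Perm.mul_apply, c0, hg0])
    have e3 := hFg (g * c * c) (by
      rw [Subgroup.coe_mul, Subgroup.coe_mul, Equiv.Perm.mul_apply, Equiv.Perm.mul_apply, c0, c0,
        hg0])
    simp only [Subgroup.coe_mul, Equiv.Perm.mul_apply, c1, c2, c3, c4] at e2 e3
    change F _ _ + F _ _ + F _ _ = _
    rw [e1, e2, e3, hs 0]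
    linarith
  funext i j
  by_cases hij : i = j
  · rw [hij, skew_self, skew_self]
  by_cases hi : i = 0
  · rw [hi]
    exact h0 j fun h => hij (hi.trans h.symm)
  by_cases hj : j = 0
  · rw [hj, (curl.hom _ : skew).2, h0 i hi, ← hs]
  obtain ⟨g, rfl, rfl, hg⟩ := exists_even i j 0 hij hi hj
  rw [curl_apply, hg]
  obtain ⟨d, d0, d1, d2, d3, d4⟩ := exists_cycle'
  have e1 := hFg (g * d) (by rw [Subgroup.coe_mul, Equiv.Perm.mul_apply, d0, hg])
  simp only [Subgroup.coe_mul, Equiv.Perm.mul_apply, d1, d2, d3, d4] at e1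
  change F _ _ + F _ _ + F _ _ = _
  rw [e1, hF0, hF1, add_zero, add_zero]

set_option maxRecDepth 100000 in
theorem card_filter_one : ∀ i : Fin 5, (univ.filter fun g : A5 => g.1 i = 0).card = 12 := by
  decide +kernel

set_option maxRecDepth 100000 in
theorem card_filter_two : ∀ i j : Fin 5, i ≠ j →
    (univ.filter fun g : A5 => g.1 i = 0 ∧ g.1 j = 1).card = 3 := by
  decide +kernel

theorem freeUpTo_P : P.FreeUpTo 12 := by
  refine ⟨LinearMap.proj (R := ℤ) (φ := fun _ : Fin 5 => ℤ) 0,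
    (Pi.single 0 1 : Fin 5 → ℤ), fun x => ?_⟩
  refine funext fun i => ?_
  refine (Finset.sum_apply i _ _).trans ?_
  have h : ∀ g : A5, permRep g x 0 * permRep g⁻¹ (Pi.single 0 1) i =
      if g.1 i = 0 then (x : Fin 5 → ℤ) i else 0 := by
    intro g
    rw [permRep_inv_apply, Pi.single_apply]
    by_cases hg : g.1 i = 0
    · rw [if_pos hg, if_pos hg, mul_one]
      change (x : Fin 5 → ℤ) ((g.1)⁻¹ 0) = _
      rw [← hg]
      exact congrArg _ (g.1.symm_apply_apply i)
    · rw [if_neg hg, if_neg hg, mul_zero]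
  refine (Finset.sum_congr rfl fun g _ => h g).trans ?_
  rw [← Finset.sum_filter, Finset.sum_const, card_filter_one]
  rfl

/-- The elementary alternating function supported on the first two letters. -/
def unitSkew : skew :=
  ⟨fun i j => (if i = 0 ∧ j = 1 then 1 else 0) - (if j = 0 ∧ i = 1 then 1 else 0),
    fun _ _ => (neg_sub _ _).symm⟩

/-- The evaluation of an alternating function at the first two letters. -/
def evalSkew : S →ₗ[ℤ] ℤ where
  toFun M := (M : skew).1 0 1
  map_add' _ _ := rfl
  map_smul' _ _ := rfl

theorem average_S (M : S) : ∑ g : A5, evalSkew (S.ρ g M) • S.ρ g⁻¹ (unitSkew : S) = 6 • M := by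
  have hs := (M : skew).2
  have hinv : ∀ (g : A5) (a b : Fin 5), g.1 a = b → (g⁻¹).1 b = a := fun g a b h => by
    rw [← h]
    exact g.1.symm_apply_apply a
  have h : ∀ (i j : Fin 5) (g : A5),
      (skewRep g M).1 0 1 * (skewRep g⁻¹ unitSkew).1 i j =
      (if g.1 i = 0 ∧ g.1 j = 1 then (M : skew).1 i j else 0) +
      (if g.1 j = 0 ∧ g.1 i = 1 then (M : skew).1 i j else 0) := by
    intro i j g
    rw [skewRep_inv_apply]
    change (M : skew).1 ((g⁻¹).1 0) ((g⁻¹).1 1) * ((if _ then 1 else 0) - (if _ then 1 else 0)) = _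
    rw [mul_sub, sub_eq_add_neg]
    congr 1
    · split_ifs with hg
      · rw [hinv g _ _ hg.1, hinv g _ _ hg.2, mul_one]
      · rw [mul_zero]
    · split_ifs with hg
      · rw [hinv g _ _ hg.1, hinv g _ _ hg.2, mul_one, ← hs]
      · rw [mul_zero, neg_zero]
  refine Subtype.ext ?_
  refine funext fun i => funext fun j => ?_
  have h3 : ∀ n : ℕ, (n • M : skew).1 i j = n • (M : skew).1 i j := fun n => rfl
  refine Eq.trans ?_ (h3 6).symm
  refine (skew_sum_apply _ _ i j).trans ((Finset.sum_congr rfl fun g _ => ?_).trans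
    (b := ∑ g : A5, ((if g.1 i = 0 ∧ g.1 j = 1 then (M : skew).1 i j else 0) +
      (if g.1 j = 0 ∧ g.1 i = 1 then (M : skew).1 i j else 0))) ?_)
  · exact h i j g
  by_cases hij : i = j
  · rw [hij, skew_self, smul_zero]
    exact Finset.sum_eq_zero fun g _ => by simp only [ite_self, add_zero]
  · rw [Finset.sum_add_distrib, ← Finset.sum_filter, ← Finset.sum_filter, Finset.sum_const,
      Finset.sum_const, card_filter_two i j hij, card_filter_two j i (Ne.symm hij), ← add_smul]

theorem freeUpTo_S : S.FreeUpTo 6 := ⟨evalSkew, (unitSkew : S), average_S⟩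

theorem nsmul_H0_S (x : groupHomology S 0) : 12 • x = 0 := by
  obtain ⟨s, h0, h1, h2, h3, h4⟩ := exists_swap
  refine groupHomology.nsmul_H0_eq_zero average_S (s := s⁻¹) ?_ x
  refine Subtype.ext ?_
  refine funext fun i => funext fun j => ?_
  refine (skewRep_inv_apply s unitSkew i j).trans ?_
  change _ - _ = -(_ - _)
  have : ∀ a : Fin 5, (s.1 a = 0 ↔ a = 1) ∧ (s.1 a = 1 ↔ a = 0) := by
    intro a
    rw [← s.1.injective.eq_iff (a := a) (b := 1), ← s.1.injective.eq_iff (a := a) (b := 0), h1, h0]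
    exact ⟨Iff.rfl, Iff.rfl⟩
  simp only [(this _).1, (this _).2]
  rw [neg_sub]
  congr 1
  · exact if_congr and_comm rfl rfl
  · exact if_congr and_comm rfl rfl

/-! ### Homology of the alternating group at the prime 5 -/

theorem sum_grad (x : P) (i : Fin 5) : ∑ j, (grad.hom x : skew).1 j i =
    ∑ j, (x : Fin 5 → ℤ) j - 5 * (x : Fin 5 → ℤ) i := by
  change ∑ j, ((x : Fin 5 → ℤ) j - (x : Fin 5 → ℤ) i) = _
  rw [Finset.sum_sub_distrib, Finset.sum_const]
  simp

/-- The sum of the potential of a curl-free alternating function, which is defined modulo `5`. -/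
noncomputable def potentialSum : Rep.kerRep curl →ₗ[ℤ] ZMod 5 where
  toFun N := ((∑ j, (N.1 : skew).1 j 0 : ℤ) : ZMod 5)
  map_add' M N := by
    rw [← Int.cast_add]
    exact congrArg _ Finset.sum_add_distrib
  map_smul' c N := by
    rw [RingHom.id_apply, zsmul_eq_mul, ← Int.cast_mul]
    exact congrArg _ (Finset.mul_sum _ _ _).symm

theorem potentialSum_apply (N : Rep.kerRep curl) (x : P) (hx : grad.hom x = N.1) :
    potentialSum N = ((∑ j, (x : Fin 5 → ℤ) j : ℤ) : ZMod 5) := by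
  change ((∑ j, (N.1 : skew).1 j 0 : ℤ) : ZMod 5) = _
  rw [← hx, sum_grad, Int.cast_sub, Int.cast_mul]
  have : ((5 : ℤ) : ZMod 5) = 0 := by decide
  rw [this, zero_mul, sub_zero]

theorem potentialSum_ρ (g : A5) : potentialSum ∘ₗ (Rep.kerRep curl).ρ g = potentialSum := by
  refine LinearMap.ext fun N => ?_
  obtain ⟨x, hx⟩ := exact_grad_curl N.1 N.2
  rw [potentialSum_apply N x hx, LinearMap.comp_apply, potentialSum_apply _ (P.ρ g x) ?_]
  · exact congrArg _ (Equiv.sum_comp (g⁻¹).1 (x : Fin 5 → ℤ))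
  · rw [Rep.hom_comm_apply, hx]
    rfl

/-- The map from `ℤ⁵` to the coinvariants of the curl-free functions. -/
noncomputable def potentialClass : P →ₗ[ℤ] groupHomology (Rep.kerRep curl) 0 :=
  (groupHomology.H0π (Rep.kerRep curl)).hom ∘ₗ
    (Rep.kerLift curl grad curl_grad).hom.toLinearMap

theorem potentialClass_apply (x : P) : potentialClass x =
    (∑ j, (x : Fin 5 → ℤ) j) • potentialClass (Pi.single 0 1 : Fin 5 → ℤ) := by
  have h1 : ∀ i, potentialClass (Pi.single i 1 : Fin 5 → ℤ) =
      potentialClass (Pi.single 0 1 : Fin 5 → ℤ) := by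
    intro i
    obtain ⟨g, rfl⟩ := exists_moveZero i
    have h2 : (Pi.single (g.1 0) 1 : Fin 5 → ℤ) = P.ρ g (Pi.single 0 1 : Fin 5 → ℤ) := by
      funext j
      change _ = (Pi.single 0 1 : Fin 5 → ℤ) ((g.1)⁻¹ j)
      rw [Pi.single_apply, Pi.single_apply]
      exact if_congr (by rw [Equiv.Perm.inv_eq_iff_eq, eq_comm]) rfl rfl
    rw [h2]
    refine Eq.trans ?_ (groupHomology.H0π_ρ (Rep.kerRep curl) g _)
    exact congrArg (groupHomology.H0π (Rep.kerRep curl))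
      (Rep.hom_comm_apply (Rep.kerLift curl grad curl_grad) g _)
  have h3 : x = ∑ j, (x : Fin 5 → ℤ) j • (Pi.single j 1 : Fin 5 → ℤ) := by
    refine (Finset.univ_sum_single (x : Fin 5 → ℤ)).symm.trans (Finset.sum_congr rfl fun j _ => ?_)
    rw [← Pi.single_smul, smul_eq_mul, mul_one]
  refine (congrArg potentialClass h3).trans ?_
  have h4 : ∀ (A : Type) [AddCommGroup A] (a : A), (∑ j, (x : Fin 5 → ℤ) j) • a =
      ∑ j, (x : Fin 5 → ℤ) j • a := fun A _ a => Finset.sum_smul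
  refine (map_sum potentialClass _ _).trans (Eq.trans ?_ (h4 _ _).symm)
  refine Finset.sum_congr rfl fun j _ => ?_
  rw [← h1 j]
  exact map_zsmul potentialClass.toAddMonoidHom _ _

theorem five_smul_potentialClass :
    (5 : ℤ) • potentialClass (Pi.single 0 1 : Fin 5 → ℤ) = 0 := by
  have h := potentialClass_apply (const.hom (1 : ℤ))
  have h1 : potentialClass (const.hom (1 : ℤ)) = 0 := by
    have h2 : (Rep.kerLift curl grad curl_grad).hom (const.hom (1 : ℤ)) = 0 :=
      Subtype.ext (grad_const _)
    exact (congrArg (groupHomology.H0π (Rep.kerRep curl)) h2).trans (map_zero _)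
  rw [h1] at h
  exact h.symm

/-- The coinvariants of the curl-free functions. -/
noncomputable def coinvariantsEquiv : groupHomology (Rep.kerRep curl) 0 ≃+ ZMod 5 :=
  (groupHomology.H0Iso (Rep.kerRep curl)).toLinearEquiv.toAddEquiv.trans <|
    AddEquiv.ofBijective
      (Representation.Coinvariants.lift (Rep.kerRep curl).ρ potentialSum
        potentialSum_ρ).toAddMonoidHom
      (by
        constructor
        · refine (injective_iff_map_eq_zero _).2 fun c hc => ?_
          obtain ⟨N, rfl⟩ := Representation.Coinvariants.mk_surjective _ c
          obtain ⟨x, hx⟩ := exact_grad_curl N.1 N.2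
          have h1 : potentialSum N = 0 := hc
          rw [potentialSum_apply N x hx, ZMod.intCast_zmod_eq_zero_iff_dvd] at h1
          obtain ⟨d, hd⟩ := h1
          have h2 : potentialClass x = 0 := by
            rw [potentialClass_apply, hd, mul_comm, mul_smul]
            exact (congrArg (d • ·) five_smul_potentialClass).trans (zsmul_zero d)
          have h3 : (Rep.kerLift curl grad curl_grad).hom x = N := Subtype.ext hx
          have h4 : groupHomology.H0π (Rep.kerRep curl) N = 0 := by
            rw [← h3]
            exact h2
          have h5 := groupHomology.H0π_comp_H0Iso_hom_apply (Rep.kerRep curl) N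
          rw [h4, map_zero] at h5
          exact h5.symm
        · intro c
          obtain ⟨a, rfl⟩ := ZMod.intCast_surjective c
          refine ⟨Representation.Coinvariants.mk _
            ((Rep.kerLift curl grad curl_grad).hom (Pi.single 0 a : Fin 5 → ℤ)), ?_⟩
          refine (potentialSum_apply _ (Pi.single 0 a : Fin 5 → ℤ) rfl).trans ?_
          simp)

/-- The `5`-primary part of the homology of a representation of the alternating group. -/
abbrev H5 (M : Rep ℤ A5) (n : ℕ) : Type :=
  AddCommGroup.primaryComponent (groupHomology M n) 5

/-- The connecting map of `0 → ker → ℤ⁵ → ℤ → 0`. -/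
noncomputable def shiftTotal (n : ℕ) : H5 Z (n + 1) ≃+ H5 (Rep.kerRep total) n :=
  groupHomology.shift (Rep.shortExact_of_exact (Rep.kerι total) total
    (Rep.hom_ext (DFunLike.ext _ _ fun a => a.2)) (fun _ _ h => Subtype.ext h) total_surjective
    (fun b hb => ⟨⟨b, hb⟩, rfl⟩)) freeUpTo_P (by norm_num) (by norm_num) n

/-- The connecting map of `0 → ker → Λ → ker → 0` for the row sums. -/
noncomputable def shiftRowSum (n : ℕ) : H5 (Rep.kerRep total) (n + 1) ≃+ H5 (Rep.kerRep rowSum) n :=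
  groupHomology.shift (Rep.shortExact_ker rowSum total total_rowSum exact_rowSum_total)
    freeUpTo_S (by norm_num) (by norm_num) n

/-- The connecting map of `0 → ker → Λ → ker → 0` for the boundary map from triples to pairs. -/
noncomputable def shiftCurl (n : ℕ) : H5 (Rep.kerRep rowSum) (n + 1) ≃+ H5 (Rep.kerRep curl) n :=
  groupHomology.shift (Rep.shortExact_ker curl rowSum rowSum_curl exact_curl_rowSum)
    freeUpTo_S (by norm_num) (by norm_num) n

/-- The connecting map of `0 → ℤ → ℤ⁵ → ker → 0`. -/
noncomputable def shiftGrad (n : ℕ) : H5 (Rep.kerRep curl) (n + 1) ≃+ H5 Z n :=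
  groupHomology.shift (Rep.shortExact_of_exact const (Rep.kerLift curl grad curl_grad)
    (Rep.hom_ext (DFunLike.ext _ _ fun a => Subtype.ext (grad_const a))) const_injective
    (fun b => by
      obtain ⟨a, ha⟩ := exact_grad_curl b.1 b.2
      exact ⟨a, Subtype.ext ha⟩)
    (fun b hb => exact_const_grad b (congrArg Subtype.val hb)))
    freeUpTo_P (by norm_num) (by norm_num) n

/-- The homology of the alternating group has period four at the prime `5`. -/
noncomputable def periodicity (n : ℕ) : H5 Z (n + 4) ≃+ H5 Z n :=
  ((shiftTotal (n + 3)).trans (shiftRowSum (n + 2))).trans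
    ((shiftCurl (n + 1)).trans (shiftGrad n))

theorem subsingleton_of_nsmul {M : Rep ℤ A5} (h : ∀ x : groupHomology M 0, 12 • x = 0) :
    Subsingleton (H5 M 0) :=
  AddCommGroup.primaryComponent_subsingleton fun x hx =>
    AddCommGroup.eq_zero_of_coprime_smul (by norm_num) (h x) hx

theorem subsingleton_H5_zero : Subsingleton (H5 Z 0) := by
  refine AddCommGroup.primaryComponent_subsingleton fun x hx => ?_
  let e := (groupHomology.H0IsoOfIsTrivial Z).toLinearEquiv
  refine e.injective ?_
  have h1 : 5 • (e x : ℤ) = 0 := (map_nsmul e 5 x).symm.trans (by rw [hx, map_zero])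
  rw [map_zero]
  exact (smul_eq_zero.1 h1).resolve_left (by norm_num)

theorem subsingleton_H5_one : Subsingleton (H5 Z 1) := by
  have := subsingleton_of_nsmul (groupHomology.nsmul_H0_eq_zero_of_surjective
    (Rep.kerLift total rowSum total_rowSum) (fun b => by
      obtain ⟨a, ha⟩ := exact_rowSum_total b.1 b.2
      exact ⟨a, Subtype.ext ha⟩) nsmul_H0_S)
  exact (shiftTotal 0).toEquiv.subsingleton

theorem subsingleton_H5_two : Subsingleton (H5 Z 2) := by
  have := subsingleton_of_nsmul (groupHomology.nsmul_H0_eq_zero_of_surjective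
    (Rep.kerLift rowSum curl rowSum_curl) (fun b => by
      obtain ⟨a, ha⟩ := exact_curl_rowSum b.1 b.2
      exact ⟨a, Subtype.ext ha⟩) nsmul_H0_S)
  exact ((shiftTotal 1).trans (shiftRowSum 0)).toEquiv.subsingleton

/-- The `5`-primary part of the third homology of the alternating group. -/
noncomputable def homologyThree : H5 Z 3 ≃+ ZMod 5 :=
  ((shiftTotal 2).trans ((shiftRowSum 1).trans (shiftCurl 0))).trans <|
    (AddCommGroup.primaryComponentCongr 5 coinvariantsEquiv).trans <|
    (AddEquiv.addSubgroupCongr (show AddCommGroup.primaryComponent (ZMod 5) 5 = ⊤ from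
      top_le_iff.1 fun x _ => ⟨1, by
        rw [pow_one, nsmul_eq_mul]
        exact mul_eq_zero_of_left (by decide) x⟩)).trans
    AddSubgroup.topEquiv

theorem nonempty_homology_equiv (k : ℕ) : Nonempty (H5 Z (3 + 4 * k) ≃+ ZMod 5) := by
  induction k with
  | zero => exact ⟨homologyThree⟩
  | succ k ih => exact ih.map fun e => (periodicity (3 + 4 * k)).trans e

theorem subsingleton_homology (q : ℕ) (hq : ¬ ∃ k, q = 3 + 4 * k) : Subsingleton (H5 Z q) := by
  induction q using Nat.strong_induction_on with
  | _ q ih =>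
    match q, ih, hq with
    | 0, _, _ => exact subsingleton_H5_zero
    | 1, _, _ => exact subsingleton_H5_one
    | 2, _, _ => exact subsingleton_H5_two
    | 3, _, hq => exact absurd ⟨0, rfl⟩ hq
    | q + 4, ih, hq =>
      have := ih q (by omega) fun ⟨k, hk⟩ => hq ⟨k + 1, by omega⟩
      exact (periodicity q).toEquiv.subsingleton

end AltFive

end

/-! ### The terms of the spectral sequence -/

namespace WellRounded

open AltFive

theorem cellTerm_subsingleton {n p : ℕ} (C : Cell n p) [Finite (cellStabilizer C)]
    (h : ∀ g : cellStabilizer C, orderOf g ≠ 5) (q : ℕ) : Subsingleton (cellTerm 5 C q) := by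
  have := Fintype.ofFinite (cellStabilizer C)
  have hcard : (Fintype.card (cellStabilizer C)).Coprime 5 := by
    refine Nat.Coprime.symm ((Nat.Prime.coprime_iff_not_dvd (by norm_num)).2 fun hd => ?_)
    have : Fact (Nat.Prime 5) := ⟨by norm_num⟩
    obtain ⟨g, hg⟩ := exists_prime_orderOf_dvd_card 5 hd
    exact h g hg
  exact AddCommGroup.primaryComponent_subsingleton
    ((Rep.freeUpTo_card (orientationChar C)).torsionFree (by norm_num) hcard q)

/-- A group isomorphic to the alternating group on five letters has no nontrivial homomorphism to a
commutative monoid. -/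
theorem monoidHom_eq_one {H M : Type*} [Group H] [CommMonoid M] (e : H ≃* A5) (χ : H →* M) :
    χ = 1 := by
  let ψ : A5 →* Mˣ := (χ.comp e.symm.toMonoidHom).toHomUnits
  have h : commutator A5 ≤ ψ.ker := Abelianization.commutator_subset_ker ψ
  rw [commutator_alternatingGroup_eq_top (by simp)] at h
  ext g
  have h1 : e g ∈ ψ.ker := h trivial
  have h2 := congrArg Units.val (MonoidHom.mem_ker.1 h1)
  simpa [ψ] using h2

/-- If the stabilizer of a cell is isomorphic to the alternating group on five letters, then its
homology with coefficients in the orientation module is that of the alternating group with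
trivial integral coefficients. -/
noncomputable def cellTermEquiv {n p : ℕ} (C : Cell n p) (e : cellStabilizer C ≃* A5) (q : ℕ) :
    cellTerm 5 C q ≃+ H5 Z q :=
  AddCommGroup.primaryComponentCongr 5
    (groupHomology.mapIso (A := orientationModule C) (B := Z) e (LinearEquiv.refl ℤ ℤ) (fun g => by
      refine LinearMap.ext fun m => ?_
      change (orientationChar C g * (show ℤ from m) : ℤ) = (show ℤ from m)
      rw [monoidHom_eq_one e (orientationChar C), MonoidHom.one_apply, one_mul])
      q).toLinearEquiv.toAddEquiv

/-- A direct sum with a single nontrivial summand. -/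
noncomputable def directSumEquiv {ι : Type*} (A : ι → Type*) [∀ i, AddCommGroup (A i)] (i₀ : ι)
    (h : ∀ i, i ≠ i₀ → Subsingleton (A i)) : DirectSum ι A ≃+ A i₀ := by
  classical
  exact
  { toFun := fun x => x i₀
    invFun := DirectSum.of A i₀
    left_inv := fun x => by
      refine DFinsupp.ext fun i => ?_
      by_cases hi : i = i₀
      · subst hi
        exact DirectSum.of_eq_same _ _
      · have := h i hi
        exact Subsingleton.elim _ _
    right_inv := fun x => DirectSum.of_eq_same _ _
    map_add' := fun x y => rfl }

theorem exists_orderOf_eq_five {H : Type*} [Group H] (e : H ≃* A5) : ∃ g : H, orderOf g = 5 := by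
  have : Fact (Nat.Prime 5) := ⟨by norm_num⟩
  have h : 5 ∣ Fintype.card A5 := by
    rw [card_alternatingGroup]
    decide
  obtain ⟨g, hg⟩ := exists_prime_orderOf_dvd_card 5 h
  exact ⟨e.symm g, by rw [MulEquiv.orderOf_eq, hg]⟩

theorem stabilizer_equiv_of_smul {n p : ℕ} {C D : Cell n p} {g : PSL(n, ℤ)} (h : g • C = D)
    (e : cellStabilizer C ≃* A5) : Nonempty (cellStabilizer D ≃* A5) := by
  subst h
  exact ⟨(MulAction.stabilizerEquivStabilizer (g := g) rfl).symm.trans e⟩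

variable {C₀ : Cell 4 0} {C₅ : Cell 4 5}

/-- The spectral sequence at the prime `5`, from the classification of the cells with `5`-torsion
in their stabilizer. -/
theorem spectralSequence_of_cells (hfin : ∀ (p : ℕ) (C : Cell 4 p), Finite (cellStabilizer C))
    (e₀ : cellStabilizer C₀ ≃* A5) (e₅ : cellStabilizer C₅ ≃* A5)
    (hC : ∀ (p : ℕ) (C : Cell 4 p) (g : cellStabilizer C), orderOf g = 5 →
      (∃ h, C.1 = pslRep 4 h '' C₀.1) ∨ ∃ h, C.1 = pslRep 4 h '' C₅.1) :
    (∀ k : ℕ, Nonempty (E1 5 4 0 (3 + 4 * k) ≃+ ZMod 5)) ∧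
    (∀ k : ℕ, Nonempty (E1 5 4 5 (3 + 4 * k) ≃+ ZMod 5)) ∧
    (∀ p q : ℕ, ¬ ((p = 0 ∨ p = 5) ∧ ∃ k : ℕ, q = 3 + 4 * k) → Subsingleton (E1 5 4 p q)) ∧
    (∀ p : ℕ, p = 0 ∨ p = 5 → ∃ C : Cell 4 p, ∀ D : Cell 4 p,
      Nonempty (cellStabilizer D ≃* A5) ↔ ∃ g : PSL(4, ℤ), g • C = D) ∧
    (∀ (p q : ℕ) (C : Cell 4 p), Nontrivial (cellTerm 5 C q) →
      (p = 0 ∨ p = 5) ∧ Nonempty (cellStabilizer C ≃* A5)) := by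
  have dim_eq : ∀ {p r : ℕ} {C : Cell 4 p} {D : Cell 4 r} {h : PSL(4, ℤ)},
      C.1 = pslRep 4 h '' D.1 → p = r := by
    intro p r C D h hCD
    rw [← C.2.2, ← D.2.2, hCD, cellDim_image]
  have orbit₀ : ∀ (C : Cell 4 0) (g : cellStabilizer C), orderOf g = 5 →
      ∃ h : PSL(4, ℤ), h • C₀ = C := by
    intro C g hg
    rcases hC 0 C g hg with ⟨h, hh⟩ | ⟨h, hh⟩
    · exact ⟨h, Subtype.ext hh.symm⟩
    · exact absurd (dim_eq hh) (by norm_num)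
  have orbit₅ : ∀ (C : Cell 4 5) (g : cellStabilizer C), orderOf g = 5 →
      ∃ h : PSL(4, ℤ), h • C₅ = C := by
    intro C g hg
    rcases hC 5 C g hg with ⟨h, hh⟩ | ⟨h, hh⟩
    · exact absurd (dim_eq hh) (by norm_num)
    · exact ⟨h, Subtype.ext hh.symm⟩
  have trivial_or : ∀ (p q : ℕ) (C : Cell 4 p), Subsingleton (cellTerm 5 C q) ∨
      (p = 0 ∨ p = 5) ∧ Nonempty (cellStabilizer C ≃* A5) := by
    intro p q C
    have := hfin p C
    by_cases h : ∃ g : cellStabilizer C, orderOf g = 5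
    · obtain ⟨g, hg⟩ := h
      right
      rcases hC p C g hg with ⟨h, hh⟩ | ⟨h, hh⟩
      · obtain rfl := dim_eq hh
        exact ⟨Or.inl rfl, stabilizer_equiv_of_smul (Subtype.ext hh.symm) e₀⟩
      · obtain rfl := dim_eq hh
        exact ⟨Or.inr rfl, stabilizer_equiv_of_smul (Subtype.ext hh.symm) e₅⟩
    · push Not at h
      exact Or.inl (cellTerm_subsingleton C h q)
  have single : ∀ (p : ℕ) (B : Cell 4 p) (e : cellStabilizer B ≃* A5),
      (∀ (C : Cell 4 p) (g : cellStabilizer C), orderOf g = 5 → ∃ h : PSL(4, ℤ), h • B = C) →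
      ∀ k : ℕ, Nonempty (E1 5 4 p (3 + 4 * k) ≃+ ZMod 5) := by
    intro p B e hB k
    let o : CellOrbit 4 p := Quotient.mk _ B
    obtain ⟨g, hg⟩ : ∃ g : PSL(4, ℤ), g • B = Quotient.out o :=
      MulAction.orbitRel_apply.1 (Quotient.mk_out (s := MulAction.orbitRel PSL(4, ℤ) (Cell 4 p)) B)
    obtain ⟨e'⟩ := stabilizer_equiv_of_smul hg e
    obtain ⟨f⟩ := nonempty_homology_equiv k
    refine ⟨((directSumEquiv _ o fun o' ho => ?_).trans (cellTermEquiv _ e' _)).trans f⟩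
    have := hfin p (Quotient.out o')
    refine cellTerm_subsingleton _ (fun g' hg' => ho ?_) _
    obtain ⟨h, hh⟩ := hB _ g' hg'
    rw [← Quotient.out_eq o']
    exact Quotient.sound ((MulAction.orbitRel_apply).2 ⟨h, hh⟩)
  refine ⟨single 0 C₀ e₀ orbit₀, single 5 C₅ e₅ orbit₅, fun p q hpq => ?_, ?_, ?_⟩
  · have : ∀ o : CellOrbit 4 p, Subsingleton (cellTerm 5 (Quotient.out o) q) := by
      intro o
      rcases trivial_or p q (Quotient.out o) with h | ⟨hp, ⟨e⟩⟩
      · exact h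
      · have := subsingleton_homology q fun hk => hpq ⟨hp, hk⟩
        exact (cellTermEquiv _ e q).toEquiv.subsingleton
    exact ⟨fun x y => DFinsupp.ext fun o => Subsingleton.elim _ _⟩
  · rintro p (rfl | rfl)
    · refine ⟨C₀, fun D => ⟨fun ⟨e⟩ => ?_, fun ⟨g, hg⟩ => stabilizer_equiv_of_smul hg e₀⟩⟩
      obtain ⟨g, hg⟩ := exists_orderOf_eq_five e
      exact orbit₀ D g hg
    · refine ⟨C₅, fun D => ⟨fun ⟨e⟩ => ?_, fun ⟨g, hg⟩ => stabilizer_equiv_of_smul hg e₅⟩⟩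
      obtain ⟨g, hg⟩ := exists_orderOf_eq_five e
      exact orbit₅ D g hg
  · intro p q C hn
    rcases trivial_or p q C with h | h
    · exact absurd hn (not_nontrivial_iff_subsingleton.2 h)
    · exact h

end WellRounded

/-! ### Forms with prescribed minimal vectors -/

namespace WellRounded

variable {n : ℕ}

/-- The bilinear form of a matrix on integer vectors. -/
def bilin (A : Matrix (Fin n) (Fin n) ℝ) (v w : Fin n → ℤ) : ℝ :=
  toReal v ⬝ᵥ (A *ᵥ toReal w)

theorem toReal_add (v w : Fin n → ℤ) : toReal (v + w) = toReal v + toReal w := by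
  ext i; simp [toReal]

theorem toReal_smul (c : ℤ) (v : Fin n → ℤ) : toReal (c • v) = (c : ℝ) • toReal v := by
  ext i; simp [toReal]

theorem toReal_injective : Function.Injective (toReal (n := n)) := fun v w h => by
  ext i
  have h1 : (v i : ℝ) = (w i : ℝ) := congrFun h i
  exact_mod_cast h1

theorem formValue_posDef {A : Matrix (Fin n) (Fin n) ℝ} (hA : A.PosDef) {v : Fin n → ℤ}
    (hv : v ≠ 0) : 0 < formValue A v := by
  have h : toReal v ≠ 0 := fun h => hv (toReal_injective (h.trans (by ext; simp [toReal])))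
  have h1 := hA.dotProduct_mulVec_pos h
  rwa [star_trivial] at h1

theorem formValue_zero (A : Matrix (Fin n) (Fin n) ℝ) : formValue A 0 = 0 := by
  have : toReal (0 : Fin n → ℤ) = 0 := by ext; simp [toReal]
  rw [formValue, this, zero_dotProduct]

theorem formValue_nonneg {A : Matrix (Fin n) (Fin n) ℝ} (hA : A.PosDef) (v : Fin n → ℤ) :
    0 ≤ formValue A v := by
  by_cases hv : v = 0
  · rw [hv, formValue_zero]
  · exact (formValue_posDef hA hv).le

theorem arithMin_le {A : Matrix (Fin n) (Fin n) ℝ} (hA : A.PosDef) {v : Fin n → ℤ} (hv : v ≠ 0) :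
    arithMin A ≤ formValue A v :=
  ciInf_le (f := fun v : {v : Fin n → ℤ // v ≠ 0} => formValue A v)
    ⟨0, by rintro _ ⟨w, rfl⟩; exact formValue_nonneg hA _⟩ ⟨v, hv⟩

instance [NeZero n] : Nonempty {v : Fin n → ℤ // v ≠ 0} :=
  ⟨⟨fun _ => 1, fun h => one_ne_zero (congrFun h 0)⟩⟩

theorem mem_ryshkov [NeZero n] {A : Matrix (Fin n) (Fin n) ℝ} :
    A ∈ ryshkov n ↔ A.PosDef ∧ ∀ v : Fin n → ℤ, v ≠ 0 → 1 ≤ formValue A v :=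
  ⟨fun h => ⟨h.1, fun _ hv => h.2.trans (arithMin_le h.1 hv)⟩,
    fun h => ⟨h.1, le_ciInf fun v => h.2 v.1 v.2⟩⟩

/-- The integer vectors on which a form takes the value one. -/
def unitVectors (A : Matrix (Fin n) (Fin n) ℝ) : Set (Fin n → ℤ) := {v | formValue A v = 1}

theorem ne_zero_of_mem_unitVectors {A : Matrix (Fin n) (Fin n) ℝ} {v : Fin n → ℤ}
    (hv : v ∈ unitVectors A) : v ≠ 0 := by
  rintro rfl
  have : formValue A 0 = 1 := hv
  rw [formValue_zero] at this
  exact zero_ne_one this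

theorem formValue_parallelogram (A : Matrix (Fin n) (Fin n) ℝ) (v w : Fin n → ℤ) :
    formValue A (v + w) + formValue A (v - w) = 2 * formValue A v + 2 * formValue A w := by
  have h : toReal (v - w) = toReal v - toReal w := by ext i; simp [toReal]
  simp only [formValue, toReal_add, h, Matrix.mulVec_add, Matrix.mulVec_sub, add_dotProduct,
    sub_dotProduct, dotProduct_add, dotProduct_sub]
  ring

theorem formValue_smul (A : Matrix (Fin n) (Fin n) ℝ) (c : ℤ) (v : Fin n → ℤ) :
    formValue A (c • v) = (c : ℝ) ^ 2 * formValue A v := by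
  simp only [formValue, toReal_smul, Matrix.mulVec_smul, smul_dotProduct, dotProduct_smul,
    smul_eq_mul]
  ring

/-- Two minimal vectors that are congruent modulo `2` agree up to sign. -/
theorem eq_or_eq_neg_of_unitVectors [NeZero n] {A : Matrix (Fin n) (Fin n) ℝ} (hA : A ∈ ryshkov n)
    {v w : Fin n → ℤ} (hv : v ∈ unitVectors A) (hw : w ∈ unitVectors A)
    (h : ∀ i, (v i : ZMod 2) = (w i : ZMod 2)) : w = v ∨ w = -v := by
  have h2 : ∀ i, ∃ c, v i - w i = 2 * c := fun i => by
    have := (ZMod.intCast_eq_intCast_iff_dvd_sub (w i) (v i) 2).1 (h i).symm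
    exact_mod_cast this
  choose c hc using h2
  by_contra! hne
  have e1 : v - w = (2 : ℤ) • c := funext fun i => hc i
  have e2 : v + w = (2 : ℤ) • (c + w) := funext fun i => by
    have := hc i
    simp only [Pi.add_apply, Pi.smul_apply, smul_eq_mul]
    linarith
  have hc0 : c ≠ 0 := by
    rintro rfl
    rw [smul_zero, sub_eq_zero] at e1
    exact hne.1 e1.symm
  have hcw : c + w ≠ 0 := by
    intro h0
    rw [h0, smul_zero] at e2
    exact hne.2 (eq_neg_of_add_eq_zero_right e2)
  have hp := formValue_parallelogram A v w
  rw [e1, e2, formValue_smul, formValue_smul, hv, hw] at hp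
  have h3 := (mem_ryshkov.1 hA).2 c hc0
  have h4 := (mem_ryshkov.1 hA).2 _ hcw
  norm_num at hp
  linarith

theorem finite_unitVectors [NeZero n] {A : Matrix (Fin n) (Fin n) ℝ} (hA : A ∈ ryshkov n) :
    (unitVectors A).Finite := by
  let r : (Fin n → ℤ) → (Fin n → ZMod 2) := fun v i => (v i : ZMod 2)
  refine Set.Finite.of_finite_fibers r (Set.toFinite _) ?_
  rintro _ ⟨v, hv, rfl⟩
  refine (Set.toFinite {v, -v}).subset ?_
  rintro w ⟨hw, hwv⟩
  exact eq_or_eq_neg_of_unitVectors hA hv hw fun i => (congrFun hwv i).symm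

theorem formValue_add (A B : Matrix (Fin n) (Fin n) ℝ) (v : Fin n → ℤ) :
    formValue (A + B) v = formValue A v + formValue B v := by
  rw [formValue, Matrix.add_mulVec, dotProduct_add]
  rfl

theorem formValue_const_smul (c : ℝ) (A : Matrix (Fin n) (Fin n) ℝ) (v : Fin n → ℤ) :
    formValue (c • A) v = c * formValue A v := by
  rw [formValue, Matrix.smul_mulVec, dotProduct_smul]
  rfl

theorem convex_face [NeZero n] (V : Set (Fin n → ℤ)) : Convex ℝ (face V) := by
  intro A hA B hB a b ha hb hab
  have hval : ∀ v, formValue (a • A + b • B) v = a * formValue A v + b * formValue B v :=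
    fun v => by rw [formValue_add, formValue_const_smul, formValue_const_smul]
  obtain ⟨hA1, hA2⟩ := mem_ryshkov.1 hA.1
  obtain ⟨hB1, hB2⟩ := mem_ryshkov.1 hB.1
  refine ⟨mem_ryshkov.2 ⟨?_, fun v hv => ?_⟩, fun v hv => ?_⟩
  · rcases ha.eq_or_lt with rfl | ha
    · rw [zero_add] at hab
      rw [hab, zero_smul, zero_add, one_smul]
      exact hB1
    · exact (hA1.smul ha).add_posSemidef (hB1.posSemidef.smul hb)
  · rw [hval]
    nlinarith [hA2 v hv, hB2 v hv]
  · rw [hval, hA.2 v hv, hB.2 v hv, mul_one, mul_one, hab]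

/-- The integer vectors on which all forms in a set take the value one. -/
def commonVectors (C : Set (Matrix (Fin n) (Fin n) ℝ)) : Set (Fin n → ℤ) :=
  {v | ∀ A ∈ C, formValue A v = 1}

theorem eq_face_commonVectors {C : Set (Matrix (Fin n) (Fin n) ℝ)} (hC : IsCell C) :
    C = face (commonVectors C) := by
  obtain ⟨-, -, V, rfl⟩ := hC
  exact Set.Subset.antisymm (fun A hA => ⟨hA.1, fun v hv => hv A hA⟩)
    fun A hA => ⟨hA.1, fun v hv => hA.2 v fun B hB => hB.2 v hv⟩

/-- A cell contains a form whose minimal vectors are minimal for all forms in the cell. -/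
theorem exists_generic [NeZero n] {C : Set (Matrix (Fin n) (Fin n) ℝ)} (hC : IsCell C) :
    ∃ A ∈ C, unitVectors A = commonVectors C := by
  obtain ⟨hne, hwr, V, rfl⟩ := hC
  obtain ⟨A, hA, hmin⟩ := exists_minimalFor_of_wellFoundedLT (· ∈ face V)
    (fun A => (unitVectors A).ncard) hne
  refine ⟨A, hA, Set.Subset.antisymm (fun v hv B hB => ?_) fun v hv => hv A hA⟩
  have hM := convex_face V hA hB (a := 1 / 2) (b := 1 / 2) (by norm_num) (by norm_num) (by norm_num)
  set M := (1 / 2 : ℝ) • A + (1 / 2 : ℝ) • B with hMdef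
  have hval : ∀ v, formValue M v = 1 / 2 * formValue A v + 1 / 2 * formValue B v :=
    fun v => by rw [hMdef, formValue_add, formValue_const_smul, formValue_const_smul]
  have key : ∀ w ∈ unitVectors M, formValue A w = 1 ∧ formValue B w = 1 := by
    intro w hw
    have h0 := ne_zero_of_mem_unitVectors hw
    have h1 := (mem_ryshkov.1 hA.1).2 w h0
    have h2 := (mem_ryshkov.1 hB.1).2 w h0
    have h3 : formValue M w = 1 := hw
    rw [hval] at h3
    constructor <;> linarith
  have hsub : unitVectors M ⊆ unitVectors A := fun w hw => (key w hw).1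
  have hle := hmin hM (Set.ncard_le_ncard hsub (finite_unitVectors hA.1))
  have heq := Set.eq_of_subset_of_ncard_le hsub hle (finite_unitVectors hA.1)
  exact (key v (heq ▸ hv)).2

theorem minVectors_eq_unitVectors {A : Matrix (Fin n) (Fin n) ℝ} (hA : A ∈ minOneForms n) :
    minVectors A = unitVectors A := by
  ext v
  change _ = _ ↔ _ = _
  rw [hA.2]

theorem exists_basis_commonVectors [NeZero n] {C : Set (Matrix (Fin n) (Fin n) ℝ)} (hC : IsCell C) :
    ∃ v : Fin n → (Fin n → ℤ), (∀ i, v i ∈ commonVectors C) ∧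
      LinearIndependent ℝ (fun i => toReal (v i)) := by
  obtain ⟨A, hA, hAC⟩ := exists_generic hC
  obtain ⟨hA1, v, hv, hli⟩ := hC.2.1 hA
  exact ⟨v, fun i => by rw [← hAC, ← minVectors_eq_unitVectors hA1]; exact hv i, hli⟩

/-! ### Stabilizers of cells -/

theorem transEquiv_mem_commonVectors {P : SL(n, ℤ)} {C : Set (Matrix (Fin n) (Fin n) ℝ)}
    (h : ∀ A ∈ C, realMat P * A * (realMat P)ᵀ ∈ C) {v : Fin n → ℤ} (hv : v ∈ commonVectors C) :
    transEquiv P v ∈ commonVectors C := fun A hA => by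
  have := hv _ (h A hA)
  rwa [formValue_conj] at this

theorem eq_of_transEquiv_eq [NeZero n] {P Q : SL(n, ℤ)} {v : Fin n → (Fin n → ℤ)}
    (hli : LinearIndependent ℝ (fun i => toReal (v i)))
    (h : ∀ i, transEquiv P (v i) = transEquiv Q (v i)) : P = Q := by
  have hb := hli.span_eq_top_of_card_eq_finrank (by simp)
  have h1 : (realMat P)ᵀ.mulVecLin = (realMat Q)ᵀ.mulVecLin := by
    refine LinearMap.ext_on_range hb fun i => ?_
    rw [Matrix.mulVecLin_apply, Matrix.mulVecLin_apply, ← toReal_transEquiv, ← toReal_transEquiv, h]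
  have h2 : realMat P = realMat Q :=
    Matrix.transpose_injective (Matrix.toLin'.injective h1)
  refine Matrix.SpecialLinearGroup.ext _ _ fun i j => ?_
  have := congrFun (congrFun h2 i) j
  simpa [realMat] using this

theorem slRep_mem_of_stabilizer {p : ℕ} {C : Cell n p} {P : SL(n, ℤ)}
    (hP : (P : PSL(n, ℤ)) ∈ cellStabilizer C) :
    ∀ A ∈ C.1, realMat P * A * (realMat P)ᵀ ∈ C.1 := fun A hA => by
  have h : pslRep n (P : PSL(n, ℤ)) '' C.1 = C.1 :=
    congrArg Subtype.val (MulAction.mem_stabilizer_iff (G := PSL(n, ℤ)) (α := Cell n p).1 hP)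
  rw [← h]
  exact ⟨A, hA, rfl⟩

instance finite_cellStabilizer [NeZero n] {p : ℕ} (C : Cell n p) : Finite (cellStabilizer C) := by
  obtain ⟨A, hA, hAC⟩ := exists_generic C.2.1
  obtain ⟨v, hv, hli⟩ := exists_basis_commonVectors C.2.1
  have hfin : (commonVectors C.1).Finite := by
    rw [← hAC]
    exact finite_unitVectors (by
      obtain ⟨-, -, V, hV⟩ := C.2.1
      rw [hV] at hA
      exact hA.1)
  have := hfin.to_subtype
  choose s hs using fun g : cellStabilizer C => QuotientGroup.mk_surjective (g : PSL(n, ℤ))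
  refine Finite.of_injective (fun g : cellStabilizer C => fun i =>
    (⟨transEquiv (s g) (v i), transEquiv_mem_commonVectors
      (slRep_mem_of_stabilizer (by rw [hs]; exact g.2)) (hv i)⟩ : commonVectors C.1)) ?_
  intro g g' h
  have h1 := eq_of_transEquiv_eq hli fun i => congrArg Subtype.val (congrFun h i)
  exact Subtype.ext (by rw [← hs g, ← hs g', h1])

/-- An element of order five of `PSL₄(ℤ)` lifts to an element of order five of `SL₄(ℤ)`. -/
theorem exists_lift_of_orderOf_eq_five {g : PSL(4, ℤ)} (hg : orderOf g = 5) :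
    ∃ P : SL(4, ℤ), (P : PSL(4, ℤ)) = g ∧ P ^ 5 = 1 ∧ P ≠ 1 := by
  obtain ⟨P, rfl⟩ := QuotientGroup.mk_surjective g
  have h5 : (P : PSL(4, ℤ)) ^ 5 = 1 := by rw [← hg, pow_orderOf_eq_one]
  have hc : P ^ 5 ∈ Subgroup.center SL(4, ℤ) := by
    rw [← QuotientGroup.eq_one_iff]
    exact h5
  obtain ⟨r, hr, h⟩ := Matrix.SpecialLinearGroup.mem_center_iff.1 hc
  have hu : IsUnit r := IsUnit.of_pow_eq_one hr (by simp)
  have hr2 : r * r = 1 := by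
    rcases Int.isUnit_iff.1 hu with rfl | rfl <;> norm_num
  have h10 : P ^ 10 = 1 := by
    refine Subtype.ext ?_
    have : P ^ 10 = P ^ 5 * P ^ 5 := by rw [← pow_add]
    rw [this, Matrix.SpecialLinearGroup.coe_mul, ← h, ← map_mul, hr2, map_one]
    rfl
  refine ⟨P ^ 6, ?_, ?_, ?_⟩
  · have : ((P ^ 6 : SL(4, ℤ)) : PSL(4, ℤ)) = (P : PSL(4, ℤ)) ^ 5 * (P : PSL(4, ℤ)) := by
      rw [← pow_succ]; rfl
    rw [this, h5, one_mul]
  · rw [← pow_mul, show 6 * 5 = 10 * 3 from rfl, pow_mul, h10, one_pow]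
  · intro h6
    have : (P : PSL(4, ℤ)) = 1 := by
      have : ((P ^ 6 : SL(4, ℤ)) : PSL(4, ℤ)) = (P : PSL(4, ℤ)) ^ 5 * (P : PSL(4, ℤ)) := by
        rw [← pow_succ]; rfl
      rw [h6, h5, one_mul] at this
      exact this.symm
    rw [this, orderOf_one] at hg
    exact absurd hg (by norm_num)

/-- A cell fixed by an element of finite order contains a fixed form whose minimal vectors are
minimal for all forms in the cell. -/
theorem exists_invariant_generic [NeZero n] {C : Set (Matrix (Fin n) (Fin n) ℝ)} (hC : IsCell C)
    {P : SL(n, ℤ)} (hP : ∀ A ∈ C, realMat P * A * (realMat P)ᵀ ∈ C) {m : ℕ} (hm : m ≠ 0)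
    (hPm : P ^ m = 1) :
    ∃ A ∈ C, unitVectors A = commonVectors C ∧ realMat P * A * (realMat P)ᵀ = A := by
  obtain ⟨A, hA, hAC⟩ := exists_generic hC
  have hmem : ∀ i : ℕ, slRep n (P ^ i) A ∈ C := by
    intro i
    induction i with
    | zero => rw [pow_zero, map_one]; exact hA
    | succ i ih =>
      rw [pow_succ', map_mul]
      exact hP _ ih
  have hm' : (0 : ℝ) < m := Nat.cast_pos.2 (Nat.pos_of_ne_zero hm)
  let M : Matrix (Fin n) (Fin n) ℝ := ∑ i ∈ Finset.range m, (1 / m : ℝ) • slRep n (P ^ i) A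
  have hM : M ∈ C := by
    obtain ⟨-, -, V, rfl⟩ := hC
    refine (convex_face V).sum_mem (fun i _ => by positivity) ?_ fun i _ => hmem i
    rw [Finset.sum_const, Finset.card_range, nsmul_eq_mul, mul_one_div_cancel hm'.ne']
  refine ⟨M, hM, Set.Subset.antisymm (fun v hv => ?_) fun v hv => hv M hM, ?_⟩
  · rw [← hAC]
    have h0 := ne_zero_of_mem_unitVectors hv
    have h1 : ∀ i, 1 ≤ formValue (slRep n (P ^ i) A) v := fun i => by
      obtain ⟨-, -, V, rfl⟩ := hC
      exact (mem_ryshkov.1 (hmem i).1).2 v h0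
    have hsum : ∀ s : Finset ℕ, formValue (∑ i ∈ s, (1 / m : ℝ) • slRep n (P ^ i) A) v =
        ∑ i ∈ s, (1 / m : ℝ) * formValue (slRep n (P ^ i) A) v := by
      intro s
      induction s using Finset.cons_induction with
      | empty => simp [formValue]
      | cons a s ha ih => rw [Finset.sum_cons, Finset.sum_cons, formValue_add, ih,
          formValue_const_smul]
    have h2 : formValue M v = 1 := hv
    rw [hsum, ← Finset.mul_sum, one_div, inv_mul_eq_one₀ hm'.ne'] at h2
    have h3 : ∑ i ∈ Finset.range m, (1 : ℝ) =
        ∑ i ∈ Finset.range m, formValue (slRep n (P ^ i) A) v := by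
      rw [← h2]; simp
    have h4 := (Finset.sum_eq_sum_iff_of_le fun i _ => h1 i).1 h3 0
      (Finset.mem_range.2 (Nat.pos_of_ne_zero hm))
    rw [pow_zero, map_one] at h4
    exact h4.symm
  · have h1 : slRep n P M = M := by
      simp only [M, map_sum, map_smul]
      have h2 : ∀ i, slRep n P (slRep n (P ^ i) A) = slRep n (P ^ (i + 1)) A := fun i => by
        rw [pow_succ', map_mul]; rfl
      simp only [h2]
      have h3 := Finset.sum_range_succ (fun i => (1 / m : ℝ) • slRep n (P ^ i) A) m
      rw [Finset.sum_range_succ', hPm, pow_zero] at h3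
      exact add_right_cancel h3
    exact h1

end WellRounded

/-! ### Integral matrices of order five -/

namespace WellRounded

open Polynomial in
theorem sum_pow_eq_zero_of_pow_five {Q : Matrix (Fin 4) (Fin 4) ℤ} (h5 : Q ^ 5 = 1) (h1 : Q ≠ 1) :
    ∑ i : Fin 5, Q ^ (i : ℕ) = 0 := by
  let f := (Int.castRingHom ℚ).mapMatrix (m := Fin 4)
  have hf : Function.Injective f := fun M N h => by
    ext i j
    have : ((M i j : ℤ) : ℚ) = N i j := congrFun (congrFun h i) j
    exact_mod_cast this
  set R := f Q with hR
  have hR5 : R ^ 5 = 1 := by rw [hR, ← map_pow, h5, map_one]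
  have hR1 : R ≠ 1 := fun h => h1 (hf (h.trans (map_one f).symm))
  have hprime : Fact (Nat.Prime 5) := ⟨by norm_num⟩
  have hdvd : minpoly ℚ R ∣ cyclotomic 5 ℚ * (X - 1) := by
    rw [cyclotomic_prime_mul_X_sub_one]
    exact minpoly.dvd _ _ (by simp [hR5])
  have hirr : Irreducible (cyclotomic 5 ℚ) := cyclotomic.irreducible_rat (by norm_num)
  have key : aeval R (cyclotomic 5 ℚ) = 0 := by
    by_cases h : cyclotomic 5 ℚ ∣ minpoly ℚ R
    · have hint : IsIntegral ℚ R := Matrix.isIntegral R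
      have hdeg : (minpoly ℚ R).natDegree ≤ (cyclotomic 5 ℚ).natDegree := by
        rw [natDegree_cyclotomic, Nat.totient_prime (by norm_num)]
        refine (natDegree_le_of_dvd (Matrix.minpoly_dvd_charpoly R)
          (Matrix.charpoly_monic R).ne_zero).trans ?_
        rw [Matrix.charpoly_natDegree_eq_dim, Fintype.card_fin]
      have heq := eq_of_monic_of_dvd_of_natDegree_le (cyclotomic.monic 5 ℚ)
        (minpoly.monic hint) h hdeg
      rw [← heq]
      exact minpoly.aeval ℚ R
    · have hcop : IsCoprime (cyclotomic 5 ℚ) (minpoly ℚ R) :=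
        (hirr.coprime_iff_not_dvd).2 h
      have h2 : minpoly ℚ R ∣ X - 1 := hcop.symm.dvd_of_dvd_mul_left hdvd
      have h3 := minpoly.dvd_iff.1 h2
      simp only [map_sub, aeval_X, map_one] at h3
      exact absurd (sub_eq_zero.1 h3) hR1
  refine hf ?_
  rw [cyclotomic_prime, map_sum] at key
  rw [map_zero, map_sum, Fin.sum_univ_eq_sum_range (fun i => f (Q ^ i)) 5, ← key]
  exact Finset.sum_congr rfl fun i _ => by rw [map_pow, map_pow, aeval_X]

/-! ### Residues -/

theorem sum_emod_eq {m : ℕ} (k : ℤ) :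
    ∑ t ∈ Finset.range m, (k + t) % (m : ℤ) = ∑ t ∈ Finset.range m, (t : ℤ) % m := by
  have step : ∀ k : ℤ, ∑ t ∈ Finset.range m, (k + 1 + t) % (m : ℤ) =
      ∑ t ∈ Finset.range m, (k + t) % (m : ℤ) := by
    intro k
    have h1 := Finset.sum_range_succ (fun t : ℕ => (k + t) % (m : ℤ)) m
    rw [Finset.sum_range_succ'] at h1
    simp only [Nat.cast_zero, add_zero, Int.add_emod_right] at h1
    rw [← add_right_cancel h1]
    refine Finset.sum_congr rfl fun t _ => ?_
    push_cast
    ring_nf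
  induction k with
  | zero => simp
  | succ k ih => rw [step, ih]
  | pred k ih =>
    rw [← ih, ← step]
    refine Finset.sum_congr rfl fun t _ => ?_
    ring_nf

/-- On average over all translates, the squared difference of the residues of two integers modulo
`m` is at most `m ^ 2 / 4`. -/
theorem sum_sq_emod_sub_le {m : ℕ} (hm : 0 < m) (k l : ℤ) :
    4 * ∑ t ∈ Finset.range m, ((k + t) % (m : ℤ) - (l + t) % (m : ℤ)) ^ 2 ≤ (m : ℤ) ^ 3 := by
  have hm' : (0 : ℤ) < m := by exact_mod_cast hm
  set d := (k - l) % (m : ℤ) with hd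
  -- The difference of the residues is either `d` or `d - m`, hence a root of a fixed quadratic.
  have hroot : ∀ t : ℕ, ((k + t) % (m : ℤ) - (l + t) % (m : ℤ)) ^ 2 =
      (2 * d - m) * ((k + t) % (m : ℤ) - (l + t) % (m : ℤ)) - d * (d - m) := by
    intro t
    have h1 := Int.emod_nonneg (k + t) hm'.ne'
    have h2 := Int.emod_lt_of_pos (k + t) hm'
    have h3 := Int.emod_nonneg (l + t) hm'.ne'
    have h4 := Int.emod_lt_of_pos (l + t) hm'
    have h5 := Int.emod_nonneg (k - l) hm'.ne'
    have h6 := Int.emod_lt_of_pos (k - l) hm'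
    have h7 : ((k + t) % (m : ℤ) - (l + t) % (m : ℤ)) % m = d := by
      rw [← Int.sub_emod, hd]; ring_nf
    set e := (k + t) % (m : ℤ) - (l + t) % (m : ℤ)
    have h8 : e = d ∨ e = d - m := by
      rcases le_or_gt 0 e with h | h
      · left
        rw [← h7, Int.emod_eq_of_lt h (by omega)]
      · right
        have : (e + m) % (m : ℤ) = e + m := Int.emod_eq_of_lt (by omega) (by omega)
        rw [Int.add_emod_right, h7] at this
        omega
    rcases h8 with h | h <;> rw [h] <;> ring
  rw [Finset.sum_congr rfl fun t _ => hroot t, Finset.sum_sub_distrib, ← Finset.mul_sum,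
    Finset.sum_sub_distrib, sum_emod_eq, sum_emod_eq l, sub_self, mul_zero,
    Finset.sum_const, Finset.card_range, nsmul_eq_mul]
  nlinarith [mul_nonneg hm'.le (sq_nonneg (2 * d - m))]

/-! ### Forms invariant under an element of order five -/

/-- The sum of the squared differences along the pentagon `0, 1, 2, 3, 4`. -/
def cyc₁ (y : Fin 5 → ℤ) : ℤ :=
  (y 0 - y 1) ^ 2 + (y 1 - y 2) ^ 2 + (y 2 - y 3) ^ 2 + (y 3 - y 4) ^ 2 + (y 4 - y 0) ^ 2

/-- The sum of the squared differences along the pentagram `0, 2, 4, 1, 3`. -/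
def cyc₂ (y : Fin 5 → ℤ) : ℤ :=
  (y 0 - y 2) ^ 2 + (y 2 - y 4) ^ 2 + (y 4 - y 1) ^ 2 + (y 1 - y 3) ^ 2 + (y 3 - y 0) ^ 2

theorem two_le_sum_sq {a b c d e : ℤ} (h : a + b + c + d + e = 0)
    (h0 : ¬ (a = 0 ∧ b = 0 ∧ c = 0 ∧ d = 0)) :
    2 ≤ a ^ 2 + b ^ 2 + c ^ 2 + d ^ 2 + e ^ 2 := by
  -- A sum of squares has the parity of the sum.
  have hpar : ∀ x : ℤ, ∃ k, x ^ 2 = x + 2 * k := fun x => by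
    obtain ⟨k, hk⟩ := Int.even_mul_pred_self x
    exact ⟨k, by linear_combination hk⟩
  obtain ⟨k₁, h₁⟩ := hpar a
  obtain ⟨k₂, h₂⟩ := hpar b
  obtain ⟨k₃, h₃⟩ := hpar c
  obtain ⟨k₄, h₄⟩ := hpar d
  obtain ⟨k₅, h₅⟩ := hpar e
  by_contra! hlt
  have ha := sq_nonneg a
  have hb := sq_nonneg b
  have hc := sq_nonneg c
  have hd := sq_nonneg d
  have he := sq_nonneg e
  refine h0 ⟨?_, ?_, ?_, ?_⟩ <;> refine pow_eq_zero_iff two_ne_zero |>.1 ?_ <;> omega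

theorem two_le_cyc₁ {y : Fin 5 → ℤ} (hy : ¬ ∀ i, y i = y 4) : 2 ≤ cyc₁ y := by
  refine two_le_sum_sq (by ring) fun h => hy ?_
  intro i
  fin_cases i <;> simp <;> omega

theorem two_le_cyc₂ {y : Fin 5 → ℤ} (hy : ¬ ∀ i, y i = y 4) : 2 ≤ cyc₂ y := by
  refine two_le_sum_sq (by ring) fun h => hy ?_
  intro i
  fin_cases i <;> simp <;> omega

/-- `A` is a nonnegative combination of the two pentagonal forms in the coordinates with respect to
five vectors with sum zero. -/
structure IsPentagonal (A : Matrix (Fin 4) (Fin 4) ℝ) (p q : ℝ) (v : Fin 5 → Fin 4 → ℤ) : Prop where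
  p_nonneg : 0 ≤ p
  q_nonneg : 0 ≤ q
  add_eq : p + q = 1 / 2
  sum_eq : ∑ i, v i = 0
  form : ∀ y : Fin 5 → ℤ, formValue A (∑ i, y i • v i) = p * cyc₁ y + q * cyc₂ y

variable {A : Matrix (Fin 4) (Fin 4) ℝ} {p q : ℝ} {v : Fin 5 → Fin 4 → ℤ}

theorem IsPentagonal.one_le (h : IsPentagonal A p q v) {y : Fin 5 → ℤ} (hy : ¬ ∀ i, y i = y 4) :
    1 ≤ p * cyc₁ y + q * cyc₂ y := by
  have h1 : (2 : ℝ) ≤ cyc₁ y := by exact_mod_cast two_le_cyc₁ hy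
  have h2 : (2 : ℝ) ≤ cyc₂ y := by exact_mod_cast two_le_cyc₂ hy
  nlinarith [h.p_nonneg, h.q_nonneg, h.add_eq]

theorem formValue_sum (A : Matrix (Fin 4) (Fin 4) ℝ) (v : Fin 5 → Fin 4 → ℤ) (y : Fin 5 → ℤ) :
    formValue A (∑ i, y i • v i) = ∑ i, ∑ j, (y i * y j : ℝ) * bilin A (v i) (v j) := by
  have h : toReal (∑ i, y i • v i) = ∑ i, (y i : ℝ) • toReal (v i) := by
    simp only [Fin.sum_univ_five, toReal_add, toReal_smul]
  rw [formValue, h, Matrix.mulVec_sum, sum_dotProduct]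
  refine Finset.sum_congr rfl fun i _ => ?_
  rw [dotProduct_sum]
  refine Finset.sum_congr rfl fun j _ => ?_
  rw [Matrix.mulVec_smul, smul_dotProduct, dotProduct_smul, bilin, smul_eq_mul, smul_eq_mul,
    mul_assoc]

theorem transpose_eq_of_posDef {n : ℕ} {A : Matrix (Fin n) (Fin n) ℝ} (hA : A.PosDef) : Aᵀ = A := by
  rw [← Matrix.conjTranspose_eq_transpose_of_trivial]
  exact hA.isHermitian

theorem bilin_comm (hA : A.PosDef) (v w : Fin 4 → ℤ) : bilin A v w = bilin A w v := by
  rw [bilin, bilin, Matrix.dotProduct_mulVec, ← Matrix.mulVec_transpose, transpose_eq_of_posDef hA,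
    dotProduct_comm]

theorem bilin_add_left (A : Matrix (Fin 4) (Fin 4) ℝ) (u v w : Fin 4 → ℤ) :
    bilin A (u + v) w = bilin A u w + bilin A v w := by
  rw [bilin, toReal_add, add_dotProduct]; rfl

theorem bilin_add_right (A : Matrix (Fin 4) (Fin 4) ℝ) (u v w : Fin 4 → ℤ) :
    bilin A u (v + w) = bilin A u v + bilin A u w := by
  rw [bilin, toReal_add, Matrix.mulVec_add, dotProduct_add]; rfl

theorem bilin_mulVec {P : SL(4, ℤ)} (hPA : realMat P * A * (realMat P)ᵀ = A)
    (v w : Fin 4 → ℤ) :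
    bilin A ((P : Matrix (Fin 4) (Fin 4) ℤ)ᵀ *ᵥ v) ((P : Matrix (Fin 4) (Fin 4) ℤ)ᵀ *ᵥ w) =
      bilin A v w := by
  change toReal (transEquiv P v) ⬝ᵥ (A *ᵥ toReal (transEquiv P w)) = _
  nth_rw 2 [← hPA]
  rw [bilin, toReal_transEquiv, toReal_transEquiv, ← Matrix.mulVec_mulVec, ← Matrix.mulVec_mulVec,
    Matrix.dotProduct_mulVec (toReal v), ← Matrix.mulVec_transpose]

theorem add_mulVec_ne_zero {R : Matrix (Fin 4) (Fin 4) ℤ} (hR : R ^ 5 = 1) {w : Fin 4 → ℤ}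
    (hw : w ≠ 0) : w + R *ᵥ w ≠ 0 := by
  intro h
  have h1 : R *ᵥ w = -w := eq_neg_of_add_eq_zero_right h
  have h2 : R ^ 5 *ᵥ w = -w := by
    simp only [pow_succ, pow_zero, one_mul, ← Matrix.mulVec_mulVec, h1, Matrix.mulVec_neg, neg_neg]
  rw [hR, Matrix.one_mulVec] at h2
  exact hw (self_eq_neg.1 h2)

/-- The orbit of a minimal vector of a form under a symmetry of order five puts the form into
pentagonal shape. -/
theorem exists_isPentagonal (hA : A ∈ ryshkov 4) {P : SL(4, ℤ)} (h5 : P ^ 5 = 1) (h1 : P ≠ 1)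
    (hPA : realMat P * A * (realMat P)ᵀ = A) {u : Fin 4 → ℤ} (hu : formValue A u = 1) :
    ∃ p q v, IsPentagonal A p q v := by
  set Q : Matrix (Fin 4) (Fin 4) ℤ := (P : Matrix (Fin 4) (Fin 4) ℤ)ᵀ with hQ
  have hQ5 : Q ^ 5 = 1 := by
    rw [hQ, ← Matrix.transpose_pow, ← Matrix.SpecialLinearGroup.coe_pow, h5,
      Matrix.SpecialLinearGroup.coe_one, Matrix.transpose_one]
  have hQ1 : Q ≠ 1 := fun h => h1 <| Subtype.ext <| by
    have := congrArg Matrix.transpose h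
    rw [hQ, Matrix.transpose_transpose, Matrix.transpose_one] at this
    exact this
  have hu0 : u ≠ 0 := ne_zero_of_mem_unitVectors hu
  let w : ℕ → Fin 4 → ℤ := fun k => Q ^ k *ᵥ u
  have hw : ∀ k, w (k + 1) = Q *ᵥ w k := fun k => by
    simp only [w]
    rw [pow_succ', Matrix.mulVec_mulVec]
  have hw5 : ∀ k, w (k + 5) = w k := fun k => by
    simp only [w]
    rw [pow_add, hQ5, mul_one]
  have hB : ∀ i j, bilin A (w (i + 1)) (w (j + 1)) = bilin A (w i) (w j) := fun i j => by
    rw [hw, hw]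
    exact bilin_mulVec hPA _ _
  have hc := fun i j => bilin_comm (mem_ryshkov.1 hA).1 (w i) (w j)
  have hu1 : bilin A (w 0) (w 0) = 1 := by
    simp only [w, pow_zero, Matrix.one_mulVec]
    exact hu
  have hsum : w 0 + w 1 + w 2 + w 3 + w 4 = 0 := by
    have h := congrArg (· *ᵥ u) (sum_pow_eq_zero_of_pow_five hQ5 hQ1)
    simp only [Fin.sum_univ_five, Matrix.add_mulVec, Matrix.zero_mulVec] at h
    exact h
  set a := bilin A (w 0) (w 1) with ha
  set b := bilin A (w 0) (w 2) with hb
  have h30 : bilin A (w 3) (w 0) = b := by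
    rw [← hw5 0, hB 2 4, hB 1 3, hB 0 2]
  have h40 : bilin A (w 4) (w 0) = a := by
    rw [← hw5 0, hB 3 4, hB 2 3, hB 1 2, hB 0 1]
  have h41 : bilin A (w 4) (w 1) = b := by rw [hB 3 0, h30]
  have h11 : bilin A (w 1) (w 1) = 1 := by rw [hB 0 0, hu1]
  have h22 : bilin A (w 2) (w 2) = 1 := by rw [hB 1 1, h11]
  have h33 : bilin A (w 3) (w 3) = 1 := by rw [hB 2 2, h22]
  have h44 : bilin A (w 4) (w 4) = 1 := by rw [hB 3 3, h33]
  have h12 : bilin A (w 1) (w 2) = a := hB 0 1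
  have h23 : bilin A (w 2) (w 3) = a := by rw [hB 1 2, h12]
  have h34 : bilin A (w 3) (w 4) = a := by rw [hB 2 3, h23]
  have h13 : bilin A (w 1) (w 3) = b := hB 0 2
  have h24 : bilin A (w 2) (w 4) = b := by rw [hB 1 3, h13]
  have hab : 1 + 2 * a + 2 * b = 0 := by
    have h : bilin A (w 0 + w 1 + w 2 + w 3 + w 4) (w 0) = 0 := by
      rw [hsum, bilin, show toReal (0 : Fin 4 → ℤ) = 0 by ext; simp [toReal], zero_dotProduct]
    simp only [bilin_add_left] at h
    rw [hc 1 0, hc 2 0, h30, h40, hu1] at h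
    linarith
  have hadd : ∀ k, bilin A (w k) (w k) = 1 → w 0 + w k ≠ 0 → 1 ≤ 2 + 2 * bilin A (w 0) (w k) := by
    intro k hk h0
    have h : formValue A (w 0 + w k) = bilin A (w 0 + w k) (w 0 + w k) := rfl
    have h2 := (mem_ryshkov.1 hA).2 _ h0
    rw [h, bilin_add_left, bilin_add_right, bilin_add_right, hu1, hk, hc k 0] at h2
    linarith
  have hw0 : w 0 = u := by simp [w]
  have ha1 := hadd 1 h11 (by
    rw [hw, hw0]
    exact add_mulVec_ne_zero hQ5 hu0)
  have hb1 := hadd 2 h22 (by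
    rw [hw0]
    exact add_mulVec_ne_zero (R := Q ^ 2) (by rw [← pow_mul, mul_comm, pow_mul, hQ5, one_pow]) hu0)
  refine ⟨-a, -b, fun i => w i, by linarith, by linarith, by linarith, ?_, fun y => ?_⟩
  · rw [Fin.sum_univ_five]
    exact hsum
  · rw [formValue_sum]
    simp only [Fin.sum_univ_five, cyc₁, cyc₂]
    simp only [Fin.isValue, Fin.val_zero, Fin.val_one, Fin.val_two,
      show ((3 : Fin 5) : ℕ) = 3 from rfl, show ((4 : Fin 5) : ℕ) = 4 from rfl]
    rw [hc 1 0, hc 2 0, hc 2 1, hc 3 1, hc 3 2, hc 4 2, hc 4 3, hc 0 3, hc 0 4, hc 1 4]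
    rw [hu1, h11, h22, h33, h44, h12, h13, h23, h24, h34, h30, h40, h41]
    push_cast
    linear_combination ((y 0 : ℝ) ^ 2 + (y 1 : ℝ) ^ 2 + (y 2 : ℝ) ^ 2 + (y 3 : ℝ) ^ 2
      + (y 4 : ℝ) ^ 2) * hab

theorem sum_cyc₁_emod_le {m : ℕ} (hm : 0 < m) (k : Fin 5 → ℤ) :
    4 * ∑ t ∈ Finset.range m, cyc₁ (fun i => (k i + t) % m) ≤ 5 * (m : ℤ) ^ 3 := by
  simp only [cyc₁, Finset.sum_add_distrib]
  linarith [sum_sq_emod_sub_le hm (k 0) (k 1), sum_sq_emod_sub_le hm (k 1) (k 2),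
    sum_sq_emod_sub_le hm (k 2) (k 3), sum_sq_emod_sub_le hm (k 3) (k 4),
    sum_sq_emod_sub_le hm (k 4) (k 0)]

theorem sum_cyc₂_emod_le {m : ℕ} (hm : 0 < m) (k : Fin 5 → ℤ) :
    4 * ∑ t ∈ Finset.range m, cyc₂ (fun i => (k i + t) % m) ≤ 5 * (m : ℤ) ^ 3 := by
  simp only [cyc₂, Finset.sum_add_distrib]
  linarith [sum_sq_emod_sub_le hm (k 0) (k 2), sum_sq_emod_sub_le hm (k 2) (k 4),
    sum_sq_emod_sub_le hm (k 4) (k 1), sum_sq_emod_sub_le hm (k 1) (k 3),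
    sum_sq_emod_sub_le hm (k 3) (k 0)]

theorem vecMul_castSucc (v : Fin 5 → Fin 4 → ℤ) (y : Fin 4 → ℤ) :
    y ᵥ* Matrix.of (fun i : Fin 4 => v i.castSucc) =
      ∑ i, (Fin.snoc y 0 : Fin 5 → ℤ) i • v i := by
  rw [Fin.sum_univ_castSucc, Matrix.vecMul_eq_sum, Fin.snoc_last, zero_smul, add_zero]
  exact Finset.sum_congr rfl fun i _ => by
    rw [Fin.snoc_castSucc]
    rfl

theorem IsPentagonal.det_ne_zero (h : IsPentagonal A p q v) :
    (Matrix.of fun i : Fin 4 => v i.castSucc).det ≠ 0 := by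
  intro hdet
  obtain ⟨y, hy, hy0⟩ := Matrix.exists_vecMul_eq_zero_iff.2 hdet
  rw [vecMul_castSucc] at hy0
  have h1 := h.form (Fin.snoc y 0)
  rw [hy0, formValue_zero] at h1
  have h2 := h.one_le (y := Fin.snoc y 0) fun h3 => hy <| funext fun i => by
    have h4 := h3 i.castSucc
    rw [Fin.snoc_castSucc] at h4
    rw [h4]
    exact Fin.snoc_last (α := fun _ => ℤ) 0 y
  linarith

/-- The vectors of a pentagonal form span the lattice. If `m` is the index of their span and
`m w = ∑ kᵢ vᵢ`, then the `m` vectors obtained by reducing the coefficients `kᵢ + t` modulo `m`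
have on average a value less than one, so that one of them vanishes. -/
theorem IsPentagonal.exists_eq_sum (h : IsPentagonal A p q v) (hA : A ∈ ryshkov 4)
    (w : Fin 4 → ℤ) : ∃ e : Fin 5 → ℤ, w = ∑ i, e i • v i := by
  obtain ⟨m, hm, k, hk⟩ : ∃ m : ℕ, 0 < m ∧ ∃ k : Fin 5 → ℤ, (m : ℤ) • w = ∑ i, k i • v i := by
    set W := Matrix.of fun i : Fin 4 => v i.castSucc with hW
    refine ⟨W.det.natAbs, Int.natAbs_pos.2 h.det_ne_zero,
      Fin.snoc ((W.det.sign • w) ᵥ* W.adjugate) 0, ?_⟩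
    rw [← vecMul_castSucc, Matrix.vecMul_vecMul, Matrix.adjugate_mul, Matrix.vecMul_smul,
      Matrix.vecMul_one, smul_smul, mul_comm, Int.sign_mul_self_eq_natAbs]
  by_contra! hne
  have hm' : (0 : ℤ) < m := by exact_mod_cast hm
  have hval : ∀ t : ℕ, (m : ℝ) ^ 2 ≤ p * cyc₁ (fun i => (k i + t) % m) +
      q * cyc₂ (fun i => (k i + t) % m) := by
    intro t
    have h0 : w - ∑ i, ((k i + t) / m) • v i ≠ 0 := sub_ne_zero.2 (hne _)
    have h1 : (m : ℤ) • (w - ∑ i, ((k i + t) / m) • v i) = ∑ i, ((k i + t) % m) • v i := by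
      have h2 : ∀ i, ((k i + t) % (m : ℤ)) • v i =
          k i • v i + (t : ℤ) • v i - (m : ℤ) • ((k i + t) / (m : ℤ)) • v i := fun i => by
        rw [smul_smul, ← add_smul, ← sub_smul, Int.emod_def]
      rw [Finset.sum_congr rfl fun i _ => h2 i, Finset.sum_sub_distrib, Finset.sum_add_distrib,
        ← Finset.smul_sum, ← Finset.smul_sum, h.sum_eq, smul_zero, add_zero, ← hk, smul_sub]
    rw [← h.form, ← h1, formValue_smul]
    have h3 := (mem_ryshkov.1 hA).2 _ h0
    have h4 : (0 : ℝ) ≤ (m : ℝ) ^ 2 := by positivity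
    push_cast
    nlinarith
  have hsum := Finset.sum_le_sum fun t (_ : t ∈ Finset.range m) => hval t
  rw [Finset.sum_const, Finset.card_range, Finset.sum_add_distrib, ← Finset.mul_sum,
    ← Finset.mul_sum, nsmul_eq_mul] at hsum
  have h1 : (4 * ∑ t ∈ Finset.range m, (cyc₁ (fun i => (k i + t) % m) : ℝ)) ≤ 5 * (m : ℝ) ^ 3 := by
    exact_mod_cast sum_cyc₁_emod_le hm k
  have h2 : (4 * ∑ t ∈ Finset.range m, (cyc₂ (fun i => (k i + t) % m) : ℝ)) ≤ 5 * (m : ℝ) ^ 3 := by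
    exact_mod_cast sum_cyc₂_emod_le hm k
  have h3 := mul_le_mul_of_nonneg_left h1 h.p_nonneg
  have h4 := mul_le_mul_of_nonneg_left h2 h.q_nonneg
  have h5 : (0 : ℝ) < (m : ℝ) ^ 3 := by positivity
  have h6 : p * (5 * (m : ℝ) ^ 3) + q * (5 * (m : ℝ) ^ 3) = 5 / 2 * (m : ℝ) ^ 3 := by
    linear_combination 5 * (m : ℝ) ^ 3 * h.add_eq
  nlinarith

end WellRounded

/-! ### Pentagonal forms in standard coordinates -/

namespace WellRounded

/-- The standard superbase of `ℤ⁴`: the standard basis and the negative of its sum. -/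
def stdVec : Fin 5 → Fin 4 → ℤ :=
  ![![1, 0, 0, 0], ![0, 1, 0, 0], ![0, 0, 1, 0], ![0, 0, 0, 1], ![-1, -1, -1, -1]]

/-- The vectors of the standard superbase and their negatives. -/
def superbaseVectors : Set (Fin 4 → ℤ) := {w | ∃ i, w = stdVec i ∨ w = -stdVec i}

theorem stdVec_castSucc (i : Fin 4) : stdVec i.castSucc = Pi.single i 1 := by
  revert i; decide

theorem sum_stdVec : ∑ i, stdVec i = 0 := by decide

theorem sum_smul_stdVec (y : Fin 5 → ℤ) :
    ∑ i, y i • stdVec i = fun i : Fin 4 => y i.castSucc - y 4 := by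
  ext i
  fin_cases i <;> simp [Fin.sum_univ_five, stdVec] <;> ring

/-- The pentagonal form with parameters `p` and `q` in the coordinates of the standard superbase,
provided that `p + q = 1 / 2`. -/
noncomputable def pentagonalForm (p q : ℝ) : Matrix (Fin 4) (Fin 4) ℝ :=
  !![1, -p, -q, -q; -p, 1, -p, -q; -q, -p, 1, -p; -q, -q, -p, 1]

/-- The Gram matrix `(I + J) / 2` of the root lattice `A₄`, scaled to minimum one. -/
noncomputable def rootForm : Matrix (Fin 4) (Fin 4) ℝ :=
  !![1, 1 / 2, 1 / 2, 1 / 2; 1 / 2, 1, 1 / 2, 1 / 2; 1 / 2, 1 / 2, 1, 1 / 2;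
    1 / 2, 1 / 2, 1 / 2, 1]

theorem dotProduct_pentagonalForm {p q : ℝ} (h : p + q = 1 / 2) (x : Fin 4 → ℝ) :
    x ⬝ᵥ (pentagonalForm p q *ᵥ x) =
      p * ((x 0 - x 1) ^ 2 + (x 1 - x 2) ^ 2 + (x 2 - x 3) ^ 2 + x 3 ^ 2 + x 0 ^ 2) +
      q * ((x 0 - x 2) ^ 2 + x 2 ^ 2 + x 1 ^ 2 + (x 1 - x 3) ^ 2 + (x 3 - x 0) ^ 2) := by
  simp [pentagonalForm, dotProduct, Matrix.mulVec, Fin.sum_univ_four]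
  linear_combination (-2) * (x 0 ^ 2 + x 1 ^ 2 + x 2 ^ 2 + x 3 ^ 2) * h

theorem dotProduct_rootForm (x : Fin 4 → ℝ) :
    x ⬝ᵥ (rootForm *ᵥ x) =
      1 / 2 * (x 0 ^ 2 + x 1 ^ 2 + x 2 ^ 2 + x 3 ^ 2 + (-(x 0 + x 1 + x 2 + x 3)) ^ 2) := by
  simp [rootForm, dotProduct, Matrix.mulVec, Fin.sum_univ_four]
  ring

theorem isPentagonal_pentagonalForm {p q : ℝ} (hp : 0 ≤ p) (hq : 0 ≤ q) (h : p + q = 1 / 2) :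
    IsPentagonal (pentagonalForm p q) p q stdVec := by
  refine ⟨hp, hq, h, sum_stdVec, fun y => ?_⟩
  rw [sum_smul_stdVec, formValue, dotProduct_pentagonalForm h]
  simp [toReal, cyc₁, cyc₂]
  ring

theorem posDef_of_forall {A : Matrix (Fin 4) (Fin 4) ℝ} (hA : Aᵀ = A)
    (h : ∀ x : Fin 4 → ℝ, 0 ≤ x ⬝ᵥ (A *ᵥ x)) (h0 : ∀ x : Fin 4 → ℝ, x ⬝ᵥ (A *ᵥ x) = 0 → x = 0) :
    A.PosDef := by
  refine Matrix.PosDef.of_dotProduct_mulVec_pos ?_ fun x hx => ?_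
  · rw [Matrix.IsHermitian, Matrix.conjTranspose_eq_transpose_of_trivial, hA]
  · rw [star_trivial]
    exact (h x).lt_of_ne fun h1 => hx (h0 x h1.symm)

theorem posDef_pentagonalForm {p q : ℝ} (hp : 0 < p) (hq : 0 ≤ q) (h : p + q = 1 / 2) :
    (pentagonalForm p q).PosDef := by
  refine posDef_of_forall ?_ (fun x => ?_) fun x hx => ?_
  · ext i j
    fin_cases i <;> fin_cases j <;> rfl
  · rw [dotProduct_pentagonalForm h]
    positivity
  · rw [dotProduct_pentagonalForm h] at hx
    have h1 : (x 0 - x 1) ^ 2 + (x 1 - x 2) ^ 2 + (x 2 - x 3) ^ 2 + x 3 ^ 2 + x 0 ^ 2 = 0 := by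
      have h2 : 0 ≤ q * ((x 0 - x 2) ^ 2 + x 2 ^ 2 + x 1 ^ 2 + (x 1 - x 3) ^ 2 +
          (x 3 - x 0) ^ 2) := by positivity
      have h3 : 0 ≤ (x 0 - x 1) ^ 2 + (x 1 - x 2) ^ 2 + (x 2 - x 3) ^ 2 + x 3 ^ 2 + x 0 ^ 2 := by
        positivity
      nlinarith
    have s1 := sq_nonneg (x 0 - x 1)
    have s2 := sq_nonneg (x 1 - x 2)
    have s3 := sq_nonneg (x 2 - x 3)
    have s4 := sq_nonneg (x 3)
    have s5 := sq_nonneg (x 0)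
    have e5 : x 0 = 0 := pow_eq_zero_iff two_ne_zero |>.1 (by linarith)
    have e1 : x 0 - x 1 = 0 := pow_eq_zero_iff two_ne_zero |>.1 (by linarith)
    have e2 : x 1 - x 2 = 0 := pow_eq_zero_iff two_ne_zero |>.1 (by linarith)
    have e4 : x 3 = 0 := pow_eq_zero_iff two_ne_zero |>.1 (by linarith)
    ext i
    fin_cases i <;> simp <;> linarith

theorem posDef_rootForm : rootForm.PosDef := by
  refine posDef_of_forall ?_ (fun x => ?_) fun x hx => ?_
  · ext i j
    fin_cases i <;> fin_cases j <;> rfl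
  · rw [dotProduct_rootForm]
    positivity
  · rw [dotProduct_rootForm] at hx
    have s1 := sq_nonneg (x 0)
    have s2 := sq_nonneg (x 1)
    have s3 := sq_nonneg (x 2)
    have s4 := sq_nonneg (x 3)
    have s5 := sq_nonneg (-(x 0 + x 1 + x 2 + x 3))
    ext i
    refine pow_eq_zero_iff two_ne_zero |>.1 ?_
    fin_cases i <;> simp only [Fin.mk_one, Fin.zero_eta, Fin.reduceFinMk] <;> linarith

theorem eq_sum_smul_stdVec (w : Fin 4 → ℤ) : w = ∑ i, (Fin.snoc w 0 : Fin 5 → ℤ) i • stdVec i := by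
  rw [sum_smul_stdVec]
  ext i
  rw [Fin.snoc_castSucc, show (Fin.snoc w 0 : Fin 5 → ℤ) 4 = 0 from
    Fin.snoc_last (α := fun _ => ℤ) 0 w, sub_zero]

theorem snoc_ne_const {w : Fin 4 → ℤ} (hw : w ≠ 0) :
    ¬ ∀ i, (Fin.snoc w 0 : Fin 5 → ℤ) i = (Fin.snoc w 0 : Fin 5 → ℤ) 4 := fun h => hw <| by
  rw [eq_sum_smul_stdVec w, sum_smul_stdVec]
  ext i
  rw [h i.castSucc, sub_self]
  rfl

theorem pentagonalForm_mem_ryshkov {p q : ℝ} (hp : 0 < p) (hq : 0 ≤ q) (h : p + q = 1 / 2) :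
    pentagonalForm p q ∈ ryshkov 4 := by
  refine mem_ryshkov.2 ⟨posDef_pentagonalForm hp hq h, fun w hw => ?_⟩
  have h1 := isPentagonal_pentagonalForm hp.le hq h
  rw [eq_sum_smul_stdVec w, h1.form]
  exact h1.one_le (snoc_ne_const hw)

theorem rootForm_mem_ryshkov : rootForm ∈ ryshkov 4 := by
  refine mem_ryshkov.2 ⟨posDef_rootForm, fun w hw => ?_⟩
  rw [formValue, dotProduct_rootForm]
  have h1 : 2 ≤ w 0 ^ 2 + w 1 ^ 2 + w 2 ^ 2 + w 3 ^ 2 + (-(w 0 + w 1 + w 2 + w 3)) ^ 2 :=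
    two_le_sum_sq (by ring) fun h => hw <| by
      ext i
      fin_cases i <;> simp [h]
  have h2 : (2 : ℝ) ≤ (w 0 : ℝ) ^ 2 + (w 1 : ℝ) ^ 2 + (w 2 : ℝ) ^ 2 + (w 3 : ℝ) ^ 2 +
      (-((w 0 : ℝ) + w 1 + w 2 + w 3)) ^ 2 := by exact_mod_cast h1
  simp only [toReal]
  linarith

theorem mem_superbaseVectors_of_cyc {y : Fin 5 → ℤ} (h1 : cyc₁ y = 2) (h2 : cyc₂ y = 2)
    (h4 : y 4 = 0) : ∑ i, y i • stdVec i ∈ superbaseVectors := by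
  have key : ∀ a ∈ Finset.Icc (-1 : ℤ) 1, ∀ b ∈ Finset.Icc (-1 : ℤ) 1, ∀ c ∈ Finset.Icc (-1 : ℤ) 1,
      ∀ d ∈ Finset.Icc (-1 : ℤ) 1, cyc₁ ![a, b, c, d, 0] = 2 → cyc₂ ![a, b, c, d, 0] = 2 →
      ∃ i, ![a, b, c, d] = stdVec i ∨ ![a, b, c, d] = -stdVec i := by
    decide +kernel
  have hy : y = ![y 0, y 1, y 2, y 3, 0] := by
    ext i
    fin_cases i <;> first | rfl | exact h4
  have hb : ∀ x : ℤ, x ^ 2 ≤ 2 → x ∈ Finset.Icc (-1 : ℤ) 1 := fun x hx => by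
    rw [Finset.mem_Icc]
    constructor <;> nlinarith
  have e1 := h1
  have e2 := h2
  rw [cyc₁, h4] at e1
  rw [cyc₂, h4] at e2
  rw [hy] at h1 h2
  have s01 := sq_nonneg (y 0 - y 1)
  have s12 := sq_nonneg (y 1 - y 2)
  have s23 := sq_nonneg (y 2 - y 3)
  have s02 := sq_nonneg (y 0 - y 2)
  have s13 := sq_nonneg (y 1 - y 3)
  have s30 := sq_nonneg (y 3 - y 0)
  have s0 := sq_nonneg (0 - y 0)
  have s1 := sq_nonneg (0 - y 1)
  have s2 := sq_nonneg (y 2 - 0)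
  have s3 := sq_nonneg (y 3 - 0)
  have := key (y 0) (hb _ (by linarith)) (y 1) (hb _ (by linarith)) (y 2) (hb _ (by linarith))
    (y 3) (hb _ (by linarith)) h1 h2
  rw [sum_smul_stdVec, h4]
  have h5 : (fun i : Fin 4 => y i.castSucc - 0) = ![y 0, y 1, y 2, y 3] := by
    ext i
    fin_cases i <;> simp
  rw [h5]
  exact this

theorem formValue_neg (A : Matrix (Fin 4) (Fin 4) ℝ) (v : Fin 4 → ℤ) :
    formValue A (-v) = formValue A v := by
  have := formValue_smul A (-1) v
  simpa using this

/-- If both parameters of a pentagonal form are positive, its only minimal vectors are those of the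
superbase and their negatives. -/
theorem IsPentagonal.unitVectors_eq {A : Matrix (Fin 4) (Fin 4) ℝ} {p q : ℝ}
    (h : IsPentagonal A p q stdVec) (hp : 0 < p) (hq : 0 < q) :
    unitVectors A = superbaseVectors := by
  ext w
  constructor
  · intro hw
    have h0 := ne_zero_of_mem_unitVectors hw
    have hy := snoc_ne_const h0
    have h1 : (2 : ℝ) ≤ cyc₁ (Fin.snoc w 0) := by exact_mod_cast two_le_cyc₁ hy
    have h2 : (2 : ℝ) ≤ cyc₂ (Fin.snoc w 0) := by exact_mod_cast two_le_cyc₂ hy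
    have h3 : formValue A w = 1 := hw
    rw [eq_sum_smul_stdVec w, h.form] at h3
    have h4 := h.add_eq
    have e1 : (cyc₁ (Fin.snoc w 0) : ℝ) = 2 := by nlinarith
    have e2 : (cyc₂ (Fin.snoc w 0) : ℝ) = 2 := by nlinarith
    rw [eq_sum_smul_stdVec w]
    exact mem_superbaseVectors_of_cyc (by exact_mod_cast e1) (by exact_mod_cast e2)
      (Fin.snoc_last (α := fun _ => ℤ) 0 w)
  · have key : ∀ i, formValue A (stdVec i) = 1 := fun i => by
      have h1 := h.form (Pi.single i 1)
      have h2 : ∑ j, (Pi.single i 1 : Fin 5 → ℤ) j • stdVec j = stdVec i := by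
        rw [Finset.sum_eq_single i (fun j _ hj => by rw [Pi.single_eq_of_ne hj, zero_smul])
          (by simp), Pi.single_eq_same, one_smul]
      have h3 : ∀ i, cyc₁ (Pi.single i 1) = 2 := by decide
      have h4 : ∀ i, cyc₂ (Pi.single i 1) = 2 := by decide
      rw [h2, h3, h4] at h1
      rw [h1]
      push_cast
      linarith [h.add_eq]
    rintro ⟨i, rfl | rfl⟩
    · exact key i
    · exact (formValue_neg A _).trans (key i)

/-- Multiplication by `2` on `ℤ / 5` exchanges pentagon and pentagram. -/
theorem IsPentagonal.double {A : Matrix (Fin 4) (Fin 4) ℝ} {p q : ℝ} {v : Fin 5 → Fin 4 → ℤ}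
    (h : IsPentagonal A p q v) : IsPentagonal A q p ![v 0, v 2, v 4, v 1, v 3] := by
  refine ⟨h.q_nonneg, h.p_nonneg, by rw [add_comm, h.add_eq], ?_, fun y => ?_⟩
  · rw [← h.sum_eq, Fin.sum_univ_five, Fin.sum_univ_five]
    simp
    abel
  · have h1 := h.form ![y 0, y 3, y 1, y 4, y 2]
    have h2 : ∑ i, (![y 0, y 3, y 1, y 4, y 2] : Fin 5 → ℤ) i • v i =
        ∑ i, y i • (![v 0, v 2, v 4, v 1, v 3] : Fin 5 → Fin 4 → ℤ) i := by
      rw [Fin.sum_univ_five, Fin.sum_univ_five]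
      simp
      abel
    rw [h2] at h1
    rw [h1]
    simp [cyc₁, cyc₂]
    ring

/-! ### Normal forms of cells with a symmetry of order five -/

theorem formValue_single_add (A : Matrix (Fin 4) (Fin 4) ℝ) (i j : Fin 4) :
    formValue A (Pi.single i 1 + Pi.single j 1) = A i i + A i j + A j i + A j j := by
  have h : ∀ i, toReal (Pi.single i 1 : Fin 4 → ℤ) = Pi.single i 1 := fun i => by
    ext k
    simp [toReal, Pi.single_apply]
  rw [formValue, toReal_add, h, h, Matrix.mulVec_add, dotProduct_add, add_dotProduct,
    add_dotProduct]
  simp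
  ring

theorem eq_of_formValue_eq {A B : Matrix (Fin 4) (Fin 4) ℝ} (hA : Aᵀ = A) (hB : Bᵀ = B)
    (h : ∀ v, formValue A v = formValue B v) : A = B := by
  have hA' : ∀ i j, A j i = A i j := fun i j => congrFun (congrFun hA i) j
  have hB' : ∀ i j, B j i = B i j := fun i j => congrFun (congrFun hB i) j
  have hd : ∀ i, A i i = B i i := fun i => by
    have := h (Pi.single i 1 + Pi.single i 1)
    rw [formValue_single_add, formValue_single_add] at this
    linarith
  ext i j
  have := h (Pi.single i 1 + Pi.single j 1)
  rw [formValue_single_add, formValue_single_add, hA' i j, hB' i j, hd, hd] at this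
  linarith

theorem image_face_unitVectors {n : ℕ} (P : SL(n, ℤ)) (A : Matrix (Fin n) (Fin n) ℝ) :
    pslRep n (P : PSL(n, ℤ)) '' face (unitVectors A) =
      face (unitVectors (realMat P * A * (realMat P)ᵀ)) := by
  have key : ∀ (P : SL(n, ℤ)) (A B : Matrix (Fin n) (Fin n) ℝ), B ∈ face (unitVectors A) →
      slRep n P B ∈ face (unitVectors (slRep n P A)) := fun P A B hB => by
    refine ⟨ryshkov_conj P hB.1, fun v hv => ?_⟩
    have hv' : formValue (realMat P * A * (realMat P)ᵀ) v = 1 := hv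
    rw [formValue_conj] at hv'
    exact (formValue_conj P B v).trans (hB.2 _ hv')
  have hinv : ∀ B, slRep n P⁻¹ (slRep n P B) = B := fun B => by
    rw [← Module.End.mul_apply, ← map_mul, inv_mul_cancel, map_one, Module.End.one_apply]
  have hinv' : ∀ B, slRep n P (slRep n P⁻¹ B) = B := fun B => by
    rw [← Module.End.mul_apply, ← map_mul, mul_inv_cancel, map_one, Module.End.one_apply]
  ext B
  constructor
  · rintro ⟨B, hB, rfl⟩
    exact key P A B hB
  · intro hB
    refine ⟨slRep n P⁻¹ B, ?_, hinv' B⟩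
    have := key P⁻¹ _ B hB
    rw [← hinv A]
    exact this

variable {A : Matrix (Fin 4) (Fin 4) ℝ} {p q : ℝ} {v : Fin 5 → Fin 4 → ℤ}

theorem IsPentagonal.sum_smul_eq_vecMul (h : IsPentagonal A p q v) (y : Fin 5 → ℤ) :
    ∑ i, y i • v i =
      (fun i : Fin 4 => y i.castSucc - y 4) ᵥ* Matrix.of fun i : Fin 4 => v i.castSucc := by
  have h1 : ∑ i, y i • v i = ∑ i, (y i - y 4) • v i := by
    simp only [sub_smul, Finset.sum_sub_distrib, ← Finset.smul_sum, h.sum_eq, smul_zero, sub_zero]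
  rw [h1, Fin.sum_univ_castSucc, Matrix.vecMul_eq_sum, show (Fin.last 4) = (4 : Fin 5) from rfl,
    sub_self, zero_smul, add_zero]
  rfl

theorem IsPentagonal.isUnit_det (h : IsPentagonal A p q v) (hA : A ∈ ryshkov 4) :
    IsUnit (Matrix.of fun i : Fin 4 => v i.castSucc).det := by
  have hsurj : ∀ w : Fin 4 → ℤ, ∃ y : Fin 4 → ℤ,
      y ᵥ* Matrix.of (fun i : Fin 4 => v i.castSucc) = w := fun w => by
    obtain ⟨e, rfl⟩ := h.exists_eq_sum hA w
    exact ⟨_, (h.sum_smul_eq_vecMul e).symm⟩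
  choose y hy using hsurj
  have hM : Matrix.of (fun i : Fin 4 => y (Pi.single i 1)) *
      Matrix.of (fun i : Fin 4 => v i.castSucc) = 1 := by
    ext i j
    have := congrFun (hy (Pi.single i 1)) j
    rw [Matrix.one_eq_pi_single]
    exact this
  refine IsUnit.of_mul_eq_one_right (Matrix.of fun i : Fin 4 => y (Pi.single i 1)).det ?_
  rw [← Matrix.det_mul, hM, Matrix.det_one]

theorem IsPentagonal.exists_conj_of_det (h : IsPentagonal A p q v)
    (hdet : (Matrix.of fun i : Fin 4 => v i.castSucc).det = 1) :
    ∃ P : SL(4, ℤ), IsPentagonal (realMat P * A * (realMat P)ᵀ) p q stdVec := by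
  obtain ⟨P, hP⟩ : ∃ P : SL(4, ℤ), (P : Matrix (Fin 4) (Fin 4) ℤ) =
      Matrix.of fun i : Fin 4 => v i.castSucc := ⟨⟨_, hdet⟩, rfl⟩
  refine ⟨P, h.p_nonneg, h.q_nonneg, h.add_eq, sum_stdVec, fun y => ?_⟩
  rw [formValue_conj, ← h.form, sum_smul_stdVec, hP]
  congr 1
  rw [Matrix.mulVec_transpose, h.sum_smul_eq_vecMul]

theorem IsPentagonal.exists_conj (h : IsPentagonal A p q v) (hA : A ∈ ryshkov 4) :
    ∃ P : SL(4, ℤ), ∃ p' q', IsPentagonal (realMat P * A * (realMat P)ᵀ) p' q' stdVec := by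
  rcases Int.isUnit_iff.1 (h.isUnit_det hA) with h1 | h1
  · obtain ⟨P, hP⟩ := h.exists_conj_of_det h1
    exact ⟨P, p, q, hP⟩
  · obtain ⟨P, hP⟩ := h.double.exists_conj_of_det (by
      have hT : (Matrix.of fun i : Fin 4 =>
          (![v 0, v 2, v 4, v 1, v 3] : Fin 5 → Fin 4 → ℤ) i.castSucc) =
          !![1, 0, 0, 0; 0, 0, 1, 0; -1, -1, -1, -1; 0, 1, 0, 0] *
            Matrix.of fun i : Fin 4 => v i.castSucc := by
        have hs := h.sum_eq
        rw [Fin.sum_univ_five] at hs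
        ext i j
        have hj := congrFun hs j
        simp only [Pi.add_apply, Pi.zero_apply] at hj
        fin_cases i <;> simp [Matrix.mul_apply, Fin.sum_univ_four]
        linarith
      rw [hT, Matrix.det_mul, h1]
      decide)
    exact ⟨P, q, p, hP⟩

/-- The pentagon and the pentagram alone give the Gram matrix of the root lattice `A₄`. -/
theorem IsPentagonal.exists_conj_eq_rootForm (h : IsPentagonal A p q stdVec) (hA : Aᵀ = A)
    (h0 : p = 0 ∨ q = 0) : ∃ P : SL(4, ℤ), realMat P * A * (realMat P)ᵀ = rootForm := by
  have key : ∀ M : Matrix (Fin 4) (Fin 4) ℤ, M.det = 1 →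
      (∀ v, formValue A (M *ᵥ v) = formValue rootForm v) →
      ∃ P : SL(4, ℤ), realMat P * A * (realMat P)ᵀ = rootForm := fun M hM hv => by
    obtain ⟨P, hP⟩ : ∃ P : SL(4, ℤ), (P : Matrix (Fin 4) (Fin 4) ℤ) = Mᵀ :=
      ⟨⟨Mᵀ, by rw [Matrix.det_transpose, hM]⟩, rfl⟩
    refine ⟨P, eq_of_formValue_eq ?_ (transpose_eq_of_posDef posDef_rootForm) fun v => ?_⟩
    · rw [Matrix.transpose_mul, Matrix.transpose_mul, Matrix.transpose_transpose, hA,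
        Matrix.mul_assoc]
    · rw [formValue_conj, hP, Matrix.transpose_transpose, hv]
  have hsnoc : ∀ a b c d : ℤ, (Fin.snoc ![a, b, c, d] 0 : Fin 5 → ℤ) = ![a, b, c, d, 0] :=
    fun a b c d => by
      ext i
      fin_cases i <;> rfl
  have hadd := h.add_eq
  rcases h0 with rfl | rfl
  -- The rows express the coordinates through the differences along the path `4, 1, 3, 0, 2`.
  · refine key !![1, 1, 1, 0; 0, 1, 0, 0; 1, 1, 1, 1; 1, 1, 0, 0] (by decide) fun v => ?_
    have hv : !![1, 1, 1, 0; 0, 1, 0, 0; 1, 1, 1, 1; 1, 1, 0, 0] *ᵥ v =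
        ![v 0 + v 1 + v 2, v 1, v 0 + v 1 + v 2 + v 3, v 0 + v 1] := by
      ext i
      fin_cases i <;> simp [Matrix.mulVec, dotProduct, Fin.sum_univ_four]
    rw [eq_sum_smul_stdVec (_ *ᵥ v), h.form, formValue, dotProduct_rootForm, hv, hsnoc]
    obtain rfl : q = 1 / 2 := by linarith
    simp [cyc₂, toReal]
    ring
  -- The rows express the coordinates through the differences along the path `4, 0, 1, 2, 3`.
  · refine key !![1, 0, 0, 0; 1, 1, 0, 0; 1, 1, 1, 0; 1, 1, 1, 1] (by decide) fun v => ?_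
    have hv : !![1, 0, 0, 0; 1, 1, 0, 0; 1, 1, 1, 0; 1, 1, 1, 1] *ᵥ v =
        ![v 0, v 0 + v 1, v 0 + v 1 + v 2, v 0 + v 1 + v 2 + v 3] := by
      ext i
      fin_cases i <;> simp [Matrix.mulVec, dotProduct, Fin.sum_univ_four]
    rw [eq_sum_smul_stdVec (_ *ᵥ v), h.form, formValue, dotProduct_rootForm, hv, hsnoc]
    obtain rfl : p = 1 / 2 := by linarith
    simp [cyc₁, toReal]
    ring

/-- A form with a symmetry of order five lies, up to equivalence, on the face of the superbase or
on that of the root form. -/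
theorem face_unitVectors_of_symmetry (hA : A ∈ ryshkov 4) {P : SL(4, ℤ)} (h5 : P ^ 5 = 1)
    (h1 : P ≠ 1) (hPA : realMat P * A * (realMat P)ᵀ = A) {u : Fin 4 → ℤ} (hu : formValue A u = 1) :
    (∃ g, face (unitVectors A) = pslRep 4 g '' face (unitVectors rootForm)) ∨
      ∃ g, face (unitVectors A) = pslRep 4 g '' face superbaseVectors := by
  have hinv : ∀ (g : PSL(4, ℤ)) (S T : Set (Matrix (Fin 4) (Fin 4) ℝ)), pslRep 4 g '' S = T →
      S = pslRep 4 g⁻¹ '' T := by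
    rintro g S _ rfl
    rw [← Set.image_comp, ← Module.End.coe_mul, ← map_mul, inv_mul_cancel, map_one,
      Module.End.coe_one, Set.image_id]
  obtain ⟨p, q, v, h⟩ := exists_isPentagonal hA h5 h1 hPA hu
  obtain ⟨R, p', q', h'⟩ := h.exists_conj hA
  by_cases h0 : p' = 0 ∨ q' = 0
  · left
    obtain ⟨S, hS⟩ := h'.exists_conj_eq_rootForm
      (transpose_eq_of_posDef (posDef_conj R (mem_ryshkov.1 hA).1)) h0
    refine ⟨((S * R : SL(4, ℤ)) : PSL(4, ℤ))⁻¹, hinv _ _ _ ?_⟩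
    rw [image_face_unitVectors, ← hS]
    congr 2
    rw [realMat_mul, Matrix.transpose_mul]
    simp only [Matrix.mul_assoc]
  · right
    push Not at h0
    refine ⟨(R : PSL(4, ℤ))⁻¹, hinv _ _ _ ?_⟩
    rw [image_face_unitVectors, h'.unitVectors_eq (h'.p_nonneg.lt_of_ne h0.1.symm)
      (h'.q_nonneg.lt_of_ne h0.2.symm)]

end WellRounded

/-! ### The vertex and the five-dimensional cell -/

namespace WellRounded

theorem formValue_single (A : Matrix (Fin 4) (Fin 4) ℝ) (i : Fin 4) :
    formValue A (Pi.single i 1) = A i i := by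
  have h1 := formValue_single_add A i i
  have h2 := formValue_smul A 2 (Pi.single i 1)
  rw [two_smul, h1] at h2
  push_cast at h2
  linarith

theorem isCell_face_unitVectors {A : Matrix (Fin 4) (Fin 4) ℝ} (hA : A ∈ ryshkov 4)
    (hd : ∀ i, A i i = 1) : IsCell (face (unitVectors A)) := by
  refine ⟨⟨A, hA, fun v hv => hv⟩, fun B hB => ?_, _, rfl⟩
  have hB1 : ∀ i : Fin 4, formValue B (Pi.single i 1) = 1 := fun i =>
    hB.2 _ ((formValue_single A i).trans (hd i))
  have hne : (Pi.single 0 1 : Fin 4 → ℤ) ≠ 0 := by decide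
  have hmin : arithMin B = 1 :=
    le_antisymm ((arithMin_le hB.1.1 hne).trans (hB1 0).le) hB.1.2
  refine ⟨⟨hB.1.1, hmin⟩, fun i => Pi.single i 1, fun i => (hB1 i).trans hmin.symm, ?_⟩
  convert Pi.linearIndependent_single_one (Fin 4) ℝ using 2 with i
  ext j
  simp [toReal, Pi.single_apply]

theorem formValue_single_sub (A : Matrix (Fin 4) (Fin 4) ℝ) (i j : Fin 4) :
    formValue A (Pi.single i 1 - Pi.single j 1) = A i i - A i j - A j i + A j j := by
  have h := formValue_parallelogram A (Pi.single i 1) (Pi.single j 1)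
  rw [formValue_single_add, formValue_single, formValue_single] at h
  linarith

theorem rootForm_apply (i j : Fin 4) : rootForm i j = if i = j then 1 else 1 / 2 := by
  fin_cases i <;> fin_cases j <;> simp [rootForm]

theorem face_unitVectors_rootForm : face (unitVectors rootForm) = {rootForm} := by
  refine Set.Subset.antisymm (fun B hB => ?_)
    (Set.singleton_subset_iff.2 ⟨rootForm_mem_ryshkov, fun v hv => hv⟩)
  have hB' : ∀ i j, B j i = B i j := fun i j =>
    congrFun (congrFun (transpose_eq_of_posDef hB.1.1) i) j
  have hd : ∀ i, B i i = 1 := fun i => by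
    rw [← formValue_single B]
    exact hB.2 _ ((formValue_single _ i).trans (by simp [rootForm_apply]))
  rw [Set.mem_singleton_iff]
  ext i j
  by_cases hij : i = j
  · subst hij
    rw [hd, rootForm_apply, if_pos rfl]
  · have h1 := hB.2 _ (show formValue rootForm (Pi.single i 1 - Pi.single j 1) = 1 by
      rw [formValue_single_sub]
      simp [rootForm_apply, hij, Ne.symm hij]
      norm_num)
    rw [formValue_single_sub, hd, hd, hB' i j] at h1
    rw [rootForm_apply, if_neg hij]
    linarith

/-- The vertex of the retract given by the root lattice `A₄`. -/
noncomputable def rootCell : Cell 4 0 :=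
  ⟨face (unitVectors rootForm),
    isCell_face_unitVectors rootForm_mem_ryshkov fun i => by simp [rootForm_apply], by
      rw [face_unitVectors_rootForm, cellDim, vectorSpan_singleton, finrank_bot]⟩

/-- The Gram matrix `(5 I - J) / 4` of the dual of the root lattice `A₄`, scaled to minimum one. -/
noncomputable abbrev dualForm : Matrix (Fin 4) (Fin 4) ℝ := pentagonalForm (1 / 4) (1 / 4)

theorem unitVectors_dualForm : unitVectors dualForm = superbaseVectors :=
  (isPentagonal_pentagonalForm (by norm_num) (by norm_num) (by norm_num)).unitVectors_eq
    (by norm_num) (by norm_num)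

theorem pentagonalForm_apply_self (p q : ℝ) (i : Fin 4) : pentagonalForm p q i i = 1 := by
  fin_cases i <;> simp [pentagonalForm]

theorem mem_face_superbaseVectors {A : Matrix (Fin 4) (Fin 4) ℝ} :
    A ∈ face superbaseVectors ↔ A ∈ ryshkov 4 ∧ (∀ i, A i i = 1) ∧ ∑ i, ∑ j, A i j = 1 := by
  have hlast : formValue A (stdVec 4) = ∑ i, ∑ j, A i j := by
    have : toReal (stdVec 4) = fun _ => -1 := by
      ext i
      fin_cases i <;> simp [toReal, stdVec]
    rw [formValue, this]
    simp [dotProduct, Matrix.mulVec]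
  constructor
  · intro h
    refine ⟨h.1, fun i => ?_, ?_⟩
    · rw [← formValue_single A, ← stdVec_castSucc]
      exact h.2 _ ⟨_, Or.inl rfl⟩
    · rw [← hlast]
      exact h.2 _ ⟨_, Or.inl rfl⟩
  · rintro ⟨h1, h2, h3⟩
    have key : ∀ i, formValue A (stdVec i) = 1 := by
      refine Fin.lastCases ?_ fun i => ?_
      · exact hlast.trans h3
      · rw [stdVec_castSucc, formValue_single, h2]
    refine ⟨h1, ?_⟩
    rintro _ ⟨i, rfl | rfl⟩
    · exact key i
    · rw [formValue_neg, key]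

theorem submatrix_mem_face {A : Matrix (Fin 4) (Fin 4) ℝ} (h : A ∈ face superbaseVectors)
    (σ : Equiv.Perm (Fin 4)) : A.submatrix σ σ ∈ face superbaseVectors := by
  obtain ⟨h1, h2, h3⟩ := mem_face_superbaseVectors.1 h
  refine mem_face_superbaseVectors.2 ⟨mem_ryshkov.2 ⟨?_, fun v hv => ?_⟩, fun i => h2 _, ?_⟩
  · exact h1.1.submatrix σ.injective
  · have h4 : formValue (A.submatrix σ σ) v = formValue A (v ∘ σ.symm) := by
      rw [formValue, formValue, Matrix.submatrix_mulVec_equiv, ← comp_equiv_symm_dotProduct]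
      rfl
    rw [h4]
    refine (mem_ryshkov.1 h1).2 _ fun h0 => hv <| funext fun i => ?_
    simpa using congrFun h0 (σ i)
  · exact (Finset.sum_congr rfl fun i _ => Equiv.sum_comp σ fun j => A (σ i) j).trans
      ((Equiv.sum_comp σ fun i => ∑ j, A i j).trans h3)

/-- The entries above the diagonal, without the last one. -/
def upperEntries : Matrix (Fin 4) (Fin 4) ℝ →ₗ[ℝ] (Fin 5 → ℝ) where
  toFun M := ![M 0 1, M 0 2, M 0 3, M 1 2, M 1 3]
  map_add' M N := by ext i; fin_cases i <;> rfl
  map_smul' c M := by ext i; fin_cases i <;> rfl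

/-- A tangent vector of the face of the superbase is a symmetric matrix with diagonal zero and
sum of entries zero. -/
theorem mem_vectorSpan_face {M : Matrix (Fin 4) (Fin 4) ℝ}
    (hM : M ∈ vectorSpan ℝ (face superbaseVectors)) :
    (∀ i j, M j i = M i j) ∧ (∀ i, M i i = 0) ∧ ∑ i, ∑ j, M i j = 0 := by
  rw [vectorSpan_def] at hM
  induction hM using Submodule.span_induction with
  | mem M h =>
    obtain ⟨A, hA, B, hB, rfl⟩ := h
    obtain ⟨a1, a2, a3⟩ := mem_face_superbaseVectors.1 hA
    obtain ⟨b1, b2, b3⟩ := mem_face_superbaseVectors.1 hB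
    refine ⟨fun i j => ?_, fun i => ?_, ?_⟩
    · exact congrArg₂ (· - ·) (congrFun (congrFun (transpose_eq_of_posDef a1.1) i) j)
        (congrFun (congrFun (transpose_eq_of_posDef b1.1) i) j)
    · change A i i - B i i = 0
      rw [a2, b2, sub_self]
    · change ∑ i, ∑ j, (A i j - B i j) = 0
      simp only [Finset.sum_sub_distrib]
      rw [a3, b3, sub_self]
  | zero => simp
  | add M N _ _ hM hN =>
    refine ⟨fun i j => by rw [Matrix.add_apply, Matrix.add_apply, hM.1, hN.1],
      fun i => by rw [Matrix.add_apply, hM.2.1, hN.2.1, add_zero], ?_⟩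
    simp only [Matrix.add_apply, Finset.sum_add_distrib]
    rw [hM.2.2, hN.2.2, add_zero]
  | smul c M _ hM =>
    refine ⟨fun i j => by rw [Matrix.smul_apply, Matrix.smul_apply, hM.1],
      fun i => by rw [Matrix.smul_apply, hM.2.1, smul_zero], ?_⟩
    simp only [Matrix.smul_apply, ← Finset.smul_sum]
    rw [hM.2.2, smul_zero]

theorem cellDim_face_superbaseVectors : cellDim (face superbaseVectors) = 5 := by
  refine le_antisymm ?_ ?_
  · have hinj : Function.Injective
        (upperEntries.domRestrict (vectorSpan ℝ (face superbaseVectors))) := by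
      rw [injective_iff_map_eq_zero]
      rintro ⟨M, hM⟩ h
      obtain ⟨h1, h2, h3⟩ := mem_vectorSpan_face hM
      have h : ![M 0 1, M 0 2, M 0 3, M 1 2, M 1 3] = 0 := h
      have e0 : M 0 1 = 0 := congrFun h 0
      have e1 : M 0 2 = 0 := congrFun h 1
      have e2 : M 0 3 = 0 := congrFun h 2
      have e3 : M 1 2 = 0 := congrFun h 3
      have e4 : M 1 3 = 0 := congrFun h 4
      have e5 : M 2 3 = 0 := by
        simp only [Fin.sum_univ_four] at h3
        rw [h2, h2, h2, h2, h1 0 1, h1 0 2, h1 0 3, h1 1 2, h1 1 3, h1 2 3, e0, e1, e2, e3,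
          e4] at h3
        linarith
      refine Subtype.ext (Matrix.ext fun i j => ?_)
      change M i j = 0
      fin_cases i <;> fin_cases j <;>
        first | exact h2 _ | assumption | (refine (h1 _ _).trans ?_; assumption)
    have := LinearMap.finrank_le_finrank_of_injective hinj
    rwa [Module.finrank_fin_fun] at this
  · -- The six Hamiltonian paths obtained from `0, 1, 2, 3` by these transpositions give affinely
    -- independent forms.
    let σ : Fin 5 → Equiv.Perm (Fin 4) :=
      ![Equiv.swap 0 1, Equiv.swap 1 2, Equiv.swap 2 3, Equiv.swap 0 2, Equiv.swap 1 3]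
    have hF : pentagonalForm (1 / 2) 0 ∈ face superbaseVectors :=
      mem_face_superbaseVectors.2 ⟨pentagonalForm_mem_ryshkov (by norm_num) le_rfl (by norm_num),
        pentagonalForm_apply_self _ _, by simp [pentagonalForm, Fin.sum_univ_four]; norm_num⟩
    let b : Fin 5 → vectorSpan ℝ (face superbaseVectors) := fun k =>
      ⟨(pentagonalForm (1 / 2) 0).submatrix (σ k) (σ k) - pentagonalForm (1 / 2) 0,
        vsub_mem_vectorSpan ℝ (submatrix_mem_face hF _) hF⟩
    have hb : LinearIndependent ℝ b := by
      rw [Fintype.linearIndependent_iff]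
      intro g hg
      have h : ∀ i j, ∑ k, g k * ((pentagonalForm (1 / 2) 0) (σ k i) (σ k j) -
          pentagonalForm (1 / 2) 0 i j) = 0 := fun i j => by
        have h1 := congrFun (congrFun (congrArg Subtype.val hg) i) j
        simp only [AddSubmonoidClass.coe_finsetSum, Matrix.sum_apply] at h1
        exact h1
      have e1 := h 0 1
      have e2 := h 0 2
      have e3 := h 0 3
      have e4 := h 1 2
      have e5 := h 1 3
      have e6 := h 2 3
      simp [Fin.sum_univ_five, σ, pentagonalForm, Equiv.swap_apply_def] at e1 e2 e3 e4 e5 e6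
      intro i
      fin_cases i <;> simp <;> linarith
    have := hb.fintype_card_le_finrank
    rwa [Fintype.card_fin] at this

/-- The cell of all forms for which the vectors of the superbase are minimal. -/
noncomputable def superbaseCell : Cell 4 5 :=
  ⟨face superbaseVectors, by
    rw [← unitVectors_dualForm]
    exact isCell_face_unitVectors
      (pentagonalForm_mem_ryshkov (by norm_num) (by norm_num) (by norm_num))
      (pentagonalForm_apply_self _ _), cellDim_face_superbaseVectors⟩

/-- Every cell with a symmetry of order five is equivalent to one of the two cells. -/
theorem exists_eq_image_of_orderOf_eq_five {p : ℕ} (C : Cell 4 p) (g : cellStabilizer C)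
    (hg : orderOf g = 5) : (∃ h, C.1 = pslRep 4 h '' rootCell.1) ∨
      ∃ h, C.1 = pslRep 4 h '' superbaseCell.1 := by
  obtain ⟨P, hP, h5, h1⟩ := exists_lift_of_orderOf_eq_five
    (g := (g : PSL(4, ℤ))) (by rw [← hg, Subgroup.orderOf_coe])
  obtain ⟨A, hA, hAC, hPA⟩ := exists_invariant_generic C.2.1
    (slRep_mem_of_stabilizer (by rw [hP]; exact g.2)) (by norm_num) h5
  obtain ⟨v, hv, -⟩ := exists_basis_commonVectors C.2.1
  have hface := eq_face_commonVectors C.2.1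
  have hA' : A ∈ ryshkov 4 := by
    rw [hface] at hA
    exact hA.1
  rw [hface, ← hAC]
  exact face_unitVectors_of_symmetry hA' h5 h1 hPA (hv 0 A hA)

end WellRounded

/-! ### The stabilizers of the two cells -/

namespace WellRounded

open AltFive

/-- The matrix permuting the vectors of the standard superbase. -/
def permMat (σ : Equiv.Perm (Fin 5)) : Matrix (Fin 4) (Fin 4) ℤ :=
  Matrix.of fun i j => stdVec (σ j.castSucc) i

theorem permMat_mulVec_stdVec (σ : Equiv.Perm (Fin 5)) (i : Fin 5) :
    permMat σ *ᵥ stdVec i = stdVec (σ i) := by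
  have h : ∀ j : Fin 4, permMat σ *ᵥ stdVec j.castSucc = stdVec (σ j.castSucc) := fun j => by
    rw [stdVec_castSucc, Matrix.mulVec_single_one]
    rfl
  refine Fin.lastCases ?_ h i
  have h1 : stdVec (Fin.last 4) = -∑ j : Fin 4, stdVec j.castSucc := by decide
  have h2 := sum_stdVec
  rw [← Equiv.sum_comp σ, Fin.sum_univ_castSucc] at h2
  rw [h1, Matrix.mulVec_neg, Matrix.mulVec_sum, Finset.sum_congr rfl fun j _ => h j]
  exact neg_eq_of_add_eq_zero_right h2

theorem eq_of_mulVec_stdVec {M N : Matrix (Fin 4) (Fin 4) ℤ}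
    (h : ∀ i, M *ᵥ stdVec i = N *ᵥ stdVec i) : M = N := by
  ext i j
  have := congrFun (h j.castSucc) i
  rwa [stdVec_castSucc, Matrix.mulVec_single_one, Matrix.mulVec_single_one] at this

set_option maxRecDepth 100000 in
theorem det_permMat (σ : Equiv.Perm (Fin 5)) : (permMat σ).det = Equiv.Perm.sign σ := by
  revert σ
  decide +kernel

/-- The alternating group acting by permutations of the standard superbase. -/
def altRep : A5 →* SL(4, ℤ) where
  toFun σ := ⟨permMat σ.1, by rw [det_permMat, σ.2]; rfl⟩
  map_one' := Subtype.ext <| eq_of_mulVec_stdVec fun i =>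
    (permMat_mulVec_stdVec _ i).trans (Matrix.one_mulVec _).symm
  map_mul' σ τ := Subtype.ext <| eq_of_mulVec_stdVec fun i => by
    change permMat (σ.1 * τ.1) *ᵥ _ = (permMat σ.1 * permMat τ.1) *ᵥ _
    rw [← Matrix.mulVec_mulVec]
    simp only [permMat_mulVec_stdVec]
    rfl

theorem coe_altRep (σ : A5) : (altRep σ : Matrix (Fin 4) (Fin 4) ℤ) = permMat σ.1 := rfl

theorem stdVec_injective : Function.Injective stdVec := by decide

theorem stdVec_ne_neg (i j : Fin 5) : stdVec i ≠ -stdVec j := by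
  revert i j; decide

theorem eq_one_of_permMat_eq_smul {σ : Equiv.Perm (Fin 5)} {r : ℤ} (hr : IsUnit r)
    (h : permMat σ = r • (1 : Matrix (Fin 4) (Fin 4) ℤ)) : σ = 1 := by
  ext i : 1
  have h1 := permMat_mulVec_stdVec σ i
  rw [h, Matrix.smul_mulVec, Matrix.one_mulVec] at h1
  rcases Int.isUnit_iff.1 hr with rfl | rfl
  · rw [one_smul] at h1
    exact (stdVec_injective h1).symm
  · rw [neg_smul, one_smul] at h1
    exact absurd h1.symm (stdVec_ne_neg _ _)

/-- A unimodular matrix preserving the vectors of the superbase up to sign permutes them, up to a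
common sign, by an even permutation. -/
theorem exists_eq_smul_permMat {R : Matrix (Fin 4) (Fin 4) ℤ} (hdet : R.det = 1)
    (h : ∀ w ∈ superbaseVectors, R *ᵥ w ∈ superbaseVectors) :
    ∃ σ : A5, ∃ s : ℤ, IsUnit s ∧ R = s • permMat σ.1 := by
  have h1 : ∀ i, ∃ j : Fin 5, ∃ s : ℤ, IsUnit s ∧ R *ᵥ stdVec i = s • stdVec j := fun i => by
    obtain ⟨j, hj | hj⟩ := h (stdVec i) ⟨i, Or.inl rfl⟩
    · exact ⟨j, 1, isUnit_one, by rw [hj, one_smul]⟩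
    · exact ⟨j, -1, isUnit_one.neg, by rw [hj, neg_smul, one_smul]⟩
  choose f s hs hf using h1
  have hR : Function.Injective fun w : Fin 4 → ℤ => R *ᵥ w :=
    Matrix.mulVec_injective_of_isUnit ((Matrix.isUnit_iff_isUnit_det _).2 (hdet ▸ isUnit_one))
  have hinj : Function.Injective f := fun i j hij => by
    have h2 : R *ᵥ stdVec i = R *ᵥ ((s i * s j) • stdVec j) := by
      rw [Matrix.mulVec_smul, hf i, hf j, smul_smul, mul_assoc, Int.isUnit_mul_self (hs j), mul_one,
        hij]
    have h3 := hR h2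
    rcases Int.isUnit_iff.1 ((hs i).mul (hs j)) with h4 | h4
    · rw [h4, one_smul] at h3
      exact stdVec_injective h3
    · rw [h4, neg_smul, one_smul] at h3
      exact absurd h3 (stdVec_ne_neg _ _)
  let σ : Equiv.Perm (Fin 5) := Equiv.ofBijective f (Finite.injective_iff_bijective.1 hinj)
  -- The vectors of the superbase satisfy only one linear relation, so the signs agree.
  have hsum : ∑ j, s (σ.symm j) • stdVec j = 0 := by
    rw [← Equiv.sum_comp σ]
    simp only [Equiv.symm_apply_apply]
    have h2 : ∀ i, s i • stdVec (σ i) = R *ᵥ stdVec i := fun i => (hf i).symm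
    rw [Finset.sum_congr rfl fun i _ => h2 i, ← Matrix.mulVec_sum, sum_stdVec, Matrix.mulVec_zero]
  rw [sum_smul_stdVec] at hsum
  have hs4 : ∀ j, s (σ.symm j) = s (σ.symm 4) :=
    Fin.lastCases rfl fun j => sub_eq_zero.1 (congrFun hsum j)
  set c := s (σ.symm 4) with hc
  have hRσ : R = c • permMat σ := eq_of_mulVec_stdVec fun i => by
    rw [Matrix.smul_mulVec, permMat_mulVec_stdVec, hf, ← hs4 (σ i), Equiv.symm_apply_apply]
    rfl
  have hcu : IsUnit c := hs _
  refine ⟨⟨σ, ?_⟩, c, hcu, hRσ⟩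
  rw [Equiv.Perm.mem_alternatingGroup]
  rw [hRσ, Matrix.det_smul, Fintype.card_fin, det_permMat] at hdet
  have hc4 : c ^ 4 = 1 := by
    rcases Int.isUnit_iff.1 hcu with h | h <;> rw [h] <;> norm_num
  rw [hc4, one_mul] at hdet
  exact Units.ext hdet

/-- A group of integral matrices isomorphic to its image in `PSL₄(ℤ)` is the stabilizer of a cell
as soon as it contains, up to sign, all matrices that preserve the cell. -/
theorem nonempty_cellStabilizer_mulEquiv {G : Type*} [Group G] {p : ℕ} (C : Cell 4 p)
    (θ : G →* SL(4, ℤ))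
    (hθ : ∀ g, ∀ A ∈ C.1, realMat (θ g) * A * (realMat (θ g))ᵀ ∈ C.1)
    (hinj : ∀ g, ∀ r : ℤ, IsUnit r → (θ g : Matrix (Fin 4) (Fin 4) ℤ) = r • 1 → g = 1)
    (hsurj : ∀ P : SL(4, ℤ), (∀ A ∈ C.1, realMat P * A * (realMat P)ᵀ ∈ C.1) →
      ∃ g, ∃ s : ℤ, IsUnit s ∧
        (P : Matrix (Fin 4) (Fin 4) ℤ) = s • (θ g : Matrix (Fin 4) (Fin 4) ℤ)) :
    Nonempty (cellStabilizer C ≃* G) := by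
  let π : SL(4, ℤ) →* PSL(4, ℤ) := QuotientGroup.mk' _
  have hmem : ∀ g, (π.comp θ) g ∈ cellStabilizer C := fun g => by
    rw [MulAction.mem_stabilizer_iff (G := PSL(4, ℤ)) (α := Cell 4 p)]
    refine Subtype.ext (Set.Subset.antisymm ?_ fun A hA => ?_)
    · rintro _ ⟨A, hA, rfl⟩
      exact hθ g A hA
    · refine ⟨slRep 4 (θ g⁻¹) A, hθ g⁻¹ A hA, ?_⟩
      change slRep 4 (θ g) (slRep 4 (θ g⁻¹) A) = A
      rw [← Module.End.mul_apply, ← map_mul, ← map_mul, mul_inv_cancel, map_one, map_one,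
        Module.End.one_apply]
  let Θ : G →* cellStabilizer C := (π.comp θ).codRestrict _ hmem
  refine ⟨(MulEquiv.ofBijective Θ ⟨?_, ?_⟩).symm⟩
  · rw [injective_iff_map_eq_one]
    intro g hg
    have h1 : ((θ g : SL(4, ℤ)) : PSL(4, ℤ)) = 1 := congrArg Subtype.val hg
    rw [QuotientGroup.eq_one_iff] at h1
    obtain ⟨r, hr, h⟩ := Matrix.SpecialLinearGroup.mem_center_iff.1 h1
    refine hinj g r (IsUnit.of_pow_eq_one hr (by simp)) ?_
    rw [← h, Matrix.scalar_apply, Matrix.smul_one_eq_diagonal]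
  · rintro ⟨x, hx⟩
    obtain ⟨P, rfl⟩ := QuotientGroup.mk_surjective x
    obtain ⟨g, s, hs, h⟩ := hsurj P (slRep_mem_of_stabilizer hx)
    refine ⟨g, Subtype.ext ?_⟩
    change ((θ g : SL(4, ℤ)) : PSL(4, ℤ)) = (P : PSL(4, ℤ))
    rw [QuotientGroup.eq, Matrix.SpecialLinearGroup.mem_center_iff]
    refine ⟨s, ?_, ?_⟩
    · rcases Int.isUnit_iff.1 hs with h | h <;> rw [h] <;> simp
    · rw [Matrix.SpecialLinearGroup.coe_mul, h, Matrix.mul_smul,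
        ← Matrix.SpecialLinearGroup.coe_mul, inv_mul_cancel, Matrix.SpecialLinearGroup.coe_one,
        Matrix.scalar_apply, Matrix.smul_one_eq_diagonal]

theorem permMat_mulVec_mem {σ : Equiv.Perm (Fin 5)} {w : Fin 4 → ℤ} (hw : w ∈ superbaseVectors) :
    permMat σ *ᵥ w ∈ superbaseVectors := by
  obtain ⟨i, rfl | rfl⟩ := hw
  · exact ⟨σ i, Or.inl (permMat_mulVec_stdVec σ i)⟩
  · exact ⟨σ i, Or.inr (by rw [Matrix.mulVec_neg, permMat_mulVec_stdVec])⟩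

theorem nonempty_stabilizer_superbaseCell : Nonempty (cellStabilizer superbaseCell ≃* A5) := by
  let θ : A5 →* SL(4, ℤ) :=
    { toFun := fun σ => (altRep σ⁻¹).transpose
      map_one' := Subtype.ext <| by
        change (permMat (1⁻¹ : A5).1)ᵀ = 1
        rw [inv_one, ← coe_altRep, map_one, Matrix.SpecialLinearGroup.coe_one, Matrix.transpose_one]
      map_mul' := fun σ τ => Subtype.ext <| by
        change ((altRep (σ * τ)⁻¹ : SL(4, ℤ)) : Matrix (Fin 4) (Fin 4) ℤ)ᵀ =
          (altRep σ⁻¹ : Matrix (Fin 4) (Fin 4) ℤ)ᵀ * (altRep τ⁻¹ : Matrix (Fin 4) (Fin 4) ℤ)ᵀ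
        rw [mul_inv_rev, map_mul, Matrix.SpecialLinearGroup.coe_mul, Matrix.transpose_mul] }
  have hθ : ∀ σ, (θ σ : Matrix (Fin 4) (Fin 4) ℤ) = (permMat (σ⁻¹ : A5).1)ᵀ := fun _ => rfl
  refine nonempty_cellStabilizer_mulEquiv superbaseCell θ (fun σ A hA => ?_) (fun σ r hr h => ?_)
    fun P hP => ?_
  · refine ⟨ryshkov_conj _ hA.1, fun v hv => ?_⟩
    rw [formValue_conj, hθ, Matrix.transpose_transpose]
    exact hA.2 _ (permMat_mulVec_mem hv)
  · have h1 := congrArg Matrix.transpose h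
    rw [hθ, Matrix.transpose_transpose, Matrix.transpose_smul, Matrix.transpose_one] at h1
    exact inv_eq_one.1 (Subtype.ext (eq_one_of_permMat_eq_smul hr h1))
  · have hcommon : commonVectors superbaseCell.1 = superbaseVectors := by
      refine Set.Subset.antisymm (fun v hv => ?_) fun v hv A hA => hA.2 v hv
      rw [← unitVectors_dualForm]
      refine hv _ ⟨pentagonalForm_mem_ryshkov (by norm_num) (by norm_num) (by norm_num), ?_⟩
      intro w hw
      rw [← unitVectors_dualForm] at hw
      exact hw
    obtain ⟨σ, s, hs, h⟩ := exists_eq_smul_permMat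
      (R := (P : Matrix (Fin 4) (Fin 4) ℤ)ᵀ) (by rw [Matrix.det_transpose]; exact P.2)
      fun w hw => by
        rw [← hcommon] at hw ⊢
        exact transEquiv_mem_commonVectors hP hw
    refine ⟨σ⁻¹, s, hs, ?_⟩
    rw [hθ, inv_inv, ← Matrix.transpose_smul, ← h, Matrix.transpose_transpose]

theorem rootForm_mul_dualForm :
    rootForm * dualForm = (5 / 8 : ℝ) • (1 : Matrix (Fin 4) (Fin 4) ℝ) := by
  ext i j
  fin_cases i <;> fin_cases j <;>
    simp [rootForm, dualForm, pentagonalForm, Matrix.mul_apply, Fin.sum_univ_four] <;> norm_num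

set_option maxRecDepth 100000 in
/-- Up to a factor, the root form is the sum of the squares of the vectors of the superbase. Hence
it is invariant under their permutations. -/
theorem permMat_conj (σ : Equiv.Perm (Fin 5)) :
    permMat σ * Matrix.of (fun i j : Fin 4 => if i = j then 2 else 1) * (permMat σ)ᵀ =
      Matrix.of (fun i j : Fin 4 => if i = j then 2 else 1) := by
  revert σ
  decide +kernel

theorem nonempty_stabilizer_rootCell : Nonempty (cellStabilizer rootCell ≃* A5) := by
  have hC : rootCell.1 = {rootForm} := face_unitVectors_rootForm
  refine nonempty_cellStabilizer_mulEquiv rootCell altRep (fun σ A hA => ?_) (fun σ r hr h => ?_)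
    fun P hP => ?_
  · rw [hC, Set.mem_singleton_iff] at hA ⊢
    have hR : rootForm = (1 / 2 : ℝ) • (Int.castRingHom ℝ).mapMatrix
        (Matrix.of (fun i j : Fin 4 => if i = j then 2 else 1)) := by
      ext i j
      rw [rootForm_apply]
      by_cases hij : i = j <;> simp [hij]
    have hT : (realMat (altRep σ))ᵀ = (Int.castRingHom ℝ).mapMatrix (permMat σ.1)ᵀ := rfl
    have hM : realMat (altRep σ) = (Int.castRingHom ℝ).mapMatrix (permMat σ.1) := rfl
    rw [hA, hT, hM, hR, Matrix.mul_smul, Matrix.smul_mul, ← map_mul, ← map_mul, permMat_conj]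
  · exact Subtype.ext (eq_one_of_permMat_eq_smul hr h)
  · rw [hC] at hP
    have h1 : realMat P * rootForm * (realMat P)ᵀ = rootForm := hP rootForm rfl
    -- A matrix preserving a form is contragredient to one preserving the inverse form.
    have h2 : (realMat P)ᵀ * dualForm * realMat P = dualForm := by
      have h3 : realMat P * ((8 / 5 : ℝ) • (rootForm * (realMat P)ᵀ * dualForm)) = 1 := by
        rw [Matrix.mul_smul, ← Matrix.mul_assoc, ← Matrix.mul_assoc, h1, rootForm_mul_dualForm,
          smul_smul]
        norm_num
      have h4 := mul_eq_one_comm.1 h3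
      have h5 : dualForm * rootForm = (5 / 8 : ℝ) • (1 : Matrix (Fin 4) (Fin 4) ℝ) := by
        have h6 : ((8 / 5 : ℝ) • rootForm) * dualForm = 1 := by
          rw [Matrix.smul_mul, rootForm_mul_dualForm, smul_smul]
          norm_num
        have h7 := mul_eq_one_comm.1 h6
        rw [Matrix.mul_smul] at h7
        rw [← h7, smul_smul]
        norm_num
      have h8 := congrArg (dualForm * ·) h4
      simp only [Matrix.mul_one, Matrix.smul_mul, Matrix.mul_smul, Matrix.mul_assoc] at h8
      rw [← Matrix.mul_assoc dualForm, h5, Matrix.smul_mul, Matrix.one_mul, smul_smul] at h8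
      norm_num at h8
      rw [Matrix.mul_assoc]
      exact h8
    refine exists_eq_smul_permMat P.2 fun w hw => ?_
    rw [← unitVectors_dualForm] at hw ⊢
    have h3 := formValue_conj P.transpose dualForm w
    have h4 : realMat P.transpose = (realMat P)ᵀ := rfl
    rw [h4, Matrix.transpose_transpose, h2] at h3
    exact h3.symm.trans hw

end WellRounded

theorem proposition5 :
    (∀ k : ℕ, Nonempty (WellRounded.E1 5 4 0 (3 + 4 * k) ≃+ ZMod 5)) ∧
    (∀ k : ℕ, Nonempty (WellRounded.E1 5 4 5 (3 + 4 * k) ≃+ ZMod 5)) ∧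
    (∀ p q : ℕ, ¬ ((p = 0 ∨ p = 5) ∧ ∃ k : ℕ, q = 3 + 4 * k) →
      Subsingleton (WellRounded.E1 5 4 p q)) ∧
    (∀ p : ℕ, p = 0 ∨ p = 5 → ∃ C : WellRounded.Cell 4 p, ∀ D : WellRounded.Cell 4 p,
      Nonempty (WellRounded.cellStabilizer D ≃* alternatingGroup (Fin 5)) ↔
        ∃ g : Matrix.ProjectiveSpecialLinearGroup (Fin 4) ℤ, g • C = D) ∧
    (∀ (p q : ℕ) (C : WellRounded.Cell 4 p), Nontrivial (WellRounded.cellTerm 5 C q) →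
      (p = 0 ∨ p = 5) ∧
        Nonempty (WellRounded.cellStabilizer C ≃* alternatingGroup (Fin 5))) := by
  obtain ⟨e₀⟩ := WellRounded.nonempty_stabilizer_rootCell
  obtain ⟨e₅⟩ := WellRounded.nonempty_stabilizer_superbaseCell
  exact WellRounded.spectralSequence_of_cells (fun _ _ => inferInstance) e₀ e₅
    fun _ C g hg => WellRounded.exists_eq_image_of_orderOf_eq_five C g hg
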